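/- **Setting.** Let $\mathbf J'=T_1\Join\cdots\Join T_m$ be an acyclic natural join of $m$ tables (relations with pairwise distinct real-valued rows) over $d\ge 1$ columns in total, whose largest table has $n\ge 1$ rows. Acyclic means that by repeatedly removing a column that lies in only one remaining table, or a table whose remaining columns are contained in those of another remaining table, one can reach a single table without columns. Assign each column to one table containing it. Let $D_i$ be the set of distinct projections of the rows of $T_i$ to the columns assigned to $T_i$, and let $\mathbf J$ be the matrix with $d$ columns and with one row for each element of $D_1\times\cdots\times D_m$, which is the corresponding tuple if that tuple is in $\mathbf J'$, and zero otherwise. Write $F(\mathbf J')$ for $F(\mathbf J)$. **Multiplication order.** Fix a run of the algorithm Inside-Out on the join, that is, a reduction sequence as above, in which removing a column sums it out of the factor of its table, and removing a table multiplies its factor (on the left or on the right) into the factor of a table containing its columns. Let $\rho$ be the resulting binary expression tree, which has one leaf per table. **DB-Sketch.** An $(m,\rho)$-DB-Sketch consists of a set $R$ with binary operations $\oplus$ and $\odot$, a map $F$ from the real $(D_1\times\cdots\times D_m)\times d$ matrices to $R$, and maps $F_i$ from the real $D_i\times c$ matrices to $R$ (for all $i\le m$ and all $c$), such that 1. $\oplus$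 is commutative and associative, and $F(A+B)=F(A)\oplus F(B)$ for all $A,B$; 2. $F(A_1\otimes\cdots\otimes A_m)=F_1(A_1)\odot\cdots\odot F_m(A_m)$, evaluated in the order $\rho$, for every Kronecker product with $d$ columns of matrices $A_i$ with row sets $D_i$; and $F_i(A+B)=F_i(A)\oplus F_i(B)$ for all $i,A,B$; 3. $a\odot(b\oplus c)=(a\odot b)\oplus(a\odot c)$ and $(b\oplus c)\odot a=(b\odot a)\oplus(c\odot a)$ for all $a,b,c\in R$. **Machine.** Consider a unit-cost random access machine with random access to the entries of the tables, to the schema, to the assignment of the columns and to the reduction sequence. It can compare real numbers, and sketches are opaque objects. One $\oplus$ takes time $T_\oplus\ge 1$, one $\odot$ takes time $T_\odot\ge 1$, and evaluating $F_i$ on a matrix $A$ given as a list of entries takes time $T_f\cdot\mathrm{nnz}(A)$ (plus the time for reading the list), where $\mathrm{nnz}(A)$ is the number of nonzero entries of $A$. **Theorem.** There is a single algorithm that, for every acyclic join, every such reduction sequence with multiplication order $\rho$ and every $(m,\rho)$-DB-Sketch, evaluates $F(\mathbf J')$ in time $$O\big(m\,(T_\odot+T_\oplus)\,T_{\mathrm{FAQ}}+T_f\,mnd\big),$$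 where $T_{\mathrm{FAQ}}=m\,d^2\,n\,(1+\log n)$ is the running time of Inside-Out on one single-semiring functional aggregate query over an acyclic join with operators of unit cost, and the implied constant is absolute. -/

import Mathlib

/-! ### Join queries -/

/-- A natural join `T₁ ⋈ ⋯ ⋈ T_m` with `m` tables over `d` columns in total.  Table `i` has the
set of columns `cols i` and `size i` rows; it is a relation, so its rows are pairwise distinct.
Every column `c` is assigned to one table `owner c` that contains it. -/
structure JoinQuery (m d : ℕ) where
  cols : Fin m → Finset (Fin d)
  owner : Fin d → Fin m
  owner_mem : ∀ c, c ∈ cols (owner c)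
  size : Fin m → ℕ
  table : ∀ i, Fin (size i) → {c // c ∈ cols i} → ℝ
  distinct : ∀ i, Function.Injective (table i)

namespace JoinQuery

variable {m d : ℕ}

/-- The number `n` of rows of the largest table. -/
def maxSize (Q : JoinQuery m d) : ℕ := Finset.univ.sup Q.size

/-- The set of tuples of the natural join: every projection to the columns of a table is a row of
that table. -/
def joinSet (Q : JoinQuery m d) : Set (Fin d → ℝ) :=
  {x | ∀ i, ∃ r : Fin (Q.size i), ∀ c : {c // c ∈ Q.cols i}, x c.1 = Q.table i r c}

/-- The projection of row `r` of table `i` to the columns that are assigned to table `i`. -/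
def rowProj (Q : JoinQuery m d) (i : Fin m) (r : Fin (Q.size i)) : {c // Q.owner c = i} → ℝ :=
  fun c => Q.table i r ⟨c.1, by have h := Q.owner_mem c.1; rwa [c.2] at h⟩

/-- The domain `D_i`: the projection of table `i` to the columns that are assigned to it. -/
def Dom (Q : JoinQuery m d) (i : Fin m) : Type :=
  {y : {c // Q.owner c = i} → ℝ // ∃ r, Q.rowProj i r = y}

/-- The element of `D_i` given by row `r` of table `i`. -/
def domOf (Q : JoinQuery m d) (i : Fin m) (r : Fin (Q.size i)) : Q.Dom i :=
  ⟨Q.rowProj i r, r, rfl⟩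

/-- The tuple over all columns that is described by an element of `D₁ × ⋯ × D_m`. -/
def glue (Q : JoinQuery m d) (y : ∀ i, Q.Dom i) : Fin d → ℝ :=
  fun c => (y (Q.owner c)).1 ⟨c, rfl⟩

open Classical in
/-- The matrix of the join: it has a row for every element of `D₁ × ⋯ × D_m`, which holds the
corresponding tuple if that tuple is in the join, and is zero otherwise. -/
noncomputable def joinMatrix (Q : JoinQuery m d) : Matrix (∀ i, Q.Dom i) (Fin d) ℝ :=
  Matrix.of fun y c => if Q.glue y ∈ Q.joinSet then Q.glue y c else 0

end JoinQuery

/-! ### Acyclicity and multiplication orders -/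

/-- One reduction step on the schema of a join, which consists of the remaining tables and their
remaining columns: remove a column that is in only one of the tables, or remove a table whose
columns are all contained in another table. -/
inductive ReductionStep {m d : ℕ} :
    Finset (Fin m) × (Fin m → Finset (Fin d)) → Finset (Fin m) × (Fin m → Finset (Fin d)) → Prop
  | removeColumn (live : Finset (Fin m)) (cols : Fin m → Finset (Fin d)) (i : Fin m) (c : Fin d)
      (hi : i ∈ live) (hc : c ∈ cols i) (honly : ∀ j ∈ live, c ∈ cols j → j = i) :
      ReductionStep (live, cols) (live, Function.update cols i ((cols i).erase c))
  | removeTable (live : Finset (Fin m)) (cols : Fin m → Finset (Fin d)) (i j : Fin m)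
      (hi : i ∈ live) (hj : j ∈ live) (hij : i ≠ j) (hsub : cols i ⊆ cols j) :
      ReductionStep (live, cols) (live.erase i, cols)

/-- The join is acyclic: the reduction steps can remove all columns, and all tables but one (which
then has no columns left). -/
def JoinQuery.Acyclic {m d : ℕ} (Q : JoinQuery m d) : Prop :=
  ∃ (k : Fin m) (cols : Fin m → Finset (Fin d)),
    Relation.ReflTransGen ReductionStep (Finset.univ, Q.cols) ({k}, cols) ∧ cols k = ∅

/-- Binary expression trees whose leaves are tables. -/
inductive MulTree (m : ℕ) : Type
  | leaf (i : Fin m) : MulTree m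
  | node (l r : MulTree m) : MulTree m

/-- The value of an expression tree, with `mul` at the inner nodes and `g i` at leaf `i`. -/
def MulTree.eval {m : ℕ} {R : Type*} (mul : R → R → R) (g : Fin m → R) : MulTree m → R
  | .leaf i => g i
  | .node l r => mul (l.eval mul g) (r.eval mul g)

/-- The elimination steps of Inside-Out on an acyclic join.  `sumOut i c` sums column `c` out of the
factor of table `i`; `absorb i j b` multiplies the factor of table `i` into that of table `j`, on
the left if `b` is true and on the right otherwise. -/
inductive PlanStep (m d : ℕ) : Type
  | sumOut (i : Fin m) (c : Fin d) : PlanStep m d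
  | absorb (i j : Fin m) (b : Bool) : PlanStep m d

/-- `PlanRun cols plan live cols' tree`: Inside-Out can perform the elimination steps `plan` on the
schema `cols`, which leaves the factors of the tables in `live`, over the columns `cols'`, and the
current factor of table `i` is a product of input factors in the order of `tree i`. The steps are
those of `ReductionStep`. -/
inductive PlanRun {m d : ℕ} (cols : Fin m → Finset (Fin d)) :
    List (PlanStep m d) → Finset (Fin m) → (Fin m → Finset (Fin d)) → (Fin m → MulTree m) → Prop
  | start : PlanRun cols [] Finset.univ cols MulTree.leaf
  | sumOut {plan : List (PlanStep m d)} {live : Finset (Fin m)} {cols' : Fin m → Finset (Fin d)}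
      {tree : Fin m → MulTree m} (h : PlanRun cols plan live cols' tree) (i : Fin m) (c : Fin d)
      (hi : i ∈ live) (hc : c ∈ cols' i) (honly : ∀ j ∈ live, c ∈ cols' j → j = i) :
      PlanRun cols (plan ++ [PlanStep.sumOut i c]) live
        (Function.update cols' i ((cols' i).erase c)) tree
  | absorb {plan : List (PlanStep m d)} {live : Finset (Fin m)} {cols' : Fin m → Finset (Fin d)}
      {tree : Fin m → MulTree m} (h : PlanRun cols plan live cols' tree) (i j : Fin m) (b : Bool)
      (hi : i ∈ live) (hj : j ∈ live) (hij : i ≠ j) (hsub : cols' i ⊆ cols' j) :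
      PlanRun cols (plan ++ [PlanStep.absorb i j b]) (live.erase i) cols'
        (Function.update tree j
          (if b then MulTree.node (tree i) (tree j) else MulTree.node (tree j) (tree i)))

/-- `ρ` is the multiplication order of the join for the run `plan` of Inside-Out, which eliminates
all columns and leaves a single factor. -/
def JoinQuery.IsMulOrder {m d : ℕ} (Q : JoinQuery m d) (plan : List (PlanStep m d))
    (ρ : MulTree m) : Prop :=
  ∃ (k : Fin m) (cols' : Fin m → Finset (Fin d)) (tree : Fin m → MulTree m),
    PlanRun Q.cols plan {k} cols' tree ∧ cols' k = ∅ ∧ tree k = ρ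

/-- A join has a multiplication order if and only if it is acyclic. -/
theorem JoinQuery.acyclic_iff_exists_isMulOrder {m d : ℕ} (Q : JoinQuery m d) :
    Q.Acyclic ↔ ∃ plan ρ, Q.IsMulOrder plan ρ := by
  constructor
  · rintro ⟨k, cols, h, hk⟩
    have key : ∀ s, Relation.ReflTransGen ReductionStep (Finset.univ, Q.cols) s →
        ∃ plan tree, PlanRun Q.cols plan s.1 s.2 tree := by
      intro s hs
      induction hs with
      | refl => exact ⟨_, _, PlanRun.start⟩
      | tail _ hst ih =>
        obtain ⟨plan, tree, hrun⟩ := ih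
        cases hst with
        | removeColumn live cols i c hi hc honly => exact ⟨_, _, hrun.sumOut i c hi hc honly⟩
        | removeTable live cols i j hi hj hij hsub =>
          exact ⟨_, _, hrun.absorb i j false hi hj hij hsub⟩
    obtain ⟨plan, tree, hrun⟩ := key _ h
    exact ⟨plan, tree k, k, cols, tree, hrun, hk, rfl⟩
  · rintro ⟨plan, ρ, k, cols', tree, hrun, hk, -⟩
    refine ⟨k, cols', ?_, hk⟩
    clear hk
    generalize ({k} : Finset (Fin m)) = live at hrun
    induction hrun with
    | start => exact Relation.ReflTransGen.refl
    | sumOut _ i c hi hc honly ih => exact ih.tail (ReductionStep.removeColumn _ _ i c hi hc honly)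
    | absorb _ i j b hi hj hij hsub ih =>
      exact ih.tail (ReductionStep.removeTable _ _ i j hi hj hij hsub)

/-! ### DB-Sketches -/

/-- The Kronecker product of matrices `A i` with row sets `D i` and with `c i` columns, as a matrix
with `d` columns. Rows are indexed by tuples; the columns come in the usual (lexicographic) order
of a Kronecker product, which the unique order isomorphism `σ` numbers. -/
def kroneckerProduct {m d : ℕ} {D : Fin m → Type} {c : Fin m → ℕ}
    (σ : (Πₗ i, Fin (c i)) ≃o Fin d) (A : ∀ i, Matrix (D i) (Fin (c i)) ℝ) :
    Matrix (∀ i, D i) (Fin d) ℝ :=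
  Matrix.of fun x y => ∏ i, A i (x i) (ofLex (σ.symm y) i)

/-- An `(m, ρ)`-DB-Sketch for the join `Q`, with sketches in `R`: the sketch `F` of matrices of the
format of the join matrix, the sketches `part i` of the `i`-th factors of Kronecker products (for
every number of columns), and the operators `add` (written `⊕`) and `mul` (written `⊙`) on
sketches. -/
structure DBSketch {m d : ℕ} (Q : JoinQuery m d) (ρ : MulTree m) (R : Type*) where
  F : Matrix (∀ i, Q.Dom i) (Fin d) ℝ → R
  part : ∀ (i : Fin m) (c : ℕ), Matrix (Q.Dom i) (Fin c) ℝ → R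
  add : R → R → R
  mul : R → R → R
  add_comm : ∀ a b, add a b = add b a
  add_assoc : ∀ a b c, add (add a b) c = add a (add b c)
  map_add : ∀ A B, F (A + B) = add (F A) (F B)
  map_kronecker : ∀ (c : Fin m → ℕ) (σ : (Πₗ i, Fin (c i)) ≃o Fin d)
    (A : ∀ i, Matrix (Q.Dom i) (Fin (c i)) ℝ),
    F (kroneckerProduct σ A) = ρ.eval mul fun i => part i (c i) (A i)
  part_add : ∀ i c A B, part i c (A + B) = add (part i c A) (part i c B)
  mul_add : ∀ a b c, mul a (add b c) = add (mul a b) (mul a c)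
  add_mul : ∀ a b c, mul (add a b) c = add (mul a c) (mul b c)

/-! ### The machine model

A unit-cost random access machine, programmed in a structured language.  It has number registers,
arrays of numbers with two indices, registers for reals, arrays of sketches with two indices, and
a buffer that holds a sparse matrix as a list of entries.  Sketches are opaque: they are only
produced and combined by the three operations of a DB-Sketch. All loops are bounded, which is no
more than a restriction on the programs. -/

/-- Expressions for natural numbers. `sub` is truncated, `half` is division by two rounded down, and
`le`, `eq` have the value `1` (true) or `0` (false). -/
inductive NatExp : Type
  | const (k : ℕ) : NatExp
  | var (x : ℕ) : NatExp
  | get (a : ℕ) (i j : NatExp) : NatExp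
  | add (e f : NatExp) : NatExp
  | sub (e f : NatExp) : NatExp
  | half (e : NatExp) : NatExp
  | le (e f : NatExp) : NatExp
  | eq (e f : NatExp) : NatExp

/-- A cell of the array of sketches with name `name`. -/
structure SketchCell where
  name : ℕ
  row : NatExp
  col : NatExp

/-- Programs. -/
inductive Prog : Type
  | skip : Prog
  /-- number register `x` := `e` -/
  | assign (x : ℕ) (e : NatExp) : Prog
  /-- number array cell `a[i, j]` := `e` -/
  | store (a : ℕ) (i j e : NatExp) : Prog
  /-- real register `x` := the entry of table `i` in row `r` and column `c` -/
  | read (x : ℕ) (i r c : NatExp) : Prog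
  /-- real register `x` := `1` -/
  | one (x : ℕ) : Prog
  /-- number register `z` := `1` if real register `x` is at most real register `y`, else `0` -/
  | compare (z x y : ℕ) : Prog
  /-- empty the buffer -/
  | clear : Prog
  /-- append to the buffer the entry with the value of real register `x`, in column `c` and in the
  row that belongs to row `r` of the table -/
  | push (r c : NatExp) (x : ℕ) : Prog
  /-- `u` := the sketch `F_i` of the matrix with `c` columns in the buffer -/
  | sketch (u : SketchCell) (i c : NatExp) : Prog
  | copy (u v : SketchCell) : Prog
  /-- `u` := `v ⊕ w` -/
  | sketchAdd (u v w : SketchCell) : Prog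
  /-- `u` := `v ⊙ w` -/
  | sketchMul (u v w : SketchCell) : Prog
  | seq (p q : Prog) : Prog
  /-- if `e` is nonzero then `p` else `q` -/
  | ite (e : NatExp) (p q : Prog) : Prog
  /-- for `x = 0, …, e - 1` do `p`, where `e` is evaluated once, before the loop -/
  | loop (x : ℕ) (e : NatExp) (p : Prog) : Prog

/-- States of the machine. A cell that holds no sketch has the value `none`. -/
structure MachineState (R : Type*) where
  var : ℕ → ℕ
  arr : ℕ → ℕ → ℕ → ℕ
  real : ℕ → ℝ
  buf : List (ℕ × ℕ × ℝ)
  sk : ℕ → ℕ → ℕ → Option R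

/-- The number of operations of an expression. -/
def NatExp.cost : NatExp → ℕ
  | .const _ => 1
  | .var _ => 1
  | .get _ i j => 1 + i.cost + j.cost
  | .add e f => 1 + e.cost + f.cost
  | .sub e f => 1 + e.cost + f.cost
  | .half e => 1 + e.cost
  | .le e f => 1 + e.cost + f.cost
  | .eq e f => 1 + e.cost + f.cost

/-- The value of an expression. -/
def NatExp.eval {R : Type*} (s : MachineState R) : NatExp → ℕ
  | .const k => k
  | .var x => s.var x
  | .get a i j => s.arr a (i.eval s) (j.eval s)
  | .add e f => e.eval s + f.eval s
  | .sub e f => e.eval s - f.eval s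
  | .half e => e.eval s / 2
  | .le e f => if e.eval s ≤ f.eval s then 1 else 0
  | .eq e f => if e.eval s = f.eval s then 1 else 0

/-- The cost of the address of a cell. -/
def SketchCell.cost (u : SketchCell) : ℕ := u.row.cost + u.col.cost

/-- The content of a cell. -/
def SketchCell.value {R : Type*} (u : SketchCell) (s : MachineState R) : Option R :=
  s.sk u.name (u.row.eval s) (u.col.eval s)

namespace MachineState

variable {R : Type*}

/-- Write a number register. -/
def setVar (s : MachineState R) (x v : ℕ) : MachineState R :=
  { s with var := Function.update s.var x v }

/-- Write a cell of a number array. -/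
def setArr (s : MachineState R) (a i j v : ℕ) : MachineState R :=
  { s with arr := fun a' i' j' => if a' = a ∧ i' = i ∧ j' = j then v else s.arr a' i' j' }

/-- Write a real register. -/
def setReal (s : MachineState R) (x : ℕ) (v : ℝ) : MachineState R :=
  { s with real := Function.update s.real x v }

/-- Write a cell of an array of sketches. -/
def setCell (s : MachineState R) (u : SketchCell) (v : Option R) : MachineState R :=
  { s with sk := fun a i j =>
      if a = u.name ∧ i = u.row.eval s ∧ j = u.col.eval s then v else s.sk a i j }

end MachineState

namespace JoinQuery

variable {m d : ℕ}

/-- Random access to the entries of the tables (`0` outside of the tables). -/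
def entry (Q : JoinQuery m d) (i r c : ℕ) : ℝ :=
  if h : ∃ (hi : i < m) (hc : c < d), r < Q.size ⟨i, hi⟩ ∧ (⟨c, hc⟩ : Fin d) ∈ Q.cols ⟨i, hi⟩ then
    Q.table ⟨i, h.1⟩ ⟨r, h.2.2.1⟩ ⟨⟨c, h.2.1⟩, h.2.2.2⟩
  else 0

open Classical in
/-- The matrix with row set `D_i` and `c` columns that is described by a list of entries `(r, k, v)`:
the value `v` in column `k` and in the row of `D_i` given by row `r` of table `i`. Entries in the
same position are added up, entries outside of the format are ignored. -/
noncomputable def bufferMatrix (Q : JoinQuery m d) (i : Fin m) (c : ℕ) (buf : List (ℕ × ℕ × ℝ)) :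
    Matrix (Q.Dom i) (Fin c) ℝ :=
  (buf.map fun e =>
    if h : e.1 < Q.size i ∧ e.2.1 < c then
      Matrix.single (Q.domOf i ⟨e.1, h.1⟩) (⟨e.2.1, h.2⟩ : Fin c) e.2.2
    else 0).sum

/-- The encoding of one elimination step by four numbers. -/
def planCode : PlanStep m d → ℕ → ℕ
  | .sumOut _ _, 0 => 0
  | .sumOut i _, 1 => i
  | .sumOut _ c, 2 => c
  | .absorb _ _ _, 0 => 1
  | .absorb i _ _, 1 => i
  | .absorb _ j _, 2 => j
  | .absorb _ _ b, 3 => if b then 1 else 0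
  | _, _ => 0

/-- The initial state. The number registers `0`, `1`, `2` hold `m`, `d` and the number of elimination
steps; the number arrays `0`, `1`, `2`, `3` hold the sizes of the tables, the incidence matrix of
tables and columns, the assignment of the columns to tables, and the elimination steps. -/
def initState (Q : JoinQuery m d) (plan : List (PlanStep m d)) (R : Type*) : MachineState R where
  var := fun x =>
    match x with
    | 0 => m
    | 1 => d
    | 2 => plan.length
    | _ => 0
  arr := fun a i j =>
    match a with
    | 0 => if h : i < m then Q.size ⟨i, h⟩ else 0
    | 1 => if ∃ (hi : i < m) (hj : j < d), (⟨j, hj⟩ : Fin d) ∈ Q.cols ⟨i, hi⟩ then 1 else 0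
    | 2 => if h : i < d then (Q.owner ⟨i, h⟩ : ℕ) else 0
    | 3 => if h : i < plan.length then planCode plan[i] j else 0
    | _ => 0
  real := fun _ => 0
  buf := []
  sk := fun _ _ _ => none

end JoinQuery

/-- The number of nonzero entries of a matrix. -/
noncomputable def nnz {ι κ : Type*} (A : Matrix ι κ ℝ) : ℕ :=
  {p : ι × κ | A p.1 p.2 ≠ 0}.ncard

/-- The costs of the sketch operations: `add` for one `⊕`, `mul` for one `⊙`, and `sketch` for every
nonzero entry of the argument of some `F_i`. -/
structure SketchCosts where
  add : ℕ
  mul : ℕ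
  sketch : ℕ

open Classical in
/-- The execution of a program on the join `Q` with a DB-Sketch `S`: the final state and the time. -/
noncomputable def Prog.run {m d : ℕ} {Q : JoinQuery m d} {ρ : MulTree m} {R : Type*}
    (S : DBSketch Q ρ R) (K : SketchCosts) : Prog → MachineState R → MachineState R × ℕ
  | .skip => fun s => (s, 1)
  | .assign x e => fun s => (s.setVar x (e.eval s), 1 + e.cost)
  | .store a i j e => fun s =>
      (s.setArr a (i.eval s) (j.eval s) (e.eval s), 1 + i.cost + j.cost + e.cost)
  | .read x i r c => fun s =>
      (s.setReal x (Q.entry (i.eval s) (r.eval s) (c.eval s)), 1 + i.cost + r.cost + c.cost)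
  | .one x => fun s => (s.setReal x 1, 1)
  | .compare z x y => fun s => (s.setVar z (if s.real x ≤ s.real y then 1 else 0), 1)
  | .clear => fun s => ({ s with buf := [] }, 1)
  | .push r c x => fun s =>
      ({ s with buf := s.buf ++ [(r.eval s, c.eval s, s.real x)] }, 1 + r.cost + c.cost)
  | .sketch u i c => fun s =>
      if h : i.eval s < m then
        let A := Q.bufferMatrix ⟨i.eval s, h⟩ (c.eval s) s.buf
        (s.setCell u (some (S.part ⟨i.eval s, h⟩ (c.eval s) A)),
          1 + u.cost + i.cost + c.cost + s.buf.length + K.sketch * nnz A)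
      else (s, 1 + u.cost + i.cost + c.cost)
  | .copy u v => fun s => (s.setCell u (v.value s), 1 + u.cost + v.cost)
  | .sketchAdd u v w => fun s =>
      (s.setCell u (Option.map₂ S.add (v.value s) (w.value s)),
        1 + u.cost + v.cost + w.cost + K.add)
  | .sketchMul u v w => fun s =>
      (s.setCell u (Option.map₂ S.mul (v.value s) (w.value s)),
        1 + u.cost + v.cost + w.cost + K.mul)
  | .seq p q => fun s =>
      let s₁ := p.run S K s
      let s₂ := q.run S K s₁.1
      (s₂.1, s₁.2 + s₂.2)
  | .ite e p q => fun s =>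
      let s₁ := if e.eval s ≠ 0 then p.run S K s else q.run S K s
      (s₁.1, 1 + e.cost + s₁.2)
  | .loop x e p => fun s =>
      Nat.rec (s, 1 + e.cost)
        (fun k t =>
          let t' := p.run S K (t.1.setVar x k)
          (t'.1, t.2 + 1 + t'.2))
        (e.eval s)

/-- The running time `m d² n (1 + log n)` of Inside-Out for one single-semiring functional aggregate
query over an acyclic join, with operators of unit cost; it is `m d² n ^ fhtw (1 + log n)`, where
the fractional hypertree width `fhtw` of an acyclic join is `1`. -/
def JoinQuery.faqTime {m d : ℕ} (Q : JoinQuery m d) : ℕ :=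
  m * d ^ 2 * Q.maxSize * (1 + Nat.log 2 Q.maxSize)

/-! ### Sketches with a formal zero -/

/-! Every tuple of the join comes from exactly one choice of a row in each table such that the
chosen rows agree on common columns. Hence the join matrix is a sum, over the columns `k` and over
these consistent choices, of matrices with at most one nonzero entry. Each of them is a Kronecker
product of single-entry matrices: the factor of the table that owns `k` has `d` columns and holds
the entry in column `k`, every other factor has one column and holds a `1`. Additivity and the
Kronecker rule turn the sketch of the join into a sum of `⊙`-products of sketches `F_i` of
single-entry matrices (`JoinQuery.sum_sketch_eq`).

Sketches have no zero, so a formal zero `none` is adjoined, which gives a distributive structure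
without associativity or commutativity of `⊙`. An empty sum would not be a sketch; therefore every
column also contributes the product of the `F_i(0)`. This is `F(0)`, which `F(A) = F(A + 0)`
absorbs.

For a fixed column the sum over consistent choices is a functional aggregate query. During
Inside-Out, the value attached to row `e` of a live table `j` is the sum over the consistent choices
of rows for all tables already multiplied into `j` that use `e` (`tupleSum`). The reduction rules
preserve a running intersection property (`PlanRun.schemaInv`): a column shared by two groups of
tables is still present in both representatives. So when `i` is absorbed into `j`, consistency
across the two groups is agreement of the two representing rows on the current columns of `i`, and
distributivity alone gives the new values (`tupleSum_join`). The products are formed in the order of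
the tree throughout. Summing out a column needs no arithmetic: values stay attached to rows, and
grouping by the remaining columns is left to the next absorption or the final sum.

For the running time, each column is merge sorted once and its real values are replaced by integers
(`Prog.prepare_spec`). A table of pairs then computes keys of rows with constant work per row and
column. There are `N ≤ m n` rows in all; one absorption costs `O(d N)` steps and `O(N)` sketch
operations, and each of the `d` columns needs fewer than `m` absorptions. Only the `d N`
single-entry sketches are charged to `T_f`. -/

namespace DBSketch

variable {m d : ℕ} {Q : JoinQuery m d} {ρ : MulTree m} {R : Type*}

/-- Sketches together with a formal zero `none`. -/
def Val (_S : DBSketch Q ρ R) : Type _ := Option R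

instance (S : DBSketch Q ρ R) : Zero S.Val := ⟨none⟩

instance (S : DBSketch Q ρ R) : Add S.Val := ⟨Option.merge S.add⟩

instance (S : DBSketch Q ρ R) : Mul S.Val := ⟨Option.map₂ S.mul⟩

/-- Nothing is known about `⊙` beyond distributivity, so this is the strongest available structure.
The zero is neutral for `⊕` and absorbing for `⊙`. -/
instance (S : DBSketch Q ρ R) : NonUnitalNonAssocSemiring S.Val where
  nsmul := nsmulRec
  add_assoc := by
    rintro (_ | a) (_ | b) (_ | c) <;> first | rfl | exact congrArg some (S.add_assoc a b c)
  zero_add := by rintro (_ | a) <;> rfl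
  add_zero := by rintro (_ | a) <;> rfl
  add_comm := by
    rintro (_ | a) (_ | b) <;> first | rfl | exact congrArg some (S.add_comm a b)
  zero_mul := by rintro (_ | a) <;> rfl
  mul_zero := by rintro (_ | a) <;> rfl
  left_distrib := by
    rintro (_ | a) (_ | b) (_ | c) <;> first | rfl | exact congrArg some (S.mul_add a b c)
  right_distrib := by
    rintro (_ | a) (_ | b) (_ | c) <;> first | rfl | exact congrArg some (S.add_mul a b c)

/-- The value of a cell as a sketch or zero. -/
def val (S : DBSketch Q ρ R) (a : Option R) : S.Val := a

theorem val_none (S : DBSketch Q ρ R) : S.val none = 0 := rfl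

theorem val_injective (S : DBSketch Q ρ R) : Function.Injective S.val := fun _ _ h => h

theorem val_map_mul (S : DBSketch Q ρ R) (a b : Option R) :
    S.val (Option.map₂ S.mul a b) = S.val a * S.val b := rfl

theorem val_add_some (S : DBSketch Q ρ R) (a b : R) :
    S.val (some (S.add a b)) = S.val (some a) + S.val (some b) := rfl

/-- The machine's `⊕` yields an empty cell as soon as one argument is empty, while the formal zero
is neutral. The two agree only on filled cells, so the programs have to test for empty cells before
adding; for `⊙` both conventions coincide. -/
theorem val_map_add (S : DBSketch Q ρ R) {a b : Option R} (ha : a ≠ none) (hb : b ≠ none) :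
    S.val (Option.map₂ S.add a b) = S.val a + S.val b := by
  rcases a with _ | a
  · exact absurd rfl ha
  rcases b with _ | b
  · exact absurd rfl hb
  rfl

theorem val_eval (S : DBSketch Q ρ R) (τ : MulTree m) (g : Fin m → R) :
    τ.eval (· * ·) (fun i => S.val (some (g i))) = S.val (some (τ.eval S.mul g)) := by
  induction τ with
  | leaf i => rfl
  | node l r hl hr =>
    simp only [MulTree.eval, hl, hr]
    rfl

/-- The extra summand `F B` keeps the sum nonempty: the empty sum is the formal zero, which is not
the sketch of any matrix. -/
theorem val_F_sum (S : DBSketch Q ρ R) {ι : Type*} (s : Finset ι)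
    (A : ι → Matrix (∀ i, Q.Dom i) (Fin d) ℝ) (B : Matrix (∀ i, Q.Dom i) (Fin d) ℝ) :
    S.val (some (S.F B)) + ∑ i ∈ s, S.val (some (S.F (A i))) =
      S.val (some (S.F (B + ∑ i ∈ s, A i))) := by
  classical
  induction s using Finset.induction_on generalizing B with
  | empty => simp
  | insert a s ha ih =>
    rw [Finset.sum_insert ha, Finset.sum_insert ha, ← _root_.add_assoc, ← val_add_some, ← DBSketch.map_add, ih,
      _root_.add_assoc]

end DBSketch

/-! ### The join matrix as a sum of Kronecker products -/

namespace JoinQuery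

variable {m d : ℕ} (Q : JoinQuery m d)

/-- The numbers of columns of the Kronecker factors for column `k`. -/
def colCount (k : Fin d) (i : Fin m) : ℕ := if i = Q.owner k then d else 1

theorem colCount_owner (k : Fin d) : Q.colCount k (Q.owner k) = d := if_pos rfl

theorem colCount_of_ne {k : Fin d} {i : Fin m} (h : i ≠ Q.owner k) : Q.colCount k i = 1 := if_neg h

/-- The only factor with more than one column determines the order of the columns. -/
theorem exists_colIso (k : Fin d) :
    ∃ σ : (Πₗ i, Fin (Q.colCount k i)) ≃o Fin d,
      ∀ l, ((ofLex (σ.symm l) (Q.owner k) : Fin _) : ℕ) = l := by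
  have hsub : ∀ i, i ≠ Q.owner k → ∀ a b : Fin (Q.colCount k i), a = b := by
    intro i hi a b
    have := Q.colCount_of_ne hi
    ext
    omega
  have hpos : ∀ i, 0 < Q.colCount k i := by
    intro i
    unfold colCount
    split_ifs
    · exact k.pos
    · exact one_pos
  -- All other coordinates range over a single value, so the lexicographic order is decided at the
  -- owner of `k`.
  let φ : (Πₗ i, Fin (Q.colCount k i)) → Fin d :=
    fun x => Fin.cast (Q.colCount_owner k) (ofLex x (Q.owner k))
  have hφ : StrictMono φ := by
    rintro x y ⟨i, hlt, hi⟩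
    by_cases h : i = Q.owner k
    · subst h
      exact hi
    · exact absurd (hsub i h _ _) hi.ne
  have hsurj : Function.Surjective φ := by
    intro l
    refine ⟨toLex (Function.update (fun i => ⟨0, hpos i⟩) (Q.owner k)
      (Fin.cast (Q.colCount_owner k).symm l)), ?_⟩
    ext
    simp [φ]
  refine ⟨hφ.orderIsoOfSurjective φ hsurj, fun l => ?_⟩
  have := (hφ.orderIsoOfSurjective φ hsurj).apply_symm_apply l
  exact congrArg Fin.val this

/-- The only entry of the Kronecker factor for table `i`, row `r` and column `k`. -/
noncomputable def factorBuffer (k : Fin d) (i : Fin m) (r : ℕ) : List (ℕ × ℕ × ℝ) :=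
  if i = Q.owner k then [(r, (k : ℕ), Q.entry i r k)] else [(r, 0, 1)]

/-- The Kronecker factor for table `i`, row `r` and column `k`. -/
noncomputable def factor (k : Fin d) (i : Fin m) (r : ℕ) :
    Matrix (Q.Dom i) (Fin (Q.colCount k i)) ℝ :=
  Q.bufferMatrix i (Q.colCount k i) (Q.factorBuffer k i r)

theorem bufferMatrix_nil (i : Fin m) (c : ℕ) : Q.bufferMatrix i c [] = 0 := by
  simp [bufferMatrix]

open Classical in
theorem bufferMatrix_single_apply (i : Fin m) (c : ℕ) {r k : ℕ} (v : ℝ) (hr : r < Q.size i)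
    (hk : k < c) (y : Q.Dom i) (l : Fin c) :
    Q.bufferMatrix i c [(r, k, v)] y l = if Q.domOf i ⟨r, hr⟩ = y ∧ k = (l : ℕ) then v else 0 := by
  simp [bufferMatrix, hr, hk, Matrix.single_apply, Fin.ext_iff]

theorem nnz_bufferMatrix_single_le (i : Fin m) (c : ℕ) (e : ℕ × ℕ × ℝ) :
    nnz (Q.bufferMatrix i c [e]) ≤ 1 := by
  classical
  unfold nnz
  by_cases h : e.1 < Q.size i ∧ e.2.1 < c
  · refine (Set.ncard_le_ncard (t := {(Q.domOf i ⟨e.1, h.1⟩, (⟨e.2.1, h.2⟩ : Fin c))}) ?_).trans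
      (Set.ncard_singleton _).le
    rintro ⟨p, q⟩ hp
    rw [Set.mem_singleton_iff, eq_comm, Prod.ext_iff]
    by_contra hne
    apply hp
    simp only [bufferMatrix, List.map_cons, List.map_nil, List.sum_cons, List.sum_nil, add_zero,
      dif_pos h]
    rw [Matrix.single_apply, if_neg hne]
  · simp [bufferMatrix, h]

theorem nnz_zero {ι κ : Type*} : nnz (0 : Matrix ι κ ℝ) = 0 := by
  simp [nnz]

-- A product of single-entry matrices is nonzero only where all factors hit their entry. All factors
-- but the owner's contribute a `1` there, which leaves the entry of the chosen row in column `k`.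
open Classical in
theorem kronecker_factor_apply (k : Fin d) (σ : (Πₗ i, Fin (Q.colCount k i)) ≃o Fin d)
    (hσ : ∀ l, ((ofLex (σ.symm l) (Q.owner k) : Fin _) : ℕ) = l) (f : ∀ i, Fin (Q.size i))
    (y : ∀ i, Q.Dom i) (l : Fin d) :
    kroneckerProduct σ (fun i => Q.factor k i (f i)) y l =
      if (∀ i, Q.domOf i (f i) = y i) ∧ k = l then
        Q.entry (Q.owner k) (f (Q.owner k)) k else 0 := by
  have hown : Q.factor k (Q.owner k) (f (Q.owner k)) (y (Q.owner k))
      (ofLex (σ.symm l) (Q.owner k)) =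
      if Q.domOf _ (f (Q.owner k)) = y (Q.owner k) ∧ k = l then
        Q.entry (Q.owner k) (f (Q.owner k)) k else 0 := by
    unfold factor factorBuffer
    rw [if_pos rfl, bufferMatrix_single_apply _ _ _ _ (f _).2
      (by rw [Q.colCount_owner]; exact k.2), hσ l]
    simp only [Fin.ext_iff, Fin.eta]
  have hother : ∀ i, i ≠ Q.owner k → Q.factor k i (f i) (y i) (ofLex (σ.symm l) i) =
      if Q.domOf _ (f i) = y i then 1 else 0 := by
    intro i hi
    unfold factor factorBuffer
    have h1 := Q.colCount_of_ne hi
    rw [if_neg hi, bufferMatrix_single_apply _ _ _ _ (f _).2 (by omega)]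
    have : 0 = ((ofLex (σ.symm l) i : Fin _) : ℕ) := by omega
    simp only [← this, and_true, Fin.eta]
  unfold kroneckerProduct
  rw [Matrix.of_apply]
  split_ifs with h
  · rw [Finset.prod_eq_single (Q.owner k)]
    · exact hown.trans (if_pos ⟨h.1 _, h.2⟩)
    · intro i _ hi
      exact (hother i hi).trans (if_pos (h.1 i))
    · simp
  · rw [not_and_or, not_forall] at h
    rcases h with ⟨i, hi⟩ | h
    · apply Finset.prod_eq_zero (Finset.mem_univ i)
      by_cases hio : i = Q.owner k
      · subst hio
        exact hown.trans (if_neg (fun h => hi h.1))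
      · exact (hother i hio).trans (if_neg hi)
    · apply Finset.prod_eq_zero (Finset.mem_univ (Q.owner k))
      exact hown.trans (if_neg (fun h' => h h'.2))

theorem entry_eq (i : Fin m) (r : Fin (Q.size i)) (c : {c // c ∈ Q.cols i}) :
    Q.entry i r c.1 = Q.table i r c := by
  unfold entry
  rw [dif_pos ⟨i.2, c.1.2, r.2, c.2⟩]

/-- A choice of rows is consistent if the rows agree on common columns. -/
def Consistent (f : ∀ i, Fin (Q.size i)) : Prop :=
  ∀ a b, ∀ c, c ∈ Q.cols a → c ∈ Q.cols b → Q.entry a (f a) c = Q.entry b (f b) c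

-- A row is not determined by its projection to the assigned columns, so consistency has to supply
-- the rest: each column of the chosen row in table `i` must agree with the row of the owner of that
-- column, hence with `glue y`. As rows are distinct, at most one consistent choice lies over `y`,
-- and one exists exactly if `glue y` is in the join.
open Classical in
theorem sum_consistent (y : ∀ i, Q.Dom i) (l : Fin d) :
    (∑ f : ∀ i, Fin (Q.size i), if Q.Consistent f then
      (if ∀ i, Q.domOf i (f i) = y i then Q.entry (Q.owner l) (f (Q.owner l)) l else 0) else 0) =
      Q.joinMatrix y l := by
  have hval : ∀ f : ∀ i, Fin (Q.size i), (∀ i, Q.domOf i (f i) = y i) → ∀ c,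
      Q.entry (Q.owner c) (f (Q.owner c)) c = Q.glue y c := by
    intro f hf c
    have h1 := Q.entry_eq (Q.owner c) (f _) ⟨c, Q.owner_mem c⟩
    simp only at h1
    rw [h1]
    unfold glue
    rw [← hf (Q.owner c)]
    rfl
  have hrow : ∀ f : ∀ i, Fin (Q.size i), Q.Consistent f → (∀ i, Q.domOf i (f i) = y i) → ∀ i,
      ∀ c : {c // c ∈ Q.cols i}, Q.glue y c.1 = Q.table i (f i) c := by
    intro f hf hy i c
    rw [← hval f hy, ← Q.entry_eq]
    exact hf _ _ _ (Q.owner_mem _) c.2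
  unfold joinMatrix
  rw [Matrix.of_apply]
  split_ifs with h
  · choose f hf using h
    have hd : ∀ i, Q.domOf i (f i) = y i := by
      intro i
      apply Subtype.ext
      funext ⟨c, hc⟩
      subst hc
      exact (hf _ ⟨c, Q.owner_mem c⟩).symm
    have hc : Q.Consistent f := by
      intro a b c ha hb
      have h1 := Q.entry_eq a (f a) ⟨c, ha⟩
      have h2 := Q.entry_eq b (f b) ⟨c, hb⟩
      rw [← hf] at h1 h2
      exact h1.trans h2.symm
    rw [Finset.sum_eq_single f]
    · rw [if_pos hc, if_pos hd, hval f hd]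
    · intro f' _ hne
      split_ifs with h1 h2
      · exfalso
        apply hne
        funext i
        apply Q.distinct i
        funext c
        rw [← hrow f' h1 h2, hf]
      · rfl
      · rfl
    · simp
  · apply Finset.sum_eq_zero
    intro f _
    split_ifs with h1 h2
    · exact absurd (fun i => ⟨f i, fun c => hrow f h1 h2 i c⟩) h
    · rfl
    · rfl

open Classical in
/-- The sketch of the join matrix is a sum of products of sketches of Kronecker factors. -/
theorem sum_sketch_eq {ρ : MulTree m} {R : Type*} (S : DBSketch Q ρ R) (hd : 0 < d) :
    (∑ k : Fin d, (S.val (some (ρ.eval S.mul fun i => S.part i (Q.colCount k i) 0)) +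
      ∑ f : ∀ i, Fin (Q.size i) with Q.Consistent f,
        S.val (some (ρ.eval S.mul fun i => S.part i (Q.colCount k i) (Q.factor k i (f i)))))) =
      S.val (some (S.F Q.joinMatrix)) := by
  choose σ hσ using Q.exists_colIso
  have hm : ∀ k, kroneckerProduct (σ k) (fun i => (0 : Matrix (Q.Dom i) _ ℝ)) = 0 := by
    intro k
    ext x y
    unfold kroneckerProduct
    rw [Matrix.of_apply]
    exact Finset.prod_eq_zero (Finset.mem_univ (Q.owner k)) rfl
  -- The product of the sketches of zero factors is the sketch of a Kronecker product that vanishes.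
  have h0 : ∀ k, ρ.eval S.mul (fun i => S.part i (Q.colCount k i) 0) = S.F 0 := by
    intro k
    rw [← S.map_kronecker _ (σ k), hm]
  simp_rw [h0, ← S.map_kronecker _ (σ _), S.val_F_sum, zero_add]
  set G : Fin d → Matrix (∀ i, Q.Dom i) (Fin d) ℝ := fun k =>
    ∑ f : ∀ i, Fin (Q.size i) with Q.Consistent f,
      kroneckerProduct (σ k) (fun i => Q.factor k i (f i)) with hG
  have hsum : ∑ k, G k = Q.joinMatrix := by
    ext y l
    rw [← Q.sum_consistent, Matrix.sum_apply, hG]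
    simp only [Matrix.sum_apply, Q.kronecker_factor_apply _ _ (hσ _)]
    rw [Finset.sum_eq_single l]
    · rw [Finset.sum_filter]
      simp
    · intro k _ hk
      apply Finset.sum_eq_zero
      intro f _
      rw [if_neg (fun h => hk h.2)]
    · simp
  -- Additivity over the columns again needs a summand `F 0` to start from. It is absorbed by the
  -- term of some column `k₀`, which exists since `0 < d`.
  have hz := S.val_F_sum Finset.univ G 0
  rw [zero_add, hsum] at hz
  rw [← hz]
  obtain ⟨k₀⟩ : Nonempty (Fin d) := ⟨⟨0, hd⟩⟩
  rw [← Finset.add_sum_erase _ _ (Finset.mem_univ k₀), ← add_assoc, ← DBSketch.val_add_some,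
    ← S.map_add, zero_add]

end JoinQuery

/-! ### Sums over consistent choices of rows -/

namespace MulTree

variable {m : ℕ}

/-- The tables in an expression tree. -/
def leaves : MulTree m → Finset (Fin m)
  | .leaf i => {i}
  | .node l r => l.leaves ∪ r.leaves

/-- The product of two trees, where `b` says whether the first one is the left factor. -/
def join (b : Bool) (s t : MulTree m) : MulTree m := if b then .node s t else .node t s

theorem leaves_join (b : Bool) (s t : MulTree m) : (join b s t).leaves = s.leaves ∪ t.leaves := by
  cases b
  · exact Finset.union_comm _ _
  · rfl

theorem eval_congr {R : Type*} (mul : R → R → R) {g h : Fin m → R} (t : MulTree m)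
    (hgh : ∀ i ∈ t.leaves, g i = h i) : t.eval mul g = t.eval mul h := by
  induction t with
  | leaf i => exact hgh i (Finset.mem_singleton_self i)
  | node l r hl hr =>
    simp only [eval]
    rw [hl fun i hi => hgh i (Finset.mem_union_left _ hi),
      hr fun i hi => hgh i (Finset.mem_union_right _ hi)]

end MulTree

/-- The product of two elements, where `b` says whether the first one is the left factor. -/
def mulDir {A : Type*} [Mul A] (b : Bool) (x y : A) : A := if b then x * y else y * x

theorem MulTree.eval_join {m : ℕ} {A : Type*} [Mul A] (b : Bool) (s t : MulTree m) (g : Fin m → A) :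
    (MulTree.join b s t).eval (· * ·) g = mulDir b (s.eval (· * ·) g) (t.eval (· * ·) g) := by
  cases b <;> rfl

theorem mulDir_sum_sum {A ι κ : Type*} [NonUnitalNonAssocSemiring A] (b : Bool) (s : Finset ι)
    (t : Finset κ) (f : ι → A) (g : κ → A) :
    mulDir b (∑ i ∈ s, f i) (∑ j ∈ t, g j) = ∑ p ∈ s ×ˢ t, mulDir b (f p.1) (g p.2) := by
  cases b
  · simp only [mulDir, Bool.false_eq_true, if_false, Finset.sum_mul_sum]
    rw [Finset.sum_product_right]
  · simp only [mulDir, if_true, Finset.sum_mul_sum]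
    rw [Finset.sum_product]

/-! ### Sums over consistent tuples, and their behaviour under products of trees. -/

section TupleSum

variable {m d : ℕ} (cols : Fin m → Finset (Fin d)) (items : Fin m → Finset ℕ)
  (ent : ℕ → Fin d → ℝ)

/-- The chosen items of the tables in `s` agree on common columns. -/
def TupleConsistent (s : Finset (Fin m)) (f : Fin m → ℕ) : Prop :=
  ∀ a ∈ s, ∀ b ∈ s, ∀ c, c ∈ cols a → c ∈ cols b → ent (f a) c = ent (f b) c

variable {cols ent} in
theorem TupleConsistent.congr {s : Finset (Fin m)} {f g : Fin m → ℕ} (h : ∀ a ∈ s, f a = g a)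
    (hf : TupleConsistent cols ent s f) : TupleConsistent cols ent s g := by
  intro a ha b hb c hca hcb
  rw [← h a ha, ← h b hb]
  exact hf a ha b hb c hca hcb

open Classical in
/-- The consistent choices of one item of every table in `s`. -/
noncomputable def tuples (s : Finset (Fin m)) : Finset (Fin m → ℕ) :=
  {f ∈ Fintype.piFinset fun i => if i ∈ s then items i else {0} | TupleConsistent cols ent s f}

/-- The default value `0` outside of `s` gives every choice on `s` exactly one representative among
the functions on all tables. -/
theorem mem_tuples {s : Finset (Fin m)} {f : Fin m → ℕ} :
    f ∈ tuples cols items ent s ↔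
      (∀ i ∈ s, f i ∈ items i) ∧ (∀ i ∉ s, f i = 0) ∧ TupleConsistent cols ent s f := by
  classical
  unfold tuples
  rw [Finset.mem_filter, Fintype.mem_piFinset, ← and_assoc]
  refine and_congr_left fun _ => ⟨fun h => ⟨fun i hi => ?_, fun i hi => ?_⟩, fun h i => ?_⟩
  · simpa [hi] using h i
  · simpa [hi] using h i
  · by_cases hi : i ∈ s
    · simpa [hi] using h.1 i hi
    · simpa [hi] using h.2 i hi

variable {A : Type*} [NonUnitalNonAssocSemiring A] (g : ℕ → A)

/-- The sum over the consistent choices with item `e` of table `j` of the products in the order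
of `τ`. -/
noncomputable def tupleSum (τ : MulTree m) (j : Fin m) (e : ℕ) : A :=
  ∑ f ∈ tuples cols items ent τ.leaves with f j = e, τ.eval (· * ·) fun i => g (f i)

theorem tupleSum_leaf (j : Fin m) {e : ℕ} (he : e ∈ items j) :
    tupleSum cols items ent g (.leaf j) j e = g e := by
  classical
  unfold tupleSum
  rw [Finset.sum_eq_single (fun i => if i = j then e else 0)]
  · simp [MulTree.eval]
  · intro f hf hne
    rw [Finset.mem_filter, mem_tuples] at hf
    exfalso
    apply hne
    funext i
    split_ifs with h
    · rw [h, hf.2]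
    · exact hf.1.2.1 i (by simpa [MulTree.leaves] using h)
  · intro h
    exfalso
    apply h
    rw [Finset.mem_filter, mem_tuples]
    refine ⟨⟨?_, ?_, ?_⟩, by simp⟩
    · intro i hi
      have : i = j := by simpa [MulTree.leaves] using hi
      simpa [this] using he
    · intro i hi
      have : i ≠ j := by simpa [MulTree.leaves] using hi
      simp [this]
    · intro a ha b hb c _ _
      have h1 : a = j := by simpa [MulTree.leaves] using ha
      have h2 : b = j := by simpa [MulTree.leaves] using hb
      rw [h1, h2]

theorem sum_tupleSum (τ : MulTree m) (j : Fin m) (hj : j ∈ τ.leaves) (p : ℕ → Prop)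
    [DecidablePred p] :
    ∑ e ∈ items j with p e, tupleSum cols items ent g τ j e =
      ∑ f ∈ tuples cols items ent τ.leaves with p (f j), τ.eval (· * ·) fun i => g (f i) := by
  unfold tupleSum
  simp_rw [Finset.sum_filter]
  rw [← Finset.sum_filter, Finset.sum_comm]
  refine Finset.sum_congr rfl fun f hf => ?_
  rw [Finset.sum_ite_eq]
  simp [((mem_tuples cols items ent).1 hf).1 j hj]

/-- Restriction to the two disjoint sets of leaves is a bijection between consistent choices for the
product tree and pairs of consistent choices whose items at `i` and `j` agree on `C`. The product of
the two sums then expands by distributivity, with the left and right factors kept in place. The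
hypothesis `hC` is all that is needed of the schema, and `p` is the test that the machine performs
by comparing keys. -/
theorem tupleSum_join (b : Bool) (s t : MulTree m) (i j : Fin m) (hst : Disjoint s.leaves t.leaves)
    (hi : i ∈ s.leaves) (hj : j ∈ t.leaves) (C : Finset (Fin d))
    (hC : ∀ f, TupleConsistent cols ent (s.leaves ∪ t.leaves) f ↔
      TupleConsistent cols ent s.leaves f ∧ TupleConsistent cols ent t.leaves f ∧
        ∀ c ∈ C, ent (f i) c = ent (f j) c) (e : ℕ)
    (p : ℕ → Prop) [DecidablePred p] (hp : ∀ e' ∈ items i, p e' ↔ ∀ c ∈ C, ent e' c = ent e c) :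
    tupleSum cols items ent g (MulTree.join b s t) j e =
      mulDir b
        (∑ e' ∈ items i with p e', tupleSum cols items ent g s i e')
        (tupleSum cols items ent g t j e) := by
  have hnot : ∀ a ∈ t.leaves, a ∉ s.leaves := fun a ha hs => Finset.disjoint_left.1 hst hs ha
  rw [sum_tupleSum _ _ _ _ _ _ hi p]
  unfold tupleSum
  rw [mulDir_sum_sum, MulTree.leaves_join]
  refine Finset.sum_nbij'
    (fun f => (fun a => if a ∈ s.leaves then f a else 0, fun a => if a ∈ t.leaves then f a else 0))
    (fun p a => if a ∈ s.leaves then p.1 a else p.2 a) ?_ ?_ ?_ ?_ ?_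
  · intro f hf
    rw [Finset.mem_filter, mem_tuples, hC] at hf
    obtain ⟨⟨h1, h2, h3, h4, h5⟩, h6⟩ := hf
    rw [Finset.mem_product, Finset.mem_filter, Finset.mem_filter, mem_tuples, mem_tuples]
    refine ⟨⟨⟨?_, ?_, ?_⟩, ?_⟩, ⟨?_, ?_, ?_⟩, ?_⟩
    · intro a ha
      simpa [ha] using h1 a (Finset.mem_union_left _ ha)
    · intro a ha
      simp [ha]
    · exact h3.congr fun a ha => by simp [ha]
    · have h7 := (hp (f i) (h1 i (Finset.mem_union_left _ hi))).2 (by rwa [← h6])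
      simpa [hi] using h7
    · intro a ha
      simpa [ha] using h1 a (Finset.mem_union_right _ ha)
    · intro a ha
      simp [ha]
    · exact h4.congr fun a ha => by simp [ha]
    · simpa [hj] using h6
  · rintro ⟨f, f'⟩ hp
    rw [Finset.mem_product, Finset.mem_filter, Finset.mem_filter, mem_tuples, mem_tuples] at hp
    obtain ⟨⟨⟨h1, h2, h3⟩, h4⟩, ⟨h5, h6, h7⟩, h8⟩ := hp
    simp only at h1 h2 h3 h4 h5 h6 h7 h8
    rw [Finset.mem_filter, mem_tuples, hC]
    refine ⟨⟨?_, ?_, ?_, ?_, ?_⟩, ?_⟩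
    · intro a ha
      by_cases has : a ∈ s.leaves
      · simpa [has] using h1 a has
      · have hat := (Finset.mem_union.1 ha).resolve_left has
        simpa [has] using h5 a hat
    · intro a ha
      rw [Finset.mem_union, not_or] at ha
      simpa [ha.1] using h6 a ha.2
    · exact h3.congr fun a ha => by simp [ha]
    · exact h7.congr fun a ha => by simp [hnot a ha]
    · simpa [hi, hnot j hj, h8] using (hp _ (h1 i hi)).1 h4
    · simpa [hnot j hj] using h8
  · intro f hf
    rw [Finset.mem_filter, mem_tuples] at hf
    funext a
    by_cases has : a ∈ s.leaves
    · simp [has]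
    · by_cases hat : a ∈ t.leaves
      · simp [has, hat]
      · simp [has, hat, hf.1.2.1 a (by simp [has, hat])]
  · rintro ⟨f, f'⟩ hp
    rw [Finset.mem_product, Finset.mem_filter, Finset.mem_filter, mem_tuples, mem_tuples] at hp
    obtain ⟨⟨⟨h1, h2, h3⟩, h4⟩, ⟨h5, h6, h7⟩, h8⟩ := hp
    simp only at h1 h2 h3 h4 h5 h6 h7 h8
    refine Prod.ext ?_ ?_
    · funext a
      by_cases has : a ∈ s.leaves
      · simp [has]
      · simp [has, h2 a has]
    · funext a
      by_cases hat : a ∈ t.leaves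
      · simp [hnot a hat, hat]
      · simp [hat, h6 a hat]
  · intro f hf
    rw [MulTree.eval_join]
    congr 1
    · exact MulTree.eval_congr _ _ fun a ha => by simp [ha]
    · exact MulTree.eval_congr _ _ fun a ha => by simp [ha]

end TupleSum

/-! ### The schema during a run of Inside-Out -/

/-- The relations between the current schema and the products that hold during a run. -/
structure SchemaInv {m d : ℕ} (cols : Fin m → Finset (Fin d)) (live : Finset (Fin m))
    (cols' : Fin m → Finset (Fin d)) (tree : Fin m → MulTree m) : Prop where
  subset : ∀ i, cols' i ⊆ cols i
  self_mem : ∀ i, i ∈ (tree i).leaves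
  disjoint : ∀ i ∈ live, ∀ j ∈ live, i ≠ j → Disjoint (tree i).leaves (tree j).leaves
  cover : ∀ a, ∃ i ∈ live, a ∈ (tree i).leaves
  common : ∀ i ∈ live, ∀ j ∈ live, i ≠ j → ∀ a ∈ (tree i).leaves, ∀ b ∈ (tree j).leaves,
    ∀ c, c ∈ cols a → c ∈ cols b → c ∈ cols' i

/-- The heart is `common`, the running intersection property. A column shared by two live groups is,
by symmetry, a current column of both representatives; it is therefore never one that `sumOut` may
remove. An absorption keeps the property because the columns of `i` are among those of `j`. -/
theorem PlanRun.schemaInv {m d : ℕ} {cols : Fin m → Finset (Fin d)} {plan : List (PlanStep m d)}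
    {live : Finset (Fin m)} {cols' : Fin m → Finset (Fin d)} {tree : Fin m → MulTree m}
    (h : PlanRun cols plan live cols' tree) : SchemaInv cols live cols' tree := by
  induction h with
  | start =>
    refine ⟨fun i => subset_rfl, fun i => Finset.mem_singleton_self i, ?_,
      fun a => ⟨a, Finset.mem_univ a, Finset.mem_singleton_self a⟩, ?_⟩
    · intro i _ j _ hij
      simpa [MulTree.leaves] using hij
    · intro i _ j _ _ a ha b _ c hca _
      rw [MulTree.leaves, Finset.mem_singleton] at ha
      exact ha ▸ hca
  | @sumOut plan live cols' tree h i c hi hc honly ih =>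
    refine ⟨?_, ih.self_mem, ih.disjoint, ih.cover, ?_⟩
    · intro a
      by_cases ha : a = i
      · subst ha
        rw [Function.update_self]
        exact (Finset.erase_subset _ _).trans (ih.subset a)
      · rw [Function.update_of_ne ha]
        exact ih.subset a
    · intro x hx y hy hxy a ha b hb c' hca hcb
      have h1 := ih.common x hx y hy hxy a ha b hb c' hca hcb
      have h2 := ih.common y hy x hx hxy.symm b hb a ha c' hcb hca
      by_cases hxi : x = i
      · subst hxi
        rw [Function.update_self, Finset.mem_erase]
        refine ⟨?_, h1⟩
        rintro rfl
        exact hxy (honly y hy h2).symm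
      · rw [Function.update_of_ne hxi]
        exact h1
  | @absorb plan live cols' tree h i j b hi hj hij hsub ih =>
    change SchemaInv cols (live.erase i) cols'
      (Function.update tree j (MulTree.join b (tree i) (tree j)))
    have hlj : (Function.update tree j (MulTree.join b (tree i) (tree j)) j).leaves =
        (tree i).leaves ∪ (tree j).leaves := by
      rw [Function.update_self, MulTree.leaves_join]
    have hln : ∀ x, x ≠ j → Function.update tree j (MulTree.join b (tree i) (tree j)) x = tree x :=
      fun x hx => Function.update_of_ne hx _ _
    refine ⟨ih.subset, ?_, ?_, ?_, ?_⟩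
    · intro x
      by_cases hx : x = j
      · subst hx
        rw [hlj]
        exact Finset.mem_union_right _ (ih.self_mem _)
      · rw [hln x hx]
        exact ih.self_mem x
    · intro x hx y hy hxy
      rw [Finset.mem_erase] at hx hy
      by_cases hxj : x = j
      · subst hxj
        rw [hlj, hln y hxy.symm, Finset.disjoint_union_left]
        exact ⟨ih.disjoint _ hi _ hy.2 hy.1.symm, ih.disjoint _ hj _ hy.2 hxy⟩
      · rw [hln x hxj]
        by_cases hyj : y = j
        · subst hyj
          rw [hlj, Finset.disjoint_union_right]
          exact ⟨ih.disjoint _ hx.2 _ hi hx.1, ih.disjoint _ hx.2 _ hj hxj⟩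
        · rw [hln y hyj]
          exact ih.disjoint x hx.2 y hy.2 hxy
    · intro a
      obtain ⟨x, hx, hax⟩ := ih.cover a
      by_cases hxij : x = i ∨ x = j
      · refine ⟨j, Finset.mem_erase.2 ⟨hij.symm, hj⟩, ?_⟩
        rw [hlj]
        rcases hxij with rfl | rfl
        · exact Finset.mem_union_left _ hax
        · exact Finset.mem_union_right _ hax
      · rw [not_or] at hxij
        refine ⟨x, Finset.mem_erase.2 ⟨hxij.1, hx⟩, ?_⟩
        rwa [hln x hxij.2]
    · intro x hx y hy hxy a ha b' hb c hca hcb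
      rw [Finset.mem_erase] at hx hy
      by_cases hxj : x = j
      · subst hxj
        rw [hlj, Finset.mem_union] at ha
        rw [hln y hxy.symm] at hb
        rcases ha with ha | ha
        · exact hsub (ih.common i hi y hy.2 hy.1.symm a ha b' hb c hca hcb)
        · exact ih.common _ hj y hy.2 hxy a ha b' hb c hca hcb
      · rw [hln x hxj] at ha
        by_cases hyj : y = j
        · subst hyj
          rw [hlj, Finset.mem_union] at hb
          rcases hb with hb | hb
          · exact ih.common x hx.2 i hi hx.1 a ha b' hb c hca hcb
          · exact ih.common x hx.2 _ hj hxj a ha b' hb c hca hcb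
        · rw [hln y hyj] at hb
          exact ih.common x hx.2 y hy.2 hxy a ha b' hb c hca hcb

/-- A column shared by tables `a` and `b` of different groups is a current column of `i` and `j`, so
the entries can be compared along the chain `a`, `i`, `j`, `b`. -/
theorem SchemaInv.consistent_union {m d : ℕ} {cols : Fin m → Finset (Fin d)}
    {live : Finset (Fin m)} {cols' : Fin m → Finset (Fin d)} {tree : Fin m → MulTree m}
    (h : SchemaInv cols live cols' tree) {i j : Fin m} (hi : i ∈ live) (hj : j ∈ live)
    (hij : i ≠ j) (hsub : cols' i ⊆ cols' j) (ent : ℕ → Fin d → ℝ) (f : Fin m → ℕ) :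
    TupleConsistent cols ent ((tree i).leaves ∪ (tree j).leaves) f ↔
      TupleConsistent cols ent (tree i).leaves f ∧ TupleConsistent cols ent (tree j).leaves f ∧
        ∀ c ∈ cols' i, ent (f i) c = ent (f j) c := by
  constructor
  · intro hf
    refine ⟨fun a ha b hb => hf a (Finset.mem_union_left _ ha) b (Finset.mem_union_left _ hb),
      fun a ha b hb => hf a (Finset.mem_union_right _ ha) b (Finset.mem_union_right _ hb),
      fun c hc => ?_⟩
    exact hf i (Finset.mem_union_left _ (h.self_mem i)) j (Finset.mem_union_right _ (h.self_mem j))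
      c (h.subset i hc) (h.subset j (hsub hc))
  · rintro ⟨hfi, hfj, hC⟩
    have key : ∀ a ∈ (tree i).leaves, ∀ b ∈ (tree j).leaves, ∀ c, c ∈ cols a → c ∈ cols b →
        ent (f a) c = ent (f b) c := by
      intro a ha b hb c hca hcb
      have hc := h.common i hi j hj hij a ha b hb c hca hcb
      rw [hfi a ha i (h.self_mem i) c hca (h.subset i hc), hC c hc,
        hfj j (h.self_mem j) b hb c (h.subset j (hsub hc)) hcb]
    intro a ha b hb c hca hcb
    rw [Finset.mem_union] at ha hb
    rcases ha with ha | ha <;> rcases hb with hb | hb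
    · exact hfi a ha b hb c hca hcb
    · exact key a ha b hb c hca hcb
    · exact (key b hb a ha c hcb hca).symm
    · exact hfj a ha b hb c hca hcb

/-- The number of multiplications among the elimination steps. -/
def absorbCount {m d : ℕ} (plan : List (PlanStep m d)) : ℕ :=
  (plan.map fun s => match s with
    | .sumOut _ _ => 0
    | .absorb _ _ _ => 1).sum

/-- Every absorption removes one live table, and no other step does; a run that ends with one table
has `m - 1` absorptions. -/
theorem PlanRun.card_live {m d : ℕ} {cols : Fin m → Finset (Fin d)} {plan : List (PlanStep m d)}
    {live : Finset (Fin m)} {cols' : Fin m → Finset (Fin d)} {tree : Fin m → MulTree m}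
    (h : PlanRun cols plan live cols' tree) : absorbCount plan + live.card = m := by
  induction h with
  | start => simp [absorbCount]
  | sumOut h i c hi hc honly ih => simpa [absorbCount] using ih
  | absorb h i j b hi hj hij hsub ih =>
    have := Finset.card_erase_add_one hi
    simp only [absorbCount, List.map_append, List.sum_append, List.map_cons, List.map_nil,
      List.sum_cons, List.sum_nil] at ih ⊢
    omega

/-- Every `sumOut` deletes one of the at most `m * d` incidences of tables and columns. Together
with `card_live` this bounds the number of elimination steps. -/
theorem PlanRun.length_le {m d : ℕ} {cols : Fin m → Finset (Fin d)} {plan : List (PlanStep m d)}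
    {live : Finset (Fin m)} {cols' : Fin m → Finset (Fin d)} {tree : Fin m → MulTree m}
    (h : PlanRun cols plan live cols' tree) :
    plan.length + ∑ i, (cols' i).card ≤ absorbCount plan + m * d := by
  induction h with
  | start =>
    simp only [absorbCount, List.length_nil, List.map_nil, List.sum_nil, zero_add]
    refine (Finset.sum_le_card_nsmul _ _ d fun i _ => ?_).trans (by simp)
    simpa using Finset.card_le_univ (cols i)
  | @sumOut plan live cols' tree h i c hi hc honly ih =>
    have h1 := Finset.card_erase_add_one hc
    have h2 : ∑ x, (Function.update cols' i ((cols' i).erase c) x).card + 1 =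
        ∑ x, (cols' x).card := by
      rw [← Finset.add_sum_erase _ _ (Finset.mem_univ i),
        ← Finset.add_sum_erase _ (fun x => (cols' x).card) (Finset.mem_univ i),
        Function.update_self, ← h1]
      have : ∑ x ∈ Finset.univ.erase i, (Function.update cols' i ((cols' i).erase c) x).card =
          ∑ x ∈ Finset.univ.erase i, (cols' x).card :=
        Finset.sum_congr rfl fun x hx => by rw [Function.update_of_ne (Finset.ne_of_mem_erase hx)]
      omega
    simp only [absorbCount, List.map_append, List.sum_append, List.map_cons, List.map_nil,
      List.sum_cons, List.sum_nil, List.length_append, List.length_cons, List.length_nil] at ih ⊢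
    omega
  | absorb h i j b hi hj hij hsub ih =>
    simp only [absorbCount, List.map_append, List.sum_append, List.map_cons, List.map_nil,
      List.sum_cons, List.sum_nil, List.length_append, List.length_cons, List.length_nil] at ih ⊢
    omega

/-! ### Reasoning about programs -/

namespace MachineState

variable {R : Type*} (s : MachineState R)

@[simp] theorem setVar_var (x v y : ℕ) : (s.setVar x v).var y = if y = x then v else s.var y := by
  simp [setVar, Function.update_apply]
@[simp] theorem setVar_arr (x v : ℕ) : (s.setVar x v).arr = s.arr := rfl
@[simp] theorem setVar_real (x v : ℕ) : (s.setVar x v).real = s.real := rfl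
@[simp] theorem setVar_buf (x v : ℕ) : (s.setVar x v).buf = s.buf := rfl
@[simp] theorem setVar_sk (x v : ℕ) : (s.setVar x v).sk = s.sk := rfl

@[simp] theorem setArr_var (a i j v : ℕ) : (s.setArr a i j v).var = s.var := rfl
@[simp] theorem setArr_arr (a i j v a' i' j' : ℕ) :
    (s.setArr a i j v).arr a' i' j' = if a' = a ∧ i' = i ∧ j' = j then v else s.arr a' i' j' := rfl
@[simp] theorem setArr_real (a i j v : ℕ) : (s.setArr a i j v).real = s.real := rfl
@[simp] theorem setArr_buf (a i j v : ℕ) : (s.setArr a i j v).buf = s.buf := rfl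
@[simp] theorem setArr_sk (a i j v : ℕ) : (s.setArr a i j v).sk = s.sk := rfl

@[simp] theorem setReal_var (x : ℕ) (v : ℝ) : (s.setReal x v).var = s.var := rfl
@[simp] theorem setReal_arr (x : ℕ) (v : ℝ) : (s.setReal x v).arr = s.arr := rfl
@[simp] theorem setReal_real (x : ℕ) (v : ℝ) (y : ℕ) :
    (s.setReal x v).real y = if y = x then v else s.real y := by
  simp [setReal, Function.update_apply]
@[simp] theorem setReal_buf (x : ℕ) (v : ℝ) : (s.setReal x v).buf = s.buf := rfl
@[simp] theorem setReal_sk (x : ℕ) (v : ℝ) : (s.setReal x v).sk = s.sk := rfl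

@[simp] theorem setCell_var (u : SketchCell) (v : Option R) : (s.setCell u v).var = s.var := rfl
@[simp] theorem setCell_arr (u : SketchCell) (v : Option R) : (s.setCell u v).arr = s.arr := rfl
@[simp] theorem setCell_real (u : SketchCell) (v : Option R) : (s.setCell u v).real = s.real := rfl
@[simp] theorem setCell_buf (u : SketchCell) (v : Option R) : (s.setCell u v).buf = s.buf := rfl
@[simp] theorem setCell_sk (u : SketchCell) (v : Option R) (a i j : ℕ) :
    (s.setCell u v).sk a i j =
      if a = u.name ∧ i = u.row.eval s ∧ j = u.col.eval s then v else s.sk a i j := rfl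

end MachineState

/-! ### Write sets, frame conditions and rules for loops. -/

namespace Prog

/-- The program can write number register `x`. -/
def writesVar (x : ℕ) : Prog → Bool
  | .assign y _ => x == y
  | .compare z _ _ => x == z
  | .seq p q => p.writesVar x || q.writesVar x
  | .ite _ p q => p.writesVar x || q.writesVar x
  | .loop y _ p => x == y || p.writesVar x
  | _ => false

/-- The program can write number array `a`. -/
def writesArr (a : ℕ) : Prog → Bool
  | .store b _ _ _ => a == b
  | .seq p q => p.writesArr a || q.writesArr a
  | .ite _ p q => p.writesArr a || q.writesArr a
  | .loop _ _ p => p.writesArr a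
  | _ => false

/-- The program can write the array `a` of sketches. -/
def writesSk (a : ℕ) : Prog → Bool
  | .sketch u _ _ => a == u.name
  | .copy u _ => a == u.name
  | .sketchAdd u _ _ => a == u.name
  | .sketchMul u _ _ => a == u.name
  | .seq p q => p.writesSk a || q.writesSk a
  | .ite _ p q => p.writesSk a || q.writesSk a
  | .loop _ _ p => p.writesSk a
  | _ => false

/-- The two states agree on everything that `p` cannot write. -/
structure Frame {R : Type*} (p : Prog) (s s' : MachineState R) : Prop where
  var : ∀ x, p.writesVar x = false → s'.var x = s.var x
  arr : ∀ a, p.writesArr a = false → s'.arr a = s.arr a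
  sk : ∀ a, p.writesSk a = false → s'.sk a = s.sk a

theorem Frame.refl {R : Type*} (p : Prog) (s : MachineState R) : Frame p s s :=
  ⟨fun _ _ => rfl, fun _ _ => rfl, fun _ _ => rfl⟩

theorem Frame.trans {R : Type*} {p : Prog} {s s' s'' : MachineState R} (h : Frame p s s')
    (h' : Frame p s' s'') : Frame p s s'' :=
  ⟨fun x hx => (h'.var x hx).trans (h.var x hx), fun a ha => (h'.arr a ha).trans (h.arr a ha),
    fun a ha => (h'.sk a ha).trans (h.sk a ha)⟩

variable {m d : ℕ} {Q : JoinQuery m d} {ρ : MulTree m} {R : Type*} (S : DBSketch Q ρ R)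
  (K : SketchCosts)

@[simp] theorem run_skip (s : MachineState R) : Prog.skip.run S K s = (s, 1) := rfl
@[simp] theorem run_assign (x : ℕ) (e : NatExp) (s : MachineState R) :
    (Prog.assign x e).run S K s = (s.setVar x (e.eval s), 1 + e.cost) := rfl
@[simp] theorem run_store (a : ℕ) (i j e : NatExp) (s : MachineState R) :
    (Prog.store a i j e).run S K s =
      (s.setArr a (i.eval s) (j.eval s) (e.eval s), 1 + i.cost + j.cost + e.cost) := rfl
@[simp] theorem run_read (x : ℕ) (i r c : NatExp) (s : MachineState R) :
    (Prog.read x i r c).run S K s =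
      (s.setReal x (Q.entry (i.eval s) (r.eval s) (c.eval s)),
        1 + i.cost + r.cost + c.cost) := rfl
@[simp] theorem run_one (x : ℕ) (s : MachineState R) :
    (Prog.one x).run S K s = (s.setReal x 1, 1) := rfl
open Classical in
@[simp] theorem run_compare (z x y : ℕ) (s : MachineState R) :
    (Prog.compare z x y).run S K s =
      (s.setVar z (if s.real x ≤ s.real y then 1 else 0), 1) := rfl
@[simp] theorem run_clear (s : MachineState R) :
    Prog.clear.run S K s = ({ s with buf := [] }, 1) := rfl
@[simp] theorem run_push (r c : NatExp) (x : ℕ) (s : MachineState R) :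
    (Prog.push r c x).run S K s =
      ({ s with buf := s.buf ++ [(r.eval s, c.eval s, s.real x)] }, 1 + r.cost + c.cost) := rfl
@[simp] theorem run_copy (u v : SketchCell) (s : MachineState R) :
    (Prog.copy u v).run S K s = (s.setCell u (v.value s), 1 + u.cost + v.cost) := rfl
@[simp] theorem run_sketchAdd (u v w : SketchCell) (s : MachineState R) :
    (Prog.sketchAdd u v w).run S K s =
      (s.setCell u (Option.map₂ S.add (v.value s) (w.value s)),
        1 + u.cost + v.cost + w.cost + K.add) := rfl
@[simp] theorem run_sketchMul (u v w : SketchCell) (s : MachineState R) :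
    (Prog.sketchMul u v w).run S K s =
      (s.setCell u (Option.map₂ S.mul (v.value s) (w.value s)),
        1 + u.cost + v.cost + w.cost + K.mul) := rfl
theorem run_sketch (u : SketchCell) (i c : NatExp) (s : MachineState R) (a : Fin m) (k : ℕ)
    (hi : i.eval s = a) (hk : c.eval s = k) :
    (Prog.sketch u i c).run S K s =
      (s.setCell u (some (S.part a k (Q.bufferMatrix a k s.buf))),
        1 + u.cost + i.cost + c.cost + s.buf.length + K.sketch * nnz (Q.bufferMatrix a k s.buf)) := by
  subst hk
  obtain ⟨a, ha⟩ := a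
  simp only at hi
  subst hi
  simp only [Prog.run]
  rw [dif_pos ha]
@[simp] theorem run_seq_fst (p q : Prog) (s : MachineState R) :
    ((Prog.seq p q).run S K s).1 = (q.run S K (p.run S K s).1).1 := rfl
@[simp] theorem run_seq_snd (p q : Prog) (s : MachineState R) :
    ((Prog.seq p q).run S K s).2 = (p.run S K s).2 + (q.run S K (p.run S K s).1).2 := rfl
theorem run_ite_pos (e : NatExp) (p q : Prog) (s : MachineState R) (h : e.eval s ≠ 0) :
    (Prog.ite e p q).run S K s = ((p.run S K s).1, 1 + e.cost + (p.run S K s).2) := by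
  simp [Prog.run, h]
theorem run_ite_neg (e : NatExp) (p q : Prog) (s : MachineState R) (h : e.eval s = 0) :
    (Prog.ite e p q).run S K s = ((q.run S K s).1, 1 + e.cost + (q.run S K s).2) := by
  simp [Prog.run, h]

/-- The first `n` iterations of a loop. -/
noncomputable def iter (x : ℕ) (p : Prog) (s : MachineState R) : ℕ → MachineState R × ℕ
  | 0 => (s, 0)
  | n + 1 =>
    ((p.run S K ((iter x p s n).1.setVar x n)).1,
      (iter x p s n).2 + 1 + (p.run S K ((iter x p s n).1.setVar x n)).2)

theorem run_loop (x : ℕ) (e : NatExp) (p : Prog) (s : MachineState R) :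
    (Prog.loop x e p).run S K s =
      ((iter S K x p s (e.eval s)).1, 1 + e.cost + (iter S K x p s (e.eval s)).2) := by
  simp only [Prog.run]
  generalize e.eval s = n
  induction n with
  | zero => rfl
  | succ n ih =>
    simp only [iter, ih]
    refine Prod.ext rfl ?_
    simp only
    omega

theorem frame_iter (x : ℕ) (p : Prog) (e : NatExp) (s : MachineState R)
    (hp : ∀ s : MachineState R, Frame p s (p.run S K s).1) (n : ℕ) :
    Frame (.loop x e p) s (iter S K x p s n).1 := by
  induction n with
  | zero => exact Frame.refl _ _
  | succ n ih =>
    refine ih.trans ⟨fun y hy => ?_, fun a ha => ?_, fun a ha => ?_⟩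
    · simp only [writesVar, Bool.or_eq_false_iff, beq_eq_false_iff_ne] at hy
      simp only [iter]
      rw [(hp _).var y hy.2, MachineState.setVar_var, if_neg hy.1]
    · simp only [iter]
      rw [(hp _).arr a ha, MachineState.setVar_arr]
    · simp only [iter]
      rw [(hp _).sk a ha, MachineState.setVar_sk]

/-- The write sets are computed from the syntax alone, so for concrete programs the side conditions
of a frame hold by `rfl` or `decide`. This is how all facts about untouched registers and arrays are
carried along below. -/
theorem frame_run (p : Prog) (s : MachineState R) : Frame p s (p.run S K s).1 := by
  induction p generalizing s with
  | skip => exact Frame.refl _ _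
  | assign x e =>
    refine ⟨fun y hy => ?_, fun _ _ => rfl, fun _ _ => rfl⟩
    simp only [writesVar, beq_eq_false_iff_ne] at hy
    simp [hy]
  | store a i j e =>
    refine ⟨fun _ _ => rfl, fun b hb => ?_, fun _ _ => rfl⟩
    simp only [writesArr, beq_eq_false_iff_ne] at hb
    funext i' j'
    simp [hb]
  | read x i r c => exact ⟨fun _ _ => rfl, fun _ _ => rfl, fun _ _ => rfl⟩
  | one x => exact ⟨fun _ _ => rfl, fun _ _ => rfl, fun _ _ => rfl⟩
  | compare z x y =>
    refine ⟨fun y hy => ?_, fun _ _ => rfl, fun _ _ => rfl⟩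
    simp only [writesVar, beq_eq_false_iff_ne] at hy
    simp [hy]
  | clear => exact ⟨fun _ _ => rfl, fun _ _ => rfl, fun _ _ => rfl⟩
  | push r c x => exact ⟨fun _ _ => rfl, fun _ _ => rfl, fun _ _ => rfl⟩
  | sketch u i c =>
    by_cases h : i.eval s < m
    · rw [run_sketch S K u i c s ⟨_, h⟩ _ rfl rfl]
      refine ⟨fun _ _ => rfl, fun _ _ => rfl, fun b hb => ?_⟩
      simp only [writesSk, beq_eq_false_iff_ne] at hb
      funext i' j'
      simp [hb]
    · have : ((Prog.sketch u i c).run S K s).1 = s := by simp [Prog.run, h]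
      rw [this]
      exact Frame.refl _ _
  | copy u v =>
    refine ⟨fun _ _ => rfl, fun _ _ => rfl, fun b hb => ?_⟩
    simp only [writesSk, beq_eq_false_iff_ne] at hb
    funext i' j'
    simp [hb]
  | sketchAdd u v w =>
    refine ⟨fun _ _ => rfl, fun _ _ => rfl, fun b hb => ?_⟩
    simp only [writesSk, beq_eq_false_iff_ne] at hb
    funext i' j'
    simp [hb]
  | sketchMul u v w =>
    refine ⟨fun _ _ => rfl, fun _ _ => rfl, fun b hb => ?_⟩
    simp only [writesSk, beq_eq_false_iff_ne] at hb
    funext i' j'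
    simp [hb]
  | seq p q hp hq =>
    refine ⟨fun y hy => ?_, fun a ha => ?_, fun a ha => ?_⟩
    · simp only [writesVar, Bool.or_eq_false_iff] at hy
      rw [run_seq_fst, (hq _).var y hy.2, (hp _).var y hy.1]
    · simp only [writesArr, Bool.or_eq_false_iff] at ha
      rw [run_seq_fst, (hq _).arr a ha.2, (hp _).arr a ha.1]
    · simp only [writesSk, Bool.or_eq_false_iff] at ha
      rw [run_seq_fst, (hq _).sk a ha.2, (hp _).sk a ha.1]
  | ite e p q hp hq =>
    refine ⟨fun y hy => ?_, fun a ha => ?_, fun a ha => ?_⟩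
    · simp only [writesVar, Bool.or_eq_false_iff] at hy
      by_cases h : e.eval s = 0
      · rw [run_ite_neg S K e p q s h, (hq _).var y hy.2]
      · rw [run_ite_pos S K e p q s h, (hp _).var y hy.1]
    · simp only [writesArr, Bool.or_eq_false_iff] at ha
      by_cases h : e.eval s = 0
      · rw [run_ite_neg S K e p q s h, (hq _).arr a ha.2]
      · rw [run_ite_pos S K e p q s h, (hp _).arr a ha.1]
    · simp only [writesSk, Bool.or_eq_false_iff] at ha
      by_cases h : e.eval s = 0
      · rw [run_ite_neg S K e p q s h, (hq _).sk a ha.2]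
      · rw [run_ite_pos S K e p q s h, (hp _).sk a ha.1]
  | loop x e p hp =>
    rw [run_loop]
    exact frame_iter S K x p e s hp _

/-- The invariant rule for loops, with a bound `b k` for the time of iteration `k`. -/
theorem loop_rule (x : ℕ) (e : NatExp) (p : Prog) (s : MachineState R) (n : ℕ)
    (hn : e.eval s = n) (I : ℕ → MachineState R → Prop) (b : ℕ → ℕ)
    (hx : ∀ k s v, I k s → I k (s.setVar x v)) (h0 : I 0 s)
    (hs : ∀ k < n, ∀ s₁, Frame (.loop x e p) s s₁ → s₁.var x = k → I k s₁ →
      I (k + 1) (p.run S K s₁).1 ∧ (p.run S K s₁).2 ≤ b k) :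
    I n ((Prog.loop x e p).run S K s).1 ∧
      ((Prog.loop x e p).run S K s).2 ≤ 1 + e.cost + ∑ k ∈ Finset.range n, (b k + 1) := by
  rw [run_loop, hn]
  have key : ∀ k ≤ n, I k (iter S K x p s k).1 ∧
      (iter S K x p s k).2 ≤ ∑ k ∈ Finset.range k, (b k + 1) := by
    intro k
    induction k with
    | zero => exact fun _ => ⟨h0, by simp [iter]⟩
    | succ k ih =>
      intro hk
      obtain ⟨h1, h2⟩ := ih (by omega)
      obtain ⟨h3, h4⟩ := hs k (by omega) ((iter S K x p s k).1.setVar x k)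
        ((frame_iter S K x p e s (frame_run S K p) k).trans
          ⟨fun y hy => by
            simp only [writesVar, Bool.or_eq_false_iff, beq_eq_false_iff_ne] at hy
            rw [MachineState.setVar_var, if_neg hy.1], fun _ _ => rfl, fun _ _ => rfl⟩)
        (by simp) (hx _ _ _ h1)
      refine ⟨h3, ?_⟩
      rw [Finset.sum_range_succ]
      simp only [iter]
      omega
  obtain ⟨h1, h2⟩ := key n le_rfl
  refine ⟨h1, ?_⟩
  simp only
  omega

/-- The invariant rule for loops, with a uniform bound for the time of an iteration. -/
theorem loop_rule_const (x : ℕ) (e : NatExp) (p : Prog) (s : MachineState R) (n : ℕ)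
    (hn : e.eval s = n) (I : ℕ → MachineState R → Prop) (b : ℕ)
    (hx : ∀ k s v, I k s → I k (s.setVar x v)) (h0 : I 0 s)
    (hs : ∀ k < n, ∀ s₁, Frame (.loop x e p) s s₁ → s₁.var x = k → I k s₁ →
      I (k + 1) (p.run S K s₁).1 ∧ (p.run S K s₁).2 ≤ b) :
    I n ((Prog.loop x e p).run S K s).1 ∧
      ((Prog.loop x e p).run S K s).2 ≤ 1 + e.cost + n * (b + 1) := by
  simpa using loop_rule S K x e p s n hn I (fun _ => b) hx h0 hs

end Prog

/-! ### Merge sort -/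

/-- Both block starts are `w * (k / w)`. This identifies the block that a merge is filling with the
block in which sortedness is asked for. -/
theorem eq_of_dvd_of_mem_block {w s s' k : ℕ} (h : w ∣ s) (h' : w ∣ s') (hs : s ≤ k)
    (hk : k < s + w) (hs' : s' ≤ k) (hk' : k < s' + w) : s = s' := by
  obtain ⟨a, rfl⟩ := h
  obtain ⟨b, rfl⟩ := h'
  have hw : 0 < w := by omega
  have h1 : k / w = a := Nat.div_eq_of_lt_le (by rw [mul_comm]; exact hs) (by rw [add_mul, mul_comm a]; omega)
  have h2 : k / w = b := Nat.div_eq_of_lt_le (by rw [mul_comm]; exact hs') (by rw [add_mul, mul_comm b]; omega)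
  rw [← h1, ← h2]

/-- The blocks of length `w` of the first `N` items of `A` are sorted by `v`. -/
def BlockSorted (v : ℕ → ℝ) (A : ℕ → ℕ) (w N : ℕ) : Prop :=
  ∀ s, w ∣ s → ∀ x y, s ≤ x → x ≤ y → y < s + w → y < N → v (A x) ≤ v (A y)

/-- The state of a merge pass after `k` outputs: the blocks `[p, pe)` and `[q, qe)` of `A` are being
merged into `B`. -/
structure MergeInv (v : ℕ → ℝ) (A : ℕ → ℕ) (N w k p pe q qe : ℕ) (B : ℕ → ℕ) : Prop where
  hp : p ≤ pe
  hpq : pe ≤ q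
  hq : q ≤ qe
  hqe : qe ≤ N
  count : k + pe = p + q
  dvd : 2 * w ∣ qe ∨ qe = N
  left : ∀ x y, p ≤ x → x ≤ y → y < pe → v (A x) ≤ v (A y)
  right : ∀ x y, q ≤ x → x ≤ y → y < qe → v (A x) ≤ v (A y)
  out : ∃ s, 2 * w ∣ s ∧ s ≤ k ∧ qe ≤ s + 2 * w ∧ ∀ x, s ≤ x → x < k →
    ∀ y, (p ≤ y ∧ y < pe) ∨ (q ≤ y ∧ y < qe) → v (B x) ≤ v (A y)
  sorted : ∀ s, 2 * w ∣ s → ∀ x y, s ≤ x → x ≤ y → y < s + 2 * w → y < k → v (B x) ≤ v (B y)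
  surj : ∀ e < N, (∃ x < k, B x = A e) ∨ (p ≤ e ∧ e < pe) ∨ (q ≤ e ∧ e < N)

namespace MergeInv

variable {v : ℕ → ℝ} {A B : ℕ → ℕ} {N w k p pe q qe : ℕ}

theorem start (v : ℕ → ℝ) (A B : ℕ → ℕ) (N w : ℕ) : MergeInv v A N w 0 0 0 0 0 B where
  hp := le_rfl
  hpq := le_rfl
  hq := le_rfl
  hqe := Nat.zero_le _
  count := rfl
  dvd := Or.inl (dvd_zero _)
  left := by omega
  right := by omega
  out := ⟨0, dvd_zero _, le_rfl, by omega, by omega⟩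
  sorted := by omega
  surj := fun e he => Or.inr (Or.inr ⟨Nat.zero_le _, he⟩)

/-- When both blocks are used up, `count` forces `k = q`, and since `k < N` this is a multiple of `2
* w`. The next two blocks start there and are cut off at `N`; if a cut occurs, the right end is `N`
itself. -/
theorem reset (h : MergeInv v A N w k p p q q B) (hA : BlockSorted v A w N) (hk : k < N) :
    MergeInv v A N w k k (min (k + w) N) (min (k + w) N) (min (min (k + w) N + w) N) B := by
  have hkq : k = q := by have := h.count; omega
  have hdvd : 2 * w ∣ k := by
    rcases h.dvd with h' | h'
    · rwa [hkq]
    · omega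
  have hdw : w ∣ k := (Dvd.intro_left 2 rfl).trans hdvd
  refine ⟨by omega, le_rfl, by omega, by omega, by omega, ?_, ?_, ?_, ⟨k, hdvd, le_rfl, by omega,
    by omega⟩, h.sorted, ?_⟩
  · by_cases h1 : k + 2 * w ≤ N
    · left
      have : min (min (k + w) N + w) N = k + 2 * w := by omega
      rw [this]
      exact hdvd.add (dvd_refl _)
    · right
      omega
  · intro x y hx hxy hy
    exact hA k hdw x y hx hxy (by omega) (by omega)
  · intro x y hx hxy hy
    refine hA (k + w) (hdw.add (dvd_refl _)) x y ?_ hxy ?_ ?_ <;> omega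
  · intro e he
    rcases h.surj e he with h1 | h1 | h1
    · exact Or.inl h1
    · omega
    · by_cases h2 : e < min (k + w) N
      · right; left; omega
      · right; right; omega

/-- Item `p` is the least of its sorted block and, by the comparison, at most everything left in the
other one. By `out` it is at least everything already written to the current output block. -/
theorem takeLeft (h : MergeInv v A N w k p pe q qe B) (hlt : p < pe)
    (hle : q < qe → v (A p) ≤ v (A q)) {B' : ℕ → ℕ} (hB : ∀ x < k, B' x = B x)
    (hBk : B' k = A p) : MergeInv v A N w (k + 1) (p + 1) pe q qe B' := by
  obtain ⟨s, hs, hsk, hqe, hout⟩ := h.out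
  have hq := h.hq
  have hc := h.count
  have hmin : ∀ y, (p ≤ y ∧ y < pe) ∨ (q ≤ y ∧ y < qe) → v (A p) ≤ v (A y) := by
    rintro y (⟨h1, h2⟩ | ⟨h1, h2⟩)
    · exact h.left p y le_rfl h1 h2
    · exact (hle (by omega)).trans (h.right q y le_rfl h1 h2)
  refine ⟨hlt, h.hpq, h.hq, h.hqe, by omega, h.dvd, fun x y hx => h.left x y (by omega), h.right,
    ⟨s, hs, by omega, hqe, ?_⟩, ?_, ?_⟩
  · intro x hx hxk y hy
    have hy' : (p ≤ y ∧ y < pe) ∨ (q ≤ y ∧ y < qe) := by omega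
    by_cases hxk' : x = k
    · subst hxk'
      rw [hBk]
      exact hmin y hy'
    · rw [hB x (by omega)]
      exact hout x hx (by omega) y hy'
  · intro s' hs' x y hx hxy hy hyk
    by_cases hyk' : y = k
    · subst hyk'
      by_cases hxy' : x = y
      · rw [hxy']
      · rw [hB x (by omega), hBk]
        have : s = s' := eq_of_dvd_of_mem_block hs hs' hsk (by omega) (by omega) hy
        exact hout x (by omega) (by omega) p (Or.inl ⟨le_rfl, hlt⟩)
    · rw [hB x (by omega), hB y (by omega)]
      exact h.sorted s' hs' x y hx hxy hy (by omega)
  · intro e he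
    rcases h.surj e he with ⟨x, hx, hxe⟩ | h1 | h1
    · exact Or.inl ⟨x, by omega, by rw [hB x hx, hxe]⟩
    · by_cases hep : e = p
      · exact Or.inl ⟨k, by omega, by rw [hBk, hep]⟩
      · right; left; omega
    · exact Or.inr (Or.inr h1)

theorem takeRight (h : MergeInv v A N w k p pe q qe B) (hlt : q < qe)
    (hle : p < pe → v (A q) ≤ v (A p)) {B' : ℕ → ℕ} (hB : ∀ x < k, B' x = B x)
    (hBk : B' k = A q) : MergeInv v A N w (k + 1) p pe (q + 1) qe B' := by
  obtain ⟨s, hs, hsk, hqe, hout⟩ := h.out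
  have hpq := h.hpq
  have hp := h.hp
  have hqN := h.hqe
  have hc := h.count
  have hmin : ∀ y, (p ≤ y ∧ y < pe) ∨ (q ≤ y ∧ y < qe) → v (A q) ≤ v (A y) := by
    rintro y (⟨h1, h2⟩ | ⟨h1, h2⟩)
    · exact (hle (by omega)).trans (h.left p y le_rfl h1 h2)
    · exact h.right q y le_rfl h1 h2
  refine ⟨h.hp, by omega, hlt, h.hqe, by omega, h.dvd, h.left, fun x y hx => h.right x y (by omega),
    ⟨s, hs, by omega, hqe, ?_⟩, ?_, ?_⟩
  · intro x hx hxk y hy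
    have hy' : (p ≤ y ∧ y < pe) ∨ (q ≤ y ∧ y < qe) := by omega
    by_cases hxk' : x = k
    · subst hxk'
      rw [hBk]
      exact hmin y hy'
    · rw [hB x (by omega)]
      exact hout x hx (by omega) y hy'
  · intro s' hs' x y hx hxy hy hyk
    by_cases hyk' : y = k
    · subst hyk'
      by_cases hxy' : x = y
      · rw [hxy']
      · rw [hB x (by omega), hBk]
        have : s = s' := eq_of_dvd_of_mem_block hs hs' hsk (by omega) (by omega) hy
        exact hout x (by omega) (by omega) q (Or.inr ⟨le_rfl, hlt⟩)
    · rw [hB x (by omega), hB y (by omega)]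
      exact h.sorted s' hs' x y hx hxy hy (by omega)
  · intro e he
    rcases h.surj e he with ⟨x, hx, hxe⟩ | h1 | h1
    · exact Or.inl ⟨x, by omega, by rw [hB x hx, hxe]⟩
    · exact Or.inr (Or.inl h1)
    · by_cases hep : e = q
      · exact Or.inl ⟨k, by omega, by rw [hBk, hep]⟩
      · right; right; omega

theorem finish (h : MergeInv v A N w N p pe q qe B) :
    BlockSorted v B (2 * w) N ∧ ∀ e < N, ∃ x < N, B x = A e := by
  -- After `N` outputs `count` leaves no room: `p = pe` and `q = N`, so every item has been written.
  refine ⟨fun s hs x y hx hxy hy hyN => h.sorted s hs x y hx hxy hy hyN, fun e he => ?_⟩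
  have h1 := h.hp
  have h2 := h.hpq
  have h3 := h.hq
  have h4 := h.hqe
  have h5 := h.count
  rcases h.surj e he with h6 | h6 | h6
  · exact h6
  · omega
  · omega

end MergeInv

/-! ### Merge sort as a program. -/

namespace Prog

/-- Start with the next two blocks when both blocks are used up. -/
def mergeReset : Prog :=
  .ite (.eq (.var 11) (.var 12))
    (.ite (.eq (.var 13) (.var 14))
      (.seq (.assign 11 (.var 10))
      (.seq (.assign 12 (.sub (.var 3) (.sub (.var 3) (.add (.var 10) (.var 7)))))
      (.seq (.assign 13 (.var 12))
        (.assign 14 (.sub (.var 3) (.sub (.var 3) (.add (.var 12) (.var 7))))))))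
      .skip)
    .skip

/-- Find out whether the next item comes from the left block. -/
def mergeChoose : Prog :=
  .ite (.eq (.var 11) (.var 12)) (.assign 15 (.const 0))
    (.ite (.eq (.var 13) (.var 14)) (.assign 15 (.const 1))
      (.seq (.read 0 (.get 4 (.get 6 (.var 11) (.const 0)) (.const 0))
        (.get 5 (.get 6 (.var 11) (.const 0)) (.const 0)) (.var 8))
      (.seq (.read 1 (.get 4 (.get 6 (.var 13) (.const 0)) (.const 0))
        (.get 5 (.get 6 (.var 13) (.const 0)) (.const 0)) (.var 8))
        (.compare 15 0 1))))

/-- Output the next item. -/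
def mergeTake : Prog :=
  .ite (.var 15)
    (.seq (.store 7 (.var 10) (.const 0) (.get 6 (.var 11) (.const 0)))
      (.assign 11 (.add (.var 11) (.const 1))))
    (.seq (.store 7 (.var 10) (.const 0) (.get 6 (.var 13) (.const 0)))
      (.assign 13 (.add (.var 13) (.const 1))))

def mergeStep : Prog := .seq mergeReset (.seq mergeChoose mergeTake)

/-- One pass of merge sort, which merges the blocks of length `w` in pairs. -/
def mergePass : Prog :=
  .seq (.assign 11 (.const 0)) (.seq (.assign 12 (.const 0)) (.seq (.assign 13 (.const 0))
    (.seq (.assign 14 (.const 0)) (.seq (.loop 10 (.var 3) mergeStep)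
      (.seq (.loop 10 (.var 3) (.store 6 (.var 10) (.const 0) (.get 7 (.var 10) (.const 0))))
        (.assign 7 (.add (.var 7) (.var 7))))))))

variable {m d : ℕ} {Q : JoinQuery m d} {ρ : MulTree m} {R : Type*} (S : DBSketch Q ρ R)
  (K : SketchCosts)

/-- The invariant of a merge pass as a property of the machine state. -/
def MergeState (v : ℕ → ℝ) (N w k : ℕ) (s : MachineState R) : Prop :=
  MergeInv v (fun x => s.arr 6 x 0) N w k (s.var 11) (s.var 12) (s.var 13) (s.var 14)
    (fun x => s.arr 7 x 0)

theorem mergeReset_spec (v : ℕ → ℝ) (N w k : ℕ) (s : MachineState R) (hN : s.var 3 = N)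
    (hw : s.var 7 = w) (hk : s.var 10 = k) (hkN : k < N) (hw0 : 0 < w)
    (hA : BlockSorted v (fun x => s.arr 6 x 0) w N) (h : MergeState v N w k s) :
    MergeState v N w k (mergeReset.run S K s).1 ∧
      ((mergeReset.run S K s).1.var 11 < (mergeReset.run S K s).1.var 12 ∨
        (mergeReset.run S K s).1.var 13 < (mergeReset.run S K s).1.var 14) ∧
      (mergeReset.run S K s).2 ≤ 32 := by
  -- Expressions have no minimum; the cut-off at `N` is written with truncated subtraction.
  have hmin : ∀ x, N - (N - x) = min x N := by omega
  unfold mergeReset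
  by_cases h1 : s.var 11 = s.var 12
  · rw [run_ite_pos _ _ _ _ _ _ (by simp [NatExp.eval, h1])]
    by_cases h2 : s.var 13 = s.var 14
    · rw [run_ite_pos _ _ _ _ _ _ (by simp [NatExp.eval, h2])]
      simp only [run_seq_fst, run_seq_snd, run_assign, NatExp.eval, NatExp.cost,
        MachineState.setVar_var, MergeState, MachineState.setVar_arr, hN, hw, hk]
      simp only [Nat.reduceEqDiff, if_true, if_false, hmin]
      refine ⟨?_, by omega, by omega⟩
      unfold MergeState at h
      rw [← h1, ← h2] at h
      exact h.reset hA hkN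
    · rw [run_ite_neg _ _ _ _ _ _ (by simp [NatExp.eval, h2])]
      refine ⟨h, Or.inr (lt_of_le_of_ne h.hq h2), ?_⟩
      simp [NatExp.cost]
  · rw [run_ite_neg _ _ _ _ _ _ (by simp [NatExp.eval, h1])]
    refine ⟨h, Or.inl (lt_of_le_of_ne h.hp h1), ?_⟩
    simp [NatExp.cost]

theorem mergeChoose_spec (v : ℕ → ℝ) (N w k : ℕ) (s : MachineState R)
    (hv : ∀ e, Q.entry (s.arr 4 e 0) (s.arr 5 e 0) (s.var 8) = v e) (h : MergeState v N w k s)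
    (hne : s.var 11 < s.var 12 ∨ s.var 13 < s.var 14) :
    MergeState v N w k (mergeChoose.run S K s).1 ∧
      ((mergeChoose.run S K s).1.var 15 ≠ 0 → s.var 11 < s.var 12 ∧
        (s.var 13 < s.var 14 → v (s.arr 6 (s.var 11) 0) ≤ v (s.arr 6 (s.var 13) 0))) ∧
      ((mergeChoose.run S K s).1.var 15 = 0 → s.var 13 < s.var 14 ∧
        (s.var 11 < s.var 12 → v (s.arr 6 (s.var 13) 0) ≤ v (s.arr 6 (s.var 11) 0))) ∧
      (mergeChoose.run S K s).2 ≤ 40 := by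
  have hF := frame_run S K mergeChoose s
  have h6 := hF.arr 6 rfl
  have h7 := hF.arr 7 rfl
  have h11 := hF.var 11 rfl
  have h12 := hF.var 12 rfl
  have h13 := hF.var 13 rfl
  have h14 := hF.var 14 rfl
  refine ⟨?_, ?_⟩
  · unfold MergeState
    rw [h6, h7, h11, h12, h13, h14]
    exact h
  clear hF h6 h7 h11 h12 h13 h14
  have hp := h.hp
  have hq := h.hq
  unfold mergeChoose
  by_cases h1 : s.var 11 = s.var 12
  · rw [run_ite_pos _ _ _ _ _ _ (by simp [NatExp.eval, h1])]
    simp [NatExp.eval, NatExp.cost]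
    omega
  · rw [run_ite_neg _ _ _ _ _ _ (by simp [NatExp.eval, h1])]
    by_cases h2 : s.var 13 = s.var 14
    · rw [run_ite_pos _ _ _ _ _ _ (by simp [NatExp.eval, h2])]
      simp [NatExp.eval, NatExp.cost]
      omega
    · rw [run_ite_neg _ _ _ _ _ _ (by simp [NatExp.eval, h2])]
      simp only [run_seq_fst, run_seq_snd, run_read, run_compare, NatExp.eval, NatExp.cost,
        MachineState.setReal_var, MachineState.setReal_arr, MachineState.setVar_var,
        MachineState.setReal_real, hv]
      simp only [if_true, Nat.reduceEqDiff, if_false]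
      refine ⟨?_, ?_, ?_⟩
      · intro h3
        refine ⟨by omega, fun _ => ?_⟩
        by_contra h4
        simp [h4] at h3
      · intro h3
        refine ⟨by omega, fun _ => ?_⟩
        by_contra h4
        simp [(not_le.1 h4).le] at h3
      · simp

theorem mergeTake_spec (v : ℕ → ℝ) (N w k : ℕ) (s : MachineState R) (hk : s.var 10 = k)
    (h : MergeState v N w k s)
    (hl : s.var 15 ≠ 0 → s.var 11 < s.var 12 ∧
        (s.var 13 < s.var 14 → v (s.arr 6 (s.var 11) 0) ≤ v (s.arr 6 (s.var 13) 0)))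
    (hr : s.var 15 = 0 → s.var 13 < s.var 14 ∧
        (s.var 11 < s.var 12 → v (s.arr 6 (s.var 13) 0) ≤ v (s.arr 6 (s.var 11) 0))) :
    MergeState v N w (k + 1) (mergeTake.run S K s).1 ∧ (mergeTake.run S K s).2 ≤ 20 := by
  unfold mergeTake
  by_cases h1 : s.var 15 = 0
  · rw [run_ite_neg _ _ _ _ _ _ (by simpa [NatExp.eval] using h1)]
    obtain ⟨h2, h3⟩ := hr h1
    refine ⟨?_, by simp [NatExp.cost]⟩
    have := MergeInv.takeRight h h2 h3
      (B' := fun x => if x = k then s.arr 6 (s.var 13) 0 else s.arr 7 x 0)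
      (fun x hx => by simp [hx.ne]) (by simp)
    unfold MergeState
    simpa [NatExp.eval, hk] using this
  · rw [run_ite_pos _ _ _ _ _ _ (by simpa [NatExp.eval] using h1)]
    obtain ⟨h2, h3⟩ := hl h1
    refine ⟨?_, by simp [NatExp.cost]⟩
    have := MergeInv.takeLeft h h2 h3
      (B' := fun x => if x = k then s.arr 6 (s.var 11) 0 else s.arr 7 x 0)
      (fun x hx => by simp [hx.ne]) (by simp)
    unfold MergeState
    simpa [NatExp.eval, hk] using this

theorem mergeStep_spec (v : ℕ → ℝ) (N w k : ℕ) (s : MachineState R) (hN : s.var 3 = N)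
    (hw : s.var 7 = w) (hk : s.var 10 = k) (hkN : k < N) (hw0 : 0 < w)
    (hv : ∀ e, Q.entry (s.arr 4 e 0) (s.arr 5 e 0) (s.var 8) = v e)
    (hA : BlockSorted v (fun x => s.arr 6 x 0) w N) (h : MergeState v N w k s) :
    MergeState v N w (k + 1) (mergeStep.run S K s).1 ∧ (mergeStep.run S K s).2 ≤ 92 := by
  obtain ⟨a1, a2, a3⟩ := mergeReset_spec S K v N w k s hN hw hk hkN hw0 hA h
  have hF := frame_run S K mergeReset s
  obtain ⟨b1, b2, b3, b4⟩ := mergeChoose_spec S K v N w k (mergeReset.run S K s).1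
    (by rw [hF.arr 4 rfl, hF.arr 5 rfl, hF.var 8 rfl]; exact hv) a1 a2
  have hG := frame_run S K mergeChoose (mergeReset.run S K s).1
  rw [← hG.var 11 rfl, ← hG.var 12 rfl, ← hG.var 13 rfl, ← hG.var 14 rfl, ← hG.arr 6 rfl] at b2 b3
  obtain ⟨c1, c2⟩ := mergeTake_spec S K v N w k _
    (by rw [hG.var 10 rfl, hF.var 10 rfl]; exact hk) b1 b2 b3
  refine ⟨c1, ?_⟩
  unfold mergeStep
  rw [run_seq_snd, run_seq_snd]
  omega

/-- The items in array `6` are sorted in blocks of length `w`, and every item occurs. -/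
def SortState (v : ℕ → ℝ) (N w : ℕ) (s : MachineState R) : Prop :=
  BlockSorted v (fun x => s.arr 6 x 0) w N ∧ ∀ e < N, ∃ x < N, s.arr 6 x 0 = e

/-- The merge writes to array `7`, which is then copied back. Per item this takes `92 + 1` for a
merge step and `6 + 1` for the copy, whence the factor `100`. -/
theorem mergePass_spec (v : ℕ → ℝ) (N w : ℕ) (s : MachineState R) (hN : s.var 3 = N)
    (hw : s.var 7 = w) (hw0 : 0 < w)
    (hv : ∀ e, Q.entry (s.arr 4 e 0) (s.arr 5 e 0) (s.var 8) = v e) (h : SortState v N w s) :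
    SortState v N (2 * w) (mergePass.run S K s).1 ∧ (mergePass.run S K s).1.var 7 = 2 * w ∧
      (mergePass.run S K s).2 ≤ 100 * N + 20 := by
  obtain ⟨hA, hsurj⟩ := h
  unfold mergePass
  simp only [run_seq_fst, run_seq_snd]
  set s1 := ((Prog.assign 14 (.const 0)).run S K ((Prog.assign 13 (.const 0)).run S K
    ((Prog.assign 12 (.const 0)).run S K ((Prog.assign 11 (.const 0)).run S K s).1).1).1).1 with hs1
  have e3 : s1.var 3 = N := by simp [hs1, hN]
  have e7 : s1.var 7 = w := by simp [hs1, hw]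
  have e4 : s1.arr = s.arr := by simp [hs1]
  have e8 : s1.var 8 = s.var 8 := by simp [hs1]
  obtain ⟨a1, a2⟩ := loop_rule_const S K 10 (.var 3) mergeStep s1 N e3
    (fun k s => MergeState v N w k s) 92 (fun k s x h => by
      unfold MergeState at h ⊢
      simpa using h)
    (by
      unfold MergeState
      simp only [hs1, run_assign, MachineState.setVar_var, NatExp.eval, MachineState.setVar_arr]
      exact MergeInv.start _ _ _ _ _)
    (fun k hk s2 hF hk2 hI => mergeStep_spec S K v N w k s2 (by rw [hF.var 3 rfl, e3])
      (by rw [hF.var 7 rfl, e7]) hk2 hk hw0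
      (by rw [hF.arr 4 rfl, hF.arr 5 rfl, hF.var 8 rfl, e4, e8]; exact hv)
      (by rw [hF.arr 6 rfl, e4]; exact hA) hI)
  have hF1 := frame_run S K (.loop 10 (.var 3) mergeStep) s1
  set s2 := ((Prog.loop 10 (.var 3) mergeStep).run S K s1).1 with hs2
  obtain ⟨b1, b2⟩ := loop_rule_const S K 10 (.var 3)
    (.store 6 (.var 10) (.const 0) (.get 7 (.var 10) (.const 0))) s2 N
    (by simp only [NatExp.eval]; rw [hF1.var 3 rfl, e3])
    (fun k s => ∀ x < k, s.arr 6 x 0 = s2.arr 7 x 0) 6 (fun k s x h => h) (by simp)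
    (by
      intro k hk s3 hF hk3 hI
      refine ⟨?_, by simp [NatExp.cost]⟩
      intro x hx
      have h7 := hF.arr 7 rfl
      simp only [run_store, MachineState.setArr_arr, NatExp.eval, hk3, h7]
      by_cases hxk : x = k
      · simp [hxk]
      · simp [hxk, hI x (by omega)])
  have hF2 := frame_run S K (.loop 10 (.var 3)
    (.store 6 (.var 10) (.const 0) (.get 7 (.var 10) (.const 0)))) s2
  set s3 := ((Prog.loop 10 (.var 3)
    (.store 6 (.var 10) (.const 0) (.get 7 (.var 10) (.const 0)))).run S K s2).1 with hs3
  obtain ⟨c1, c2⟩ := MergeInv.finish a1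
  refine ⟨⟨?_, ?_⟩, ?_, ?_⟩
  · intro t ht x y hx hxy hy hyN
    simp only [run_assign, MachineState.setVar_arr]
    rw [b1 x (by omega), b1 y hyN]
    exact c1 t ht x y hx hxy hy hyN
  · intro e he
    obtain ⟨y, hy, rfl⟩ := hsurj e he
    obtain ⟨x, hx, hxy⟩ := c2 y hy
    refine ⟨x, hx, ?_⟩
    simp only [run_assign, MachineState.setVar_arr]
    rw [b1 x hx, hxy, hF1.arr 6 rfl, e4]
  · simp only [run_assign, MachineState.setVar_var, NatExp.eval, if_true]
    rw [hF2.var 7 rfl, hF1.var 7 rfl, e7]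
    omega
  · simp only [NatExp.cost, run_assign] at a2 b2 ⊢
    omega

end Prog

/-! ### Preparation: numbering the rows and the values of every column -/

/-- The first `N` items are the rows of the tables before `i` and the first `r` rows of table `i`. -/
structure ItemsUpTo (sz : ℕ → ℕ) (i r N : ℕ) (IT IR : ℕ → ℕ) : Prop where
  range : ∀ e < N, (IT e < i ∨ (IT e = i ∧ IR e < r)) ∧ IR e < sz (IT e)
  inj : ∀ e < N, ∀ e' < N, IT e = IT e' → IR e = IR e' → e = e'
  surj : ∀ i' r', (i' < i ∧ r' < sz i') ∨ (i' = i ∧ r' < r) → ∃ e < N, IT e = i' ∧ IR e = r'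
  bound : ∀ n, (∀ i, sz i ≤ n) → N ≤ i * n + r

namespace ItemsUpTo

variable {sz : ℕ → ℕ} {i r N : ℕ} {IT IR : ℕ → ℕ}

theorem start (IT IR : ℕ → ℕ) : ItemsUpTo sz 0 0 0 IT IR :=
  ⟨by omega, by omega, by omega, by omega⟩

theorem succ (h : ItemsUpTo sz i r N IT IR) (hr : r < sz i) {IT' IR' : ℕ → ℕ}
    (h1 : ∀ e < N, IT' e = IT e) (h2 : ∀ e < N, IR' e = IR e) (h3 : IT' N = i) (h4 : IR' N = r) :
    ItemsUpTo sz i (r + 1) (N + 1) IT' IR' := by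
  refine ⟨?_, ?_, ?_, fun n hn => by have := h.bound n hn; omega⟩
  · intro e he
    by_cases heN : e = N
    · subst heN
      rw [h3, h4]
      exact ⟨Or.inr ⟨rfl, by omega⟩, hr⟩
    · rw [h1 e (by omega), h2 e (by omega)]
      have := h.range e (by omega)
      exact ⟨by omega, this.2⟩
  · intro e he e' he' ht hr'
    by_cases heN : e = N
    · by_cases heN' : e' = N
      · omega
      · subst heN
        rw [h3, h1 e' (by omega)] at ht
        rw [h4, h2 e' (by omega)] at hr'
        have := h.range e' (by omega)
        omega
    · by_cases heN' : e' = N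
      · subst heN'
        rw [h3, h1 e (by omega)] at ht
        rw [h4, h2 e (by omega)] at hr'
        have := h.range e (by omega)
        omega
      · rw [h1 e (by omega), h1 e' (by omega)] at ht
        rw [h2 e (by omega), h2 e' (by omega)] at hr'
        exact h.inj e (by omega) e' (by omega) ht hr'
  · intro i' r' hir
    by_cases hlast : i' = i ∧ r' = r
    · exact ⟨N, by omega, by omega, by omega⟩
    · obtain ⟨e, he, he1, he2⟩ := h.surj i' r' (by omega)
      exact ⟨e, by omega, by rw [h1 e he, he1], by rw [h2 e he, he2]⟩

theorem nextTable (h : ItemsUpTo sz i (sz i) N IT IR) : ItemsUpTo sz (i + 1) 0 N IT IR := by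
  refine ⟨?_, h.inj, ?_, ?_⟩
  · intro e he
    have := h.range e he
    exact ⟨by omega, this.2⟩
  · intro i' r' hir
    refine h.surj i' r' ?_
    by_cases hi : i' = i
    · subst hi
      omega
    · omega
  · intro n hn
    have h1 := h.bound n hn
    have h2 := hn i
    rw [add_mul]
    omega

end ItemsUpTo

/-! ### Programs that number the rows, and the values of every column. -/

namespace Prog

/-- Number the rows of all tables. -/
def numberRows : Prog :=
  .seq (.assign 3 (.const 0))
    (.loop 4 (.var 0) (.loop 5 (.get 0 (.var 4) (.const 0))
      (.seq (.store 4 (.var 3) (.const 0) (.var 4))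
      (.seq (.store 5 (.var 3) (.const 0) (.var 5))
        (.assign 3 (.add (.var 3) (.const 1)))))))

/-- Register `6` := the number of passes of merge sort. -/
def countPasses : Prog :=
  .seq (.assign 6 (.const 0)) (.seq (.assign 7 (.const 1))
    (.loop 10 (.var 3) (.ite (.le (.var 3) (.var 7)) .skip
      (.seq (.assign 7 (.add (.var 7) (.var 7))) (.assign 6 (.add (.var 6) (.const 1)))))))

/-- Sort the items by the column in register `8`. -/
def sortColumn : Prog :=
  .seq (.loop 10 (.var 3) (.store 6 (.var 10) (.const 0) (.var 10)))
    (.seq (.assign 7 (.const 1)) (.loop 9 (.var 6) mergePass))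

/-- Number the values of the sorted items. -/
def numberValues : Prog :=
  .loop 10 (.var 3) (.seq
    (.ite (.eq (.var 10) (.const 0)) .skip
      (.seq (.read 0 (.get 4 (.get 6 (.var 10) (.const 0)) (.const 0))
        (.get 5 (.get 6 (.var 10) (.const 0)) (.const 0)) (.var 8))
      (.seq (.read 1 (.get 4 (.get 6 (.sub (.var 10) (.const 1)) (.const 0)) (.const 0))
        (.get 5 (.get 6 (.sub (.var 10) (.const 1)) (.const 0)) (.const 0)) (.var 8))
      (.seq (.compare 15 0 1)
        (.ite (.var 15) .skip (.assign 17 (.add (.var 17) (.const 1))))))))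
    (.store 8 (.var 8) (.get 6 (.var 10) (.const 0)) (.var 17)))

def prepare : Prog :=
  .seq numberRows (.seq countPasses (.loop 8 (.var 1) (.seq sortColumn numberValues)))

variable {m d : ℕ} {Q : JoinQuery m d} {ρ : MulTree m} {R : Type*} (S : DBSketch Q ρ R)
  (K : SketchCosts)

theorem numberRows_spec (s : MachineState R) (n : ℕ) (hm : s.var 0 = m)
    (hn : ∀ i, s.arr 0 i 0 ≤ n) :
    ItemsUpTo (fun i => s.arr 0 i 0) m 0 ((numberRows.run S K s).1.var 3)
      (fun e => (numberRows.run S K s).1.arr 4 e 0) (fun e => (numberRows.run S K s).1.arr 5 e 0) ∧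
      (numberRows.run S K s).2 ≤ 4 + m * (5 + n * 14) := by
  unfold numberRows
  simp only [run_seq_fst, run_seq_snd, run_assign, NatExp.eval]
  obtain ⟨a1, a2⟩ := loop_rule_const S K 4 (.var 0) (.loop 5 (.get 0 (.var 4) (.const 0))
      (.seq (.store 4 (.var 3) (.const 0) (.var 4))
      (.seq (.store 5 (.var 3) (.const 0) (.var 5))
        (.assign 3 (.add (.var 3) (.const 1)))))) (s.setVar 3 0) m (by simp [NatExp.eval, hm])
    (fun i s' => ItemsUpTo (fun i => s.arr 0 i 0) i 0 (s'.var 3) (fun e => s'.arr 4 e 0)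
      (fun e => s'.arr 5 e 0)) (4 + n * 14) (fun k s v h => by simpa using h)
    (by simpa using ItemsUpTo.start _ _) (by
      intro i hi s1 hF hi1 hI
      obtain ⟨b1, b2⟩ := loop_rule_const S K 5 (.get 0 (.var 4) (.const 0))
        (.seq (.store 4 (.var 3) (.const 0) (.var 4))
        (.seq (.store 5 (.var 3) (.const 0) (.var 5))
          (.assign 3 (.add (.var 3) (.const 1))))) s1 (s.arr 0 i 0)
        (by simp only [NatExp.eval, hi1]; rw [hF.arr 0 rfl]; rfl)
        (fun r s' => ItemsUpTo (fun i => s.arr 0 i 0) i r (s'.var 3) (fun e => s'.arr 4 e 0)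
          (fun e => s'.arr 5 e 0)) 13 (fun k s v h => by simpa using h) hI (by
          intro r hr s2 hF2 hr2 hI2
          have h4 : s2.var 4 = i := by rw [hF2.var 4 rfl, hi1]
          refine ⟨?_, by simp [NatExp.cost]⟩
          simp only [run_seq_fst, run_store, run_assign, NatExp.eval, MachineState.setVar_var,
            MachineState.setVar_arr, MachineState.setArr_arr, MachineState.setArr_var, if_true]
          apply hI2.succ hr
          · intro e he
            simp [he.ne]
          · intro e he
            simp [he.ne]
          · simp [h4]
          · simp [hr2])
      refine ⟨b1.nextTable, b2.trans ?_⟩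
      have := Nat.mul_le_mul_right 14 (hn i)
      simp only [NatExp.cost]
      omega)
  refine ⟨a1, ?_⟩
  simp only [NatExp.cost] at a2 ⊢
  have : 4 + n * 14 + 1 = 5 + n * 14 := by omega
  rw [this] at a2
  omega

/-- The width is doubled only while it is below `N`, so it never exceeds `2 * N`; the `+ 1` is for
`N = 0`. Running `N` iterations is enough because `N < 2 ^ N`, and the linear cost is harmless. -/
theorem countPasses_spec (s : MachineState R) (N : ℕ) (hN : s.var 3 = N) :
    N ≤ 2 ^ (countPasses.run S K s).1.var 6 ∧ 2 ^ (countPasses.run S K s).1.var 6 ≤ 2 * N + 1 ∧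
      (countPasses.run S K s).2 ≤ 6 + N * 14 := by
  unfold countPasses
  simp only [run_seq_fst, run_seq_snd, run_assign, NatExp.eval]
  obtain ⟨⟨a1, a2, a3⟩, a4⟩ := loop_rule_const S K 10 (.var 3)
    (.ite (.le (.var 3) (.var 7)) .skip
      (.seq (.assign 7 (.add (.var 7) (.var 7))) (.assign 6 (.add (.var 6) (.const 1)))))
    ((s.setVar 6 0).setVar 7 1) N (by simp [NatExp.eval, hN])
    (fun k s => s.var 7 = 2 ^ s.var 6 ∧ (N ≤ s.var 7 ∨ k ≤ s.var 6) ∧ s.var 7 ≤ 2 * N + 1) 13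
    (fun k s v h => by simpa using h) (by simp) (by
      intro k hk s1 hF hk1 hI
      obtain ⟨h1, h2, h3⟩ := hI
      have h4 : s1.var 3 = N := by rw [hF.var 3 rfl]; simp [hN]
      by_cases h : N ≤ s1.var 7
      · rw [run_ite_pos _ _ _ _ _ _ (by simp [NatExp.eval, h4, h])]
        exact ⟨⟨h1, Or.inl h, h3⟩, by simp [NatExp.cost]⟩
      · rw [run_ite_neg _ _ _ _ _ _ (by simp [NatExp.eval, h4, h])]
        refine ⟨?_, by simp [NatExp.cost]⟩
        simp only [run_seq_fst, run_assign, NatExp.eval, MachineState.setVar_var]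
        simp only [Nat.reduceEqDiff, if_true, if_false, pow_succ]
        omega)
  rw [a1] at a2 a3
  refine ⟨?_, a3, ?_⟩
  · rcases a2 with h | h
    · exact h
    · exact h.trans Nat.lt_two_pow_self.le
  · simp only [NatExp.cost] at a4 ⊢
    omega

/-- Blocks of length `1` are sorted in any order, in particular in the initial order by number, and
each pass doubles the length. -/
theorem sortColumn_spec (v : ℕ → ℝ) (N L : ℕ) (s : MachineState R) (hN : s.var 3 = N)
    (hL : s.var 6 = L) (hv : ∀ e, Q.entry (s.arr 4 e 0) (s.arr 5 e 0) (s.var 8) = v e) :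
    SortState v N (2 ^ L) (sortColumn.run S K s).1 ∧
      (sortColumn.run S K s).2 ≤ 6 + N * 5 + L * (100 * N + 21) := by
  unfold sortColumn
  simp only [run_seq_fst, run_seq_snd]
  obtain ⟨a1, a2⟩ := loop_rule_const S K 10 (.var 3) (.store 6 (.var 10) (.const 0) (.var 10)) s N
    hN (fun k s => ∀ x < k, s.arr 6 x 0 = x) 4 (fun k s v h => h) (by simp) (by
      intro k hk s1 hF hk1 hI
      refine ⟨?_, by simp [NatExp.cost]⟩
      intro x hx
      simp only [run_store, MachineState.setArr_arr, NatExp.eval, hk1]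
      by_cases hxk : x = k
      · simp [hxk]
      · simp [hxk, hI x (by omega)])
  have hF1 := frame_run S K (.loop 10 (.var 3) (.store 6 (.var 10) (.const 0) (.var 10))) s
  set s1 := ((Prog.loop 10 (.var 3) (.store 6 (.var 10) (.const 0) (.var 10))).run S K s).1
  obtain ⟨b1, b2⟩ := loop_rule_const S K 9 (.var 6) mergePass
    ((Prog.assign 7 (.const 1)).run S K s1).1 L
    (by simp only [NatExp.eval, run_assign, MachineState.setVar_var]; rw [hF1.var 6 rfl]; simp [hL])
    (fun k s => SortState v N (2 ^ k) s ∧ s.var 7 = 2 ^ k) (100 * N + 20)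
    (fun k s v h => by simpa [SortState] using h) (by
      refine ⟨⟨?_, ?_⟩, by simp [NatExp.eval]⟩
      · intro t _ x y hx hxy hy _
        have : x = y := by omega
        rw [this]
      · intro e he
        exact ⟨e, he, by simpa using a1 e he⟩)
    (by
      intro k hk s2 hF hk2 hI
      obtain ⟨c1, c2, c3⟩ := mergePass_spec S K v N (2 ^ k) s2
        (by rw [hF.var 3 rfl]; simp only [run_assign, MachineState.setVar_var]
            rw [hF1.var 3 rfl]; simp [hN]) hI.2 (by positivity)
        (by
          rw [hF.arr 4 rfl, hF.arr 5 rfl, hF.var 8 rfl]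
          simp only [run_assign, MachineState.setVar_var, MachineState.setVar_arr]
          rw [hF1.arr 4 rfl, hF1.arr 5 rfl, hF1.var 8 rfl]
          simpa using hv) hI.1
      rw [pow_succ, mul_comm]
      exact ⟨⟨c1, c2⟩, c3⟩)
  refine ⟨b1.1, ?_⟩
  simp only [NatExp.cost, run_assign] at a2 b2 ⊢
  have : 100 * N + 20 + 1 = 100 * N + 21 := by omega
  rw [this] at b2
  omega

/-- After sorting, equal values are contiguous, so a counter that goes up exactly at strict
increases separates the values. The counter is not reset between columns, since numbers are only
compared within one column. -/
theorem numberValues_spec (v : ℕ → ℝ) (N c : ℕ) (s : MachineState R) (hN : s.var 3 = N)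
    (hc : s.var 8 = c) (hv : ∀ e, Q.entry (s.arr 4 e 0) (s.arr 5 e 0) c = v e)
    (hs : ∀ x y, x ≤ y → y < N → v (s.arr 6 x 0) ≤ v (s.arr 6 y 0))
    (hsurj : ∀ e < N, ∃ x < N, s.arr 6 x 0 = e) :
    (∀ e < N, ∀ e' < N, (numberValues.run S K s).1.arr 8 c e = (numberValues.run S K s).1.arr 8 c e' ↔
      v e = v e') ∧
      (∀ c' ≠ c, ∀ e, (numberValues.run S K s).1.arr 8 c' e = s.arr 8 c' e) ∧
      (numberValues.run S K s).2 ≤ 2 + N * 60 := by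
  unfold numberValues
  obtain ⟨⟨a1, a2, a3, a4⟩, a5⟩ := loop_rule_const S K 10 (.var 3) (.seq
    (.ite (.eq (.var 10) (.const 0)) .skip
      (.seq (.read 0 (.get 4 (.get 6 (.var 10) (.const 0)) (.const 0))
        (.get 5 (.get 6 (.var 10) (.const 0)) (.const 0)) (.var 8))
      (.seq (.read 1 (.get 4 (.get 6 (.sub (.var 10) (.const 1)) (.const 0)) (.const 0))
        (.get 5 (.get 6 (.sub (.var 10) (.const 1)) (.const 0)) (.const 0)) (.var 8))
      (.seq (.compare 15 0 1)
        (.ite (.var 15) .skip (.assign 17 (.add (.var 17) (.const 1))))))))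
    (.store 8 (.var 8) (.get 6 (.var 10) (.const 0)) (.var 17))) s N hN
    (fun k s' => (∀ x < k, ∀ y < k,
        s'.arr 8 c (s.arr 6 x 0) = s'.arr 8 c (s.arr 6 y 0) ↔ v (s.arr 6 x 0) = v (s.arr 6 y 0)) ∧
      (∀ x < k, s'.arr 8 c (s.arr 6 x 0) ≤ s'.var 17) ∧
      (0 < k → s'.arr 8 c (s.arr 6 (k - 1) 0) = s'.var 17) ∧
      ∀ c' ≠ c, ∀ e, s'.arr 8 c' e = s.arr 8 c' e) 59
    (fun k s v h => by simpa using h) (by simp) (by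
      intro k hk s1 hF hk1 hI
      obtain ⟨h1, h2, h3, h4⟩ := hI
      have h6 := hF.arr 6 rfl
      have h8 : s1.var 8 = c := by rw [hF.var 8 rfl, hc]
      have hv1 : ∀ e, Q.entry (s1.arr 4 e 0) (s1.arr 5 e 0) c = v e := by
        rw [hF.arr 4 rfl, hF.arr 5 rfl]
        exact hv
      -- the effect of one iteration on the counter
      suffices hcnt : ∀ cnt, (cnt = s1.var 17 ∧ (0 < k → v (s.arr 6 k 0) = v (s.arr 6 (k - 1) 0)) ∨
          0 < k ∧ cnt = s1.var 17 + 1 ∧ v (s.arr 6 (k - 1) 0) < v (s.arr 6 k 0)) →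
          ∀ s' : MachineState R, s'.var 17 = cnt →
          (∀ c' e, s'.arr 8 c' e = if c' = c ∧ e = s.arr 6 k 0 then cnt else s1.arr 8 c' e) →
          (∀ x < k + 1, ∀ y < k + 1,
            s'.arr 8 c (s.arr 6 x 0) = s'.arr 8 c (s.arr 6 y 0) ↔
              v (s.arr 6 x 0) = v (s.arr 6 y 0)) ∧
          (∀ x < k + 1, s'.arr 8 c (s.arr 6 x 0) ≤ s'.var 17) ∧
          (0 < k + 1 → s'.arr 8 c (s.arr 6 (k + 1 - 1) 0) = s'.var 17) ∧
          ∀ c' ≠ c, ∀ e, s'.arr 8 c' e = s.arr 8 c' e by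
        simp only [run_seq_fst, run_seq_snd]
        by_cases hk0 : k = 0
        · rw [run_ite_pos _ _ _ _ _ _ (by simp [NatExp.eval, hk1, hk0])]
          refine ⟨hcnt (s1.var 17) (Or.inl ⟨rfl, by omega⟩) _ ?_ ?_, by simp [NatExp.cost]⟩
          · simp
          · intro c' e
            simp [NatExp.eval, h8, hk1, h6]
        · rw [run_ite_neg _ _ _ _ _ _ (by simp [NatExp.eval, hk1, hk0])]
          simp only [run_seq_fst, run_seq_snd, run_read, run_compare, NatExp.eval]
          simp only [MachineState.setReal_var, MachineState.setReal_arr,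
            MachineState.setReal_real, h8, hv1, hk1, h6, Nat.reduceEqDiff, if_true, if_false]
          by_cases hle : v (s.arr 6 k 0) ≤ v (s.arr 6 (k - 1) 0)
          · rw [run_ite_pos _ _ _ _ _ _ (by simp [NatExp.eval, hle])]
            refine ⟨hcnt (s1.var 17) (Or.inl ⟨rfl, fun _ => le_antisymm hle
              (hs _ _ (by omega) hk)⟩) _ ?_ ?_, by simp [NatExp.cost]⟩
            · simp
            · intro c' e
              simp [NatExp.eval, h8, hk1, h6]
          · rw [run_ite_neg _ _ _ _ _ _ (by simp [NatExp.eval, hle])]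
            refine ⟨hcnt (s1.var 17 + 1) (Or.inr ⟨by omega, rfl, not_le.1 hle⟩) _ ?_ ?_,
              by simp [NatExp.cost]⟩
            · simp [NatExp.eval]
            · intro c' e
              simp [NatExp.eval, h8, hk1, h6]
      intro cnt hcase s' hs17 hs8
      -- The order is only known to contain every item, not to be free of repetitions. If the item
      -- at `k` has occurred before, its value did not increase at `k`, and the same number is
      -- written again.
      have hold : ∀ x < k, s'.arr 8 c (s.arr 6 x 0) = s1.arr 8 c (s.arr 6 x 0) := by
        intro x hx
        rw [hs8]
        split_ifs with heq
        · rcases hcase with ⟨hc1, hc2⟩ | ⟨_, hc1, hc2⟩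
          · rw [hc1, ← h3 (by omega), h1 _ (by omega) _ hx, ← hc2 (by omega), heq.2]
          · have := hs x (k - 1) (by omega) (by omega)
            rw [heq.2] at this
            exact absurd this (not_le.2 hc2)
        · rfl
      have hnew : s'.arr 8 c (s.arr 6 k 0) = cnt := by
        rw [hs8]
        simp
      have hxk : ∀ x < k, s'.arr 8 c (s.arr 6 x 0) = s'.arr 8 c (s.arr 6 k 0) ↔
          v (s.arr 6 x 0) = v (s.arr 6 k 0) := by
        intro x hx
        rw [hold x hx, hnew]
        rcases hcase with ⟨hc1, hc2⟩ | ⟨_, hc1, hc2⟩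
        · rw [hc1, ← h3 (by omega), h1 x hx _ (by omega), hc2 (by omega)]
        · have h5 := hs x (k - 1) (by omega) (by omega)
          have h7 := h2 x hx
          constructor
          · omega
          · intro h9
            rw [h9] at h5
            exact absurd h5 (not_le.2 hc2)
      refine ⟨?_, ?_, ?_, ?_⟩
      · intro x hx y hy
        by_cases hx' : x = k
        · by_cases hy' : y = k
          · rw [hx', hy']
            simp
          · rw [hx', eq_comm, hxk y (by omega), eq_comm]
        · by_cases hy' : y = k
          · rw [hy']
            exact hxk x (by omega)
          · rw [hold x (by omega), hold y (by omega)]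
            exact h1 x (by omega) y (by omega)
      · intro x hx
        by_cases hx' : x = k
        · rw [hx', hnew, hs17]
        · rw [hold x (by omega), hs17]
          have := h2 x (by omega)
          omega
      · intro _
        rw [Nat.add_sub_cancel, hnew, hs17]
      · intro c' hc' e
        rw [hs8, if_neg (fun h => hc' h.1)]
        exact h4 c' hc' e)
  refine ⟨?_, a4, ?_⟩
  · intro e he e' he'
    obtain ⟨x, hx, rfl⟩ := hsurj e he
    obtain ⟨y, hy, rfl⟩ := hsurj e' he'
    exact a1 x hx y hy
  · simp only [NatExp.cost] at a5
    omega

/-- The rows of all tables are numbered, and so are the values in every column. -/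
structure Prepared (Q : JoinQuery m d) (sz : ℕ → ℕ) (N : ℕ) (s : MachineState R) : Prop where
  var_three : s.var 3 = N
  items : ItemsUpTo sz m 0 N (fun e => s.arr 4 e 0) (fun e => s.arr 5 e 0)
  ids : ∀ c < d, ∀ e < N, ∀ e' < N, s.arr 8 c e = s.arr 8 c e' ↔
    Q.entry (s.arr 4 e 0) (s.arr 5 e 0) c = Q.entry (s.arr 4 e' 0) (s.arr 5 e' 0) c

/-- All rows of all tables are sorted together in every column, so that values of different tables
get comparable numbers. A table without the column takes part with the default entry `0`. -/
theorem prepare_spec (s : MachineState R) (n : ℕ) (hm : s.var 0 = m) (hd : s.var 1 = d)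
    (hn : ∀ i, s.arr 0 i 0 ≤ n) :
    ∃ N L, Prepared Q (fun i => s.arr 0 i 0) N (prepare.run S K s).1 ∧ 2 ^ L ≤ 2 * N + 1 ∧
      (prepare.run S K s).2 ≤ 12 + m * (5 + n * 14) + N * 14 +
        d * (9 + N * 65 + L * (100 * N + 21)) := by
  unfold prepare
  simp only [run_seq_fst, run_seq_snd]
  obtain ⟨a1, a2⟩ := numberRows_spec S K s n hm hn
  have hF1 := frame_run S K numberRows s
  set s1 := (numberRows.run S K s).1
  obtain ⟨b1, b2, b3⟩ := countPasses_spec S K s1 _ rfl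
  have hF2 := frame_run S K countPasses s1
  set s2 := (countPasses.run S K s1).1
  set N := s1.var 3
  set L := s2.var 6
  have h3 : s2.var 3 = N := hF2.var 3 rfl
  obtain ⟨c1, c2⟩ := loop_rule_const S K 8 (.var 1) (.seq sortColumn numberValues) s2 d
    (by simp only [NatExp.eval]; rw [hF2.var 1 rfl, hF1.var 1 rfl, hd])
    (fun k s => ∀ c < k, ∀ e < N, ∀ e' < N, s.arr 8 c e = s.arr 8 c e' ↔
      Q.entry (s2.arr 4 e 0) (s2.arr 5 e 0) c = Q.entry (s2.arr 4 e' 0) (s2.arr 5 e' 0) c)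
    (8 + N * 65 + L * (100 * N + 21)) (fun k s v h => h) (by simp) (by
      intro c hc s3 hF hc3 hI
      simp only [run_seq_fst, run_seq_snd]
      set v : ℕ → ℝ := fun e => Q.entry (s2.arr 4 e 0) (s2.arr 5 e 0) c with hv
      obtain ⟨⟨d1, d2⟩, d3⟩ := sortColumn_spec S K v N L s3 (by rw [hF.var 3 rfl, h3]) (hF.var 6 rfl)
        (by rw [hF.arr 4 rfl, hF.arr 5 rfl, hc3]; exact fun _ => rfl)
      have hF4 := frame_run S K sortColumn s3
      set s4 := (sortColumn.run S K s3).1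
      obtain ⟨e1, e2, e3⟩ := numberValues_spec S K v N c s4
        (by rw [hF4.var 3 rfl, hF.var 3 rfl, h3]) (by rw [hF4.var 8 rfl, hc3])
        (by rw [hF4.arr 4 rfl, hF4.arr 5 rfl, hF.arr 4 rfl, hF.arr 5 rfl]; exact fun _ => rfl)
        (fun x y hxy hy => d1 0 (dvd_zero _) x y (Nat.zero_le _) hxy (by omega) hy) d2
      refine ⟨?_, by omega⟩
      intro c' hc' e he e' he'
      by_cases hcc : c' = c
      · rw [hcc]
        exact e1 e he e' he'
      · rw [e2 c' hcc, e2 c' hcc, hF4.arr 8 rfl]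
        exact hI c' (by omega) e he e' he')
  have hF3 := frame_run S K (.loop 8 (.var 1) (.seq sortColumn numberValues)) s2
  refine ⟨N, L, ⟨?_, ?_, ?_⟩, b2, ?_⟩
  · rw [hF3.var 3 rfl, h3]
  · rw [hF3.arr 4 rfl, hF3.arr 5 rfl, hF2.arr 4 rfl, hF2.arr 5 rfl]
    exact a1
  · rw [hF3.arr 4 rfl, hF3.arr 5 rfl]
    exact c1
  · have : 8 + N * 65 + L * (100 * N + 21) + 1 = 9 + N * 65 + L * (100 * N + 21) := by omega
    rw [this] at c2
    simp only [NatExp.cost] at c2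
    omega

end Prog

/-! ### Multiplying a factor into another one -/

namespace Prog

/-- Cell `(κ, v)` of array `12` holds the new key of the items with old key `κ` and value number
`v`. The content `0` means that no key has been given out; the counter is raised before it is
stored, so actual entries are positive. -/
def keyStep : Prog :=
  .seq (.ite (.get 12 (.get 11 (.var 21) (.const 0)) (.get 8 (.var 20) (.var 21))) .skip
      (.seq (.assign 24 (.add (.var 24) (.const 1)))
        (.store 12 (.get 11 (.var 21) (.const 0)) (.get 8 (.var 20) (.var 21)) (.var 24))))
    (.store 11 (.var 21) (.const 0)
      (.get 12 (.get 11 (.var 21) (.const 0)) (.get 8 (.var 20) (.var 21))))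

/-- Give all items keys, which are equal if and only if the items agree on the current columns of
the table in register `25`. -/
def computeKeys : Prog :=
  .seq (.loop 21 (.var 3) (.store 11 (.var 21) (.const 0) (.const 0)))
    (.loop 20 (.var 1) (.ite (.get 9 (.var 25) (.var 20)) (.loop 21 (.var 3) keyStep) .skip))

/-- Add up the values of the items of the table in register `25` with the same key. -/
def accumulate : Prog :=
  .loop 21 (.var 3) (.ite (.eq (.get 4 (.var 21) (.const 0)) (.var 25))
    (.ite (.get 10 (.var 21) (.const 0))
      (.seq (.ite (.get 13 (.var 23) (.get 11 (.var 21) (.const 0)))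
          (.sketchAdd ⟨3, .var 23, .get 11 (.var 21) (.const 0)⟩
            ⟨3, .var 23, .get 11 (.var 21) (.const 0)⟩ ⟨1, .var 21, .const 0⟩)
          (.copy ⟨3, .var 23, .get 11 (.var 21) (.const 0)⟩ ⟨1, .var 21, .const 0⟩))
        (.store 13 (.var 23) (.get 11 (.var 21) (.const 0)) (.const 1)))
      .skip) .skip)

/-- Multiply the values of the items of the table in register `26` by the sums for their keys. -/
def multiply : Prog :=
  .loop 21 (.var 3) (.ite (.eq (.get 4 (.var 21) (.const 0)) (.var 26))
    (.seq (.ite (.var 27)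
        (.sketchMul ⟨1, .var 21, .const 0⟩ ⟨3, .var 23, .get 11 (.var 21) (.const 0)⟩
          ⟨1, .var 21, .const 0⟩)
        (.sketchMul ⟨1, .var 21, .const 0⟩ ⟨1, .var 21, .const 0⟩
          ⟨3, .var 23, .get 11 (.var 21) (.const 0)⟩))
      (.ite (.get 13 (.var 23) (.get 11 (.var 21) (.const 0))) .skip
        (.store 10 (.var 21) (.const 0) (.const 0))))
    .skip)

/-- Multiply the factor of the table in register `25` into that of the table in register `26`. -/
def absorb : Prog :=
  .seq (.assign 23 (.add (.var 23) (.const 1)))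
    (.seq computeKeys (.seq accumulate (.seq multiply (.seq
      (.ite (.var 27)
        (.sketchMul ⟨2, .var 26, .const 0⟩ ⟨2, .var 25, .const 0⟩ ⟨2, .var 26, .const 0⟩)
        (.sketchMul ⟨2, .var 26, .const 0⟩ ⟨2, .var 26, .const 0⟩ ⟨2, .var 25, .const 0⟩))
      (.assign 28 (.var 26))))))

/-- The table that numbers pairs is injective, and its numbers have been given out. -/
structure TrieInv (tr : ℕ → ℕ → ℕ) (cnt : ℕ) : Prop where
  le : ∀ n s, tr n s ≤ cnt
  inj : ∀ n s n' s', tr n s ≠ 0 → tr n s = tr n' s' → n = n' ∧ s = s'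

theorem TrieInv.insert {tr : ℕ → ℕ → ℕ} {cnt : ℕ} (h : TrieInv tr cnt) (n s : ℕ) :
    TrieInv (fun n' s' => if n' = n ∧ s' = s then cnt + 1 else tr n' s') (cnt + 1) := by
  refine ⟨fun n' s' => ?_, fun n₁ s₁ n₂ s₂ h0 heq => ?_⟩
  · split_ifs
    · exact le_rfl
    · exact (h.le n' s').trans (Nat.le_succ _)
  · have h1 := h.le n₁ s₁
    have h2 := h.le n₂ s₂
    split_ifs at h0 heq with a b b
    · exact ⟨a.1.trans b.1.symm, a.2.trans b.2.symm⟩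
    · omega
    · omega
    · exact h.inj _ _ _ _ h0 heq

variable {m d : ℕ} {Q : JoinQuery m d} {ρ : MulTree m} {R : Type*} (S : DBSketch Q ρ R)
  (K : SketchCosts)

/-- Injectivity of the table of pairs makes new keys equal exactly if old keys and value numbers are
equal. The table may contain entries from earlier absorptions: they cost nothing and need not be
cleared. -/
theorem keyLoop_spec (s : MachineState R) (N c : ℕ) (hN : s.var 3 = N) (hc : s.var 20 = c)
    (hT : TrieInv (s.arr 12) (s.var 24)) :
    TrieInv (((Prog.loop 21 (.var 3) keyStep).run S K s).1.arr 12)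
        (((Prog.loop 21 (.var 3) keyStep).run S K s).1.var 24) ∧
      (∀ e < N, ∀ e' < N, ((Prog.loop 21 (.var 3) keyStep).run S K s).1.arr 11 e 0 =
          ((Prog.loop 21 (.var 3) keyStep).run S K s).1.arr 11 e' 0 ↔
        s.arr 11 e 0 = s.arr 11 e' 0 ∧ s.arr 8 c e = s.arr 8 c e') ∧
      ((Prog.loop 21 (.var 3) keyStep).run S K s).2 ≤ 2 + N * 41 := by
  obtain ⟨⟨a1, a2, a3⟩, a4⟩ := loop_rule_const S K 21 (.var 3) keyStep s N hN
    (fun k s' => TrieInv (s'.arr 12) (s'.var 24) ∧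
      (∀ e < k, s'.arr 11 e 0 = s'.arr 12 (s.arr 11 e 0) (s.arr 8 c e) ∧ s'.arr 11 e 0 ≠ 0) ∧
      ∀ e, k ≤ e → s'.arr 11 e 0 = s.arr 11 e 0) 40 (fun k s v h => by simpa using h)
    ⟨hT, by simp⟩ (by
      intro k hk s1 hF hk1 hI
      obtain ⟨h1, h2, h3⟩ := hI
      have h8 := hF.arr 8 rfl
      have h20 : s1.var 20 = c := by rw [hF.var 20 rfl, hc]
      have hkey := h3 k le_rfl
      unfold keyStep
      simp only [run_seq_fst, run_seq_snd]
      by_cases h0 : s1.arr 12 (s.arr 11 k 0) (s.arr 8 c k) = 0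
      · rw [run_ite_neg _ _ _ _ _ _ (by simp [NatExp.eval, hk1, h20, h8, hkey, h0])]
        refine ⟨⟨?_, ?_, ?_⟩, by simp [NatExp.cost]⟩
        · have := h1.insert (s.arr 11 k 0) (s.arr 8 c k)
          convert this using 1
          · funext n' s'
            simp [NatExp.eval, hk1, h20, h8, hkey]
          · simp [NatExp.eval]
        · intro e he
          simp only [run_seq_fst, run_store, run_assign, NatExp.eval, MachineState.setArr_arr,
            MachineState.setVar_var, MachineState.setVar_arr, MachineState.setArr_var, hk1, h20,
            h8]
          by_cases hek : e = k
          · subst hek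
            simp [hkey]
          · have h4 := h2 e (by omega)
            -- An earlier item with the same pair would have left a nonzero entry in the table.
            have h5 : ¬ (s.arr 11 e 0 = s.arr 11 k 0 ∧ s.arr 8 c e = s.arr 8 c k) := by
              rintro ⟨h5, h6⟩
              rw [h5, h6, h0] at h4
              exact h4.2 h4.1
            simp [hek, h4.1]
            rw [← h4.1]
            exact ⟨fun a b => absurd ⟨a.trans hkey, b⟩ h5, h4.2⟩
        · intro e he
          have : e ≠ k := by omega
          simp [NatExp.eval, hk1, this, h3 e (by omega)]
      · rw [run_ite_pos _ _ _ _ _ _ (by simp [NatExp.eval, hk1, h20, h8, hkey, h0])]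
        refine ⟨⟨?_, ?_, ?_⟩, by simp [NatExp.cost]⟩
        · convert h1 using 1
          · funext n' s'
            simp
          · simp
        · intro e he
          simp only [run_skip, run_store, NatExp.eval, MachineState.setArr_arr, hk1, h20, h8, hkey]
          by_cases hek : e = k
          · subst hek
            simp [h0]
          · have h4 := h2 e (by omega)
            simp [hek, h4.1]
            rw [← h4.1]
            exact h4.2
        · intro e he
          have : e ≠ k := by omega
          simp [NatExp.eval, hk1, this, h3 e (by omega)])
  refine ⟨a1, ?_, ?_⟩
  · intro e he e' he'
    constructor
    · intro h
      rw [(a2 e he).1, (a2 e' he').1] at h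
      exact a1.inj _ _ _ _ (by rw [← (a2 e he).1]; exact (a2 e he).2) h
    · rintro ⟨h1, h2⟩
      rw [(a2 e he).1, (a2 e' he').1, h1, h2]
  · simp only [NatExp.cost] at a4
    omega

/-- All items start with key `0`, that is, they agree on the empty set of columns; each current
column then refines the partition. -/
theorem computeKeys_spec (s : MachineState R) (N i : ℕ) (hN : s.var 3 = N) (hd : s.var 1 = d)
    (hi : s.var 25 = i) (hT : TrieInv (s.arr 12) (s.var 24)) :
    TrieInv ((computeKeys.run S K s).1.arr 12) ((computeKeys.run S K s).1.var 24) ∧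
      (∀ e < N, ∀ e' < N, (computeKeys.run S K s).1.arr 11 e 0 = (computeKeys.run S K s).1.arr 11 e' 0 ↔
        ∀ c < d, s.arr 9 i c ≠ 0 → s.arr 8 c e = s.arr 8 c e') ∧
      (computeKeys.run S K s).2 ≤ 4 + N * 5 + d * (7 + N * 41) := by
  unfold computeKeys
  simp only [run_seq_fst, run_seq_snd]
  obtain ⟨a1, a2⟩ := loop_rule_const S K 21 (.var 3) (.store 11 (.var 21) (.const 0) (.const 0)) s N
    hN (fun k s => ∀ e < k, s.arr 11 e 0 = 0) 4 (fun k s v h => h) (by simp) (by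
      intro k hk s1 hF hk1 hI
      refine ⟨fun e he => ?_, by simp [NatExp.cost]⟩
      by_cases hek : e = k
      · simp [NatExp.eval, hk1, hek]
      · simp [NatExp.eval, hk1, hek, hI e (by omega)])
  have hF1 := frame_run S K (.loop 21 (.var 3) (.store 11 (.var 21) (.const 0) (.const 0))) s
  set s1 := ((Prog.loop 21 (.var 3) (.store 11 (.var 21) (.const 0) (.const 0))).run S K s).1
  obtain ⟨⟨b1, b2⟩, b3⟩ := loop_rule_const S K 20 (.var 1)
    (.ite (.get 9 (.var 25) (.var 20)) (.loop 21 (.var 3) keyStep) .skip) s1 d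
    (by simp only [NatExp.eval]; rw [hF1.var 1 rfl, hd])
    (fun k s' => TrieInv (s'.arr 12) (s'.var 24) ∧ ∀ e < N, ∀ e' < N,
      s'.arr 11 e 0 = s'.arr 11 e' 0 ↔ ∀ c < k, s.arr 9 i c ≠ 0 → s.arr 8 c e = s.arr 8 c e')
    (6 + N * 41) (fun k s v h => by simpa using h)
    ⟨by rw [hF1.arr 12 rfl, hF1.var 24 rfl]; exact hT, fun e he e' he' => by simp [a1 e he, a1 e' he']⟩
    (by
      intro k hk s2 hF hk2 hI
      obtain ⟨h1, h2⟩ := hI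
      have h25 : s2.var 25 = i := by rw [hF.var 25 rfl, hF1.var 25 rfl, hi]
      have h9 : s2.arr 9 = s.arr 9 := by rw [hF.arr 9 rfl, hF1.arr 9 rfl]
      have h8 : s2.arr 8 = s.arr 8 := by rw [hF.arr 8 rfl, hF1.arr 8 rfl]
      by_cases h0 : s.arr 9 i k = 0
      · rw [run_ite_neg _ _ _ _ _ _ (by simp [NatExp.eval, h25, hk2, h9, h0])]
        refine ⟨⟨h1, fun e he e' he' => ?_⟩, by simp [NatExp.cost]; omega⟩
        rw [run_skip, h2 e he e' he']
        refine ⟨fun h c hc hcur => ?_, fun h c hc => h c (by omega)⟩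
        refine h c (lt_of_le_of_ne (by omega) ?_) hcur
        rintro rfl
        exact hcur h0
      · rw [run_ite_pos _ _ _ _ _ _ (by simp [NatExp.eval, h25, hk2, h9, h0])]
        obtain ⟨c1, c2, c3⟩ := keyLoop_spec S K s2 N k
          (by rw [hF.var 3 rfl, hF1.var 3 rfl, hN]) hk2 h1
        refine ⟨⟨c1, fun e he e' he' => ?_⟩, by simp only [NatExp.cost]; omega⟩
        rw [c2 e he e' he', h2 e he e' he', h8]
        constructor
        · rintro ⟨h3, h4⟩ c hc hcur
          by_cases hck : c = k
          · rw [hck]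
            exact h4
          · exact h3 c (by omega) hcur
        · exact fun h => ⟨fun c hc => h c (by omega), h k (by omega) h0⟩)
  refine ⟨b1, b2, ?_⟩
  have : 6 + N * 41 + 1 = 7 + N * 41 := by omega
  rw [this] at b3
  simp only [NatExp.cost] at a2 b3
  omega

/-- The machine cannot see whether a cell is empty, so arrays `10` and `13` mirror which values and
which sums are present. The first present item with a key is copied and later ones are added; absent
items are formal zeros and are skipped. -/
theorem accumulate_spec (s : MachineState R) (N i st : ℕ) (hN : s.var 3 = N) (hi : s.var 25 = i)
    (hst : s.var 23 = st) (hflag : ∀ κ, s.arr 13 st κ = 0) (hacc : ∀ κ, s.sk 3 st κ = none)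
    (hpres : ∀ e < N, s.arr 10 e 0 ≠ 0 ↔ s.sk 1 e 0 ≠ none) :
    (∀ κ, S.val ((accumulate.run S K s).1.sk 3 st κ) =
        ∑ e ∈ Finset.range N with s.arr 4 e 0 = i ∧ s.arr 11 e 0 = κ, S.val (s.sk 1 e 0)) ∧
      (∀ κ, (accumulate.run S K s).1.arr 13 st κ ≠ 0 ↔ (accumulate.run S K s).1.sk 3 st κ ≠ none) ∧
      (∀ st' ≠ st, ∀ κ, (accumulate.run S K s).1.arr 13 st' κ = s.arr 13 st' κ ∧
        (accumulate.run S K s).1.sk 3 st' κ = s.sk 3 st' κ) ∧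
      (accumulate.run S K s).2 ≤ 2 + N * (41 + K.add) := by
  unfold accumulate
  obtain ⟨⟨a1, a2, a3⟩, a4⟩ := loop_rule_const S K 21 (.var 3)
    (.ite (.eq (.get 4 (.var 21) (.const 0)) (.var 25))
      (.ite (.get 10 (.var 21) (.const 0))
        (.seq (.ite (.get 13 (.var 23) (.get 11 (.var 21) (.const 0)))
            (.sketchAdd ⟨3, .var 23, .get 11 (.var 21) (.const 0)⟩
              ⟨3, .var 23, .get 11 (.var 21) (.const 0)⟩ ⟨1, .var 21, .const 0⟩)
            (.copy ⟨3, .var 23, .get 11 (.var 21) (.const 0)⟩ ⟨1, .var 21, .const 0⟩))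
          (.store 13 (.var 23) (.get 11 (.var 21) (.const 0)) (.const 1)))
        .skip) .skip) s N hN
    (fun k s' => (∀ κ, S.val (s'.sk 3 st κ) =
        ∑ e ∈ Finset.range k with s.arr 4 e 0 = i ∧ s.arr 11 e 0 = κ, S.val (s.sk 1 e 0)) ∧
      (∀ κ, s'.arr 13 st κ ≠ 0 ↔ s'.sk 3 st κ ≠ none) ∧
      ∀ st' ≠ st, ∀ κ, s'.arr 13 st' κ = s.arr 13 st' κ ∧ s'.sk 3 st' κ = s.sk 3 st' κ)
    (40 + K.add) (fun k s v h => h)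
    ⟨fun κ => by rw [hacc]; simp [DBSketch.val_none], fun κ => by simp [hflag, hacc],
      fun _ _ _ => ⟨rfl, rfl⟩⟩
    (by
      intro k hk s1 hF hk1 hI
      obtain ⟨h1, h2, h3⟩ := hI
      have e4 := hF.arr 4 rfl
      have e10 := hF.arr 10 rfl
      have e11 := hF.arr 11 rfl
      have e1 := hF.sk 1 rfl
      have e25 : s1.var 25 = i := by rw [hF.var 25 rfl, hi]
      have e23 : s1.var 23 = st := by rw [hF.var 23 rfl, hst]
      -- the sums for the next item
      have hsum : ∀ κ, ∑ e ∈ Finset.range (k + 1) with s.arr 4 e 0 = i ∧ s.arr 11 e 0 = κ,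
          S.val (s.sk 1 e 0) = S.val (s1.sk 3 st κ) +
            if s.arr 4 k 0 = i ∧ s.arr 11 k 0 = κ then S.val (s.sk 1 k 0) else 0 := by
        intro κ
        rw [h1, Finset.sum_filter, Finset.sum_filter, Finset.sum_range_succ]
      by_cases hik : s.arr 4 k 0 = i
      · rw [run_ite_pos _ _ _ _ _ _ (by simp [NatExp.eval, hk1, e4, e25, hik])]
        by_cases hp : s.arr 10 k 0 = 0
        · rw [run_ite_neg _ _ _ _ _ _ (by simp [NatExp.eval, hk1, e10, hp])]
          refine ⟨⟨fun κ => ?_, h2, h3⟩, by simp [NatExp.cost]; omega⟩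
          have hnone : s.sk 1 k 0 = none := by
            by_contra hne
            exact (hpres k hk).2 hne hp
          rw [hsum, hnone, DBSketch.val_none, ite_self, add_zero, run_skip]
        · rw [run_ite_pos _ _ _ _ _ _ (by simp [NatExp.eval, hk1, e10, hp])]
          have hsome := (hpres k hk).1 hp
          simp only [run_seq_fst, run_seq_snd]
          by_cases hf : s1.arr 13 st (s.arr 11 k 0) = 0
          · rw [run_ite_neg _ _ _ _ _ _ (by simp [NatExp.eval, hk1, e23, e11, hf])]
            have hz : s1.sk 3 st (s.arr 11 k 0) = none := by
              by_contra hne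
              exact (h2 _).2 hne hf
            refine ⟨⟨fun κ => ?_, fun κ => ?_, fun st' hst' κ => ?_⟩, ?_⟩
            · rw [hsum]
              by_cases hκ : s.arr 11 k 0 = κ
              · subst hκ
                simp [NatExp.eval, SketchCell.value, hk1, e23, e11, e1, hik, hz,
                  DBSketch.val_none]
              · simp [NatExp.eval, SketchCell.value, hk1, e23, e11, e1, hκ, Ne.symm hκ]
            · by_cases hκ : κ = s.arr 11 k 0
              · simp [NatExp.eval, SketchCell.value, hk1, e23, e11, e1, hκ, hsome]
              · simpa [NatExp.eval, SketchCell.value, hk1, e23, e11, e1, hκ] using h2 κ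
            · simpa [NatExp.eval, SketchCell.value, hk1, e23, e11, e1, hst'] using h3 st' hst' κ
            · simp [NatExp.cost, SketchCell.cost]
              omega
          · rw [run_ite_pos _ _ _ _ _ _ (by simp [NatExp.eval, hk1, e23, e11, hf])]
            have hz := (h2 _).1 hf
            refine ⟨⟨fun κ => ?_, fun κ => ?_, fun st' hst' κ => ?_⟩, ?_⟩
            · rw [hsum]
              by_cases hκ : s.arr 11 k 0 = κ
              · subst hκ
                simp [NatExp.eval, SketchCell.value, hk1, e23, e11, e1, hik,
                  S.val_map_add hz hsome]
              · simp [NatExp.eval, SketchCell.value, hk1, e23, e11, e1, hκ, Ne.symm hκ]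
            · by_cases hκ : κ = s.arr 11 k 0
              · simp [NatExp.eval, SketchCell.value, hk1, e23, e11, e1, hκ, hsome, hz,
                  Option.map₂_eq_none_iff]
              · simpa [NatExp.eval, SketchCell.value, hk1, e23, e11, e1, hκ] using h2 κ
            · simpa [NatExp.eval, SketchCell.value, hk1, e23, e11, e1, hst'] using h3 st' hst' κ
            · simp [NatExp.cost, SketchCell.cost]
              omega
      · rw [run_ite_neg _ _ _ _ _ _ (by simp [NatExp.eval, hk1, e4, e25, hik])]
        refine ⟨⟨fun κ => ?_, h2, h3⟩, by simp [NatExp.cost]; omega⟩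
        rw [hsum, if_neg (fun h => hik h.1), add_zero, run_skip])
  refine ⟨a1, a2, a3, ?_⟩
  have : 40 + K.add + 1 = 41 + K.add := by omega
  rw [this] at a4
  simp only [NatExp.cost] at a4
  omega

/-- An item without partner of its key meets an empty sum. The product is then the formal zero, and
its presence bit has to be cleared. -/
theorem multiply_spec (s : MachineState R) (N j st : ℕ) (b : Bool) (hN : s.var 3 = N)
    (hj : s.var 26 = j) (hb : s.var 27 = if b then 1 else 0) (hst : s.var 23 = st)
    (hflag : ∀ κ, s.arr 13 st κ ≠ 0 ↔ s.sk 3 st κ ≠ none)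
    (hpres : ∀ e < N, s.arr 10 e 0 ≠ 0 ↔ s.sk 1 e 0 ≠ none) :
    (∀ e < N, S.val ((multiply.run S K s).1.sk 1 e 0) =
        if s.arr 4 e 0 = j then
          mulDir b (S.val (s.sk 3 st (s.arr 11 e 0))) (S.val (s.sk 1 e 0))
        else S.val (s.sk 1 e 0)) ∧
      (∀ e < N, (multiply.run S K s).1.arr 10 e 0 ≠ 0 ↔ (multiply.run S K s).1.sk 1 e 0 ≠ none) ∧
      (multiply.run S K s).2 ≤ 2 + N * (41 + K.mul) := by
  unfold multiply
  obtain ⟨⟨a1, a2, a3, a4⟩, a5⟩ := loop_rule_const S K 21 (.var 3)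
    (.ite (.eq (.get 4 (.var 21) (.const 0)) (.var 26))
      (.seq (.ite (.var 27)
          (.sketchMul ⟨1, .var 21, .const 0⟩ ⟨3, .var 23, .get 11 (.var 21) (.const 0)⟩
            ⟨1, .var 21, .const 0⟩)
          (.sketchMul ⟨1, .var 21, .const 0⟩ ⟨1, .var 21, .const 0⟩
            ⟨3, .var 23, .get 11 (.var 21) (.const 0)⟩))
        (.ite (.get 13 (.var 23) (.get 11 (.var 21) (.const 0))) .skip
          (.store 10 (.var 21) (.const 0) (.const 0))))
      .skip) s N hN
    (fun k s' => (∀ e < k, S.val (s'.sk 1 e 0) =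
        if s.arr 4 e 0 = j then
          mulDir b (S.val (s.sk 3 st (s.arr 11 e 0))) (S.val (s.sk 1 e 0))
        else S.val (s.sk 1 e 0)) ∧
      (∀ e < k, s'.arr 10 e 0 ≠ 0 ↔ s'.sk 1 e 0 ≠ none) ∧
      (∀ e, k ≤ e → s'.sk 1 e 0 = s.sk 1 e 0) ∧ ∀ e, k ≤ e → s'.arr 10 e 0 = s.arr 10 e 0)
    (40 + K.mul) (fun k s v h => h) (by simp) (by
      intro k hk s1 hF hk1 hI
      obtain ⟨h1, h2, h3, h4⟩ := hI
      have e4 := hF.arr 4 rfl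
      have e13 := hF.arr 13 rfl
      have e11 := hF.arr 11 rfl
      have e3 := hF.sk 3 rfl
      have e26 : s1.var 26 = j := by rw [hF.var 26 rfl, hj]
      have e27 : s1.var 27 = if b then 1 else 0 := by rw [hF.var 27 rfl, hb]
      have e23 : s1.var 23 = st := by rw [hF.var 23 rfl, hst]
      have hv := h3 k le_rfl
      have hp := h4 k le_rfl
      -- the step changes only item `k`, and it suffices to look at this item
      suffices hstep : ∀ s' : MachineState R,
          (∀ e, e ≠ k → s'.sk 1 e 0 = s1.sk 1 e 0 ∧ s'.arr 10 e 0 = s1.arr 10 e 0) →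
          S.val (s'.sk 1 k 0) = (if s.arr 4 k 0 = j then
            mulDir b (S.val (s.sk 3 st (s.arr 11 k 0))) (S.val (s.sk 1 k 0))
            else S.val (s.sk 1 k 0)) →
          (s'.arr 10 k 0 ≠ 0 ↔ s'.sk 1 k 0 ≠ none) →
          (∀ e < k + 1, S.val (s'.sk 1 e 0) = if s.arr 4 e 0 = j then
            mulDir b (S.val (s.sk 3 st (s.arr 11 e 0))) (S.val (s.sk 1 e 0))
            else S.val (s.sk 1 e 0)) ∧
          (∀ e < k + 1, s'.arr 10 e 0 ≠ 0 ↔ s'.sk 1 e 0 ≠ none) ∧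
          (∀ e, k + 1 ≤ e → s'.sk 1 e 0 = s.sk 1 e 0) ∧
          ∀ e, k + 1 ≤ e → s'.arr 10 e 0 = s.arr 10 e 0 by
        by_cases hjk : s.arr 4 k 0 = j
        · rw [run_ite_pos _ _ _ _ _ _ (by simp [NatExp.eval, hk1, e4, e26, hjk])]
          simp only [run_seq_fst, run_seq_snd]
          -- the state after the multiplication
          obtain ⟨s2, t2, hs2, hsk, harr, hvar, hval, ht2⟩ : ∃ s2 t2,
              (Prog.ite (.var 27)
                (.sketchMul ⟨1, .var 21, .const 0⟩ ⟨3, .var 23, .get 11 (.var 21) (.const 0)⟩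
                  ⟨1, .var 21, .const 0⟩)
                (.sketchMul ⟨1, .var 21, .const 0⟩ ⟨1, .var 21, .const 0⟩
                  ⟨3, .var 23, .get 11 (.var 21) (.const 0)⟩)).run S K s1 = (s2, t2) ∧
              (∀ e, e ≠ k → s2.sk 1 e 0 = s1.sk 1 e 0) ∧ s2.arr = s1.arr ∧ s2.var = s1.var ∧
              S.val (s2.sk 1 k 0) =
                mulDir b (S.val (s.sk 3 st (s.arr 11 k 0))) (S.val (s.sk 1 k 0)) ∧
              t2 ≤ 15 + K.mul := by
            cases b
            · refine ⟨_, _, run_ite_neg _ _ _ _ _ _ (by simpa [NatExp.eval] using e27), ?_, rfl,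
                rfl, ?_, ?_⟩
              · intro e he
                simp [NatExp.eval, hk1, he]
              · simp [NatExp.eval, SketchCell.value, hk1, e23, e11, e3, hv, mulDir,
                  DBSketch.val_map_mul]
              · simp [NatExp.cost, SketchCell.cost]
                omega
            · refine ⟨_, _, run_ite_pos _ _ _ _ _ _ (by simp [NatExp.eval, e27]), ?_, rfl,
                rfl, ?_, ?_⟩
              · intro e he
                simp [NatExp.eval, hk1, he]
              · simp [NatExp.eval, SketchCell.value, hk1, e23, e11, e3, hv, mulDir,
                  DBSketch.val_map_mul]
              · simp [NatExp.cost, SketchCell.cost]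
                omega
          rw [hs2]
          -- A product is present exactly if both factors are; this decides the new presence bit.
          have hval' : s2.sk 1 k 0 ≠ none ↔ s.sk 3 st (s.arr 11 k 0) ≠ none ∧ s.sk 1 k 0 ≠ none := by
            have hiff : s2.sk 1 k 0 = none ↔ s.sk 3 st (s.arr 11 k 0) = none ∨ s.sk 1 k 0 = none := by
              cases b
              · have h5 : s2.sk 1 k 0 = Option.map₂ S.mul (s.sk 1 k 0) (s.sk 3 st (s.arr 11 k 0)) :=
                  hval
                rw [h5, Option.map₂_eq_none_iff, or_comm]
              · have h5 : s2.sk 1 k 0 = Option.map₂ S.mul (s.sk 3 st (s.arr 11 k 0)) (s.sk 1 k 0) :=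
                  hval
                rw [h5, Option.map₂_eq_none_iff]
            rw [Ne, hiff, not_or]
          by_cases hf : s.arr 13 st (s.arr 11 k 0) = 0
          · rw [run_ite_neg _ _ _ _ _ _ (by simp [NatExp.eval, hvar, harr, hk1, e23, e11, e13, hf])]
            refine ⟨hstep _ ?_ ?_ ?_, ?_⟩
            · intro e he
              simp [NatExp.eval, hvar, harr, hk1, he, hsk e he]
            · rw [if_pos hjk]
              simpa using hval
            · have hn : s.sk 3 st (s.arr 11 k 0) = none := by
                by_contra hne
                exact (hflag _).2 hne hf
              simp only [run_store, MachineState.setArr_sk, hval']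
              simp [NatExp.eval, hvar, hk1, hn]
            · simp [NatExp.cost]
              omega
          · rw [run_ite_pos _ _ _ _ _ _ (by simp [NatExp.eval, hvar, harr, hk1, e23, e11, e13, hf])]
            refine ⟨hstep _ ?_ ?_ ?_, ?_⟩
            · intro e he
              simp [harr, hsk e he]
            · rw [if_pos hjk]
              simpa using hval
            · rw [run_skip, hval', harr, hp, hpres k hk]
              exact ⟨fun h => ⟨(hflag _).1 hf, h⟩, fun h => h.2⟩
            · simp [NatExp.cost]
              omega
        · rw [run_ite_neg _ _ _ _ _ _ (by simp [NatExp.eval, hk1, e4, e26, hjk])]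
          refine ⟨hstep _ (fun _ _ => ⟨rfl, rfl⟩) ?_ ?_, by simp [NatExp.cost]; omega⟩
          · rw [if_neg hjk, run_skip, hv]
          · rw [run_skip, hv, hp]
            exact hpres k hk
      intro s' g1 g2 g3
      refine ⟨fun e he => ?_, fun e he => ?_, fun e he => ?_, fun e he => ?_⟩
      · by_cases hek : e = k
        · rw [hek]
          exact g2
        · rw [(g1 e hek).1]
          exact h1 e (by omega)
      · by_cases hek : e = k
        · rw [hek]
          exact g3
        · rw [(g1 e hek).1, (g1 e hek).2]
          exact h2 e (by omega)
      · rw [(g1 e (by omega)).1]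
        exact h3 e (by omega)
      · rw [(g1 e (by omega)).2]
        exact h4 e (by omega))
  refine ⟨a1, a2, ?_⟩
  have : 40 + K.mul + 1 = 41 + K.mul := by omega
  rw [this] at a5
  simp only [NatExp.cost] at a5
  omega

/-- The keys are in order, and the stamps after the current one have not been used. -/
structure StampInv (s : MachineState R) : Prop where
  trie : TrieInv (s.arr 12) (s.var 24)
  flag : ∀ st, s.var 23 < st → ∀ κ, s.arr 13 st κ = 0
  acc : ∀ st, s.var 23 < st → ∀ κ, s.sk 3 st κ = none

/-- A fresh stamp in register `23` selects a row of accumulators that is still empty, which avoids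
clearing the sums of earlier absorptions. The products of the sketches of zero matrices are carried
along separately in sketch array `2`. -/
theorem absorb_spec (s : MachineState R) (N i j : ℕ) (b : Bool) (hN : s.var 3 = N)
    (hd : s.var 1 = d) (hi : s.var 25 = i) (hj : s.var 26 = j)
    (hb : s.var 27 = if b then 1 else 0) (hs : StampInv s)
    (hpres : ∀ e < N, s.arr 10 e 0 ≠ 0 ↔ s.sk 1 e 0 ≠ none) :
    StampInv (absorb.run S K s).1 ∧
      (∃ key : ℕ → ℕ, (∀ e < N, ∀ e' < N, key e = key e' ↔
          ∀ c < d, s.arr 9 i c ≠ 0 → s.arr 8 c e = s.arr 8 c e') ∧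
        ∀ e < N, S.val ((absorb.run S K s).1.sk 1 e 0) =
          if s.arr 4 e 0 = j then
            mulDir b (∑ e' ∈ Finset.range N with s.arr 4 e' 0 = i ∧ key e' = key e,
              S.val (s.sk 1 e' 0)) (S.val (s.sk 1 e 0))
          else S.val (s.sk 1 e 0)) ∧
      (∀ e < N, (absorb.run S K s).1.arr 10 e 0 ≠ 0 ↔ (absorb.run S K s).1.sk 1 e 0 ≠ none) ∧
      (∀ l, S.val ((absorb.run S K s).1.sk 2 l 0) =
        if l = j then mulDir b (S.val (s.sk 2 i 0)) (S.val (s.sk 2 j 0)) else S.val (s.sk 2 l 0)) ∧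
      (absorb.run S K s).1.var 28 = j ∧
      (absorb.run S K s).2 ≤ 40 + N * 100 + d * (7 + N * 41) + N * (K.add + K.mul) + K.mul := by
  unfold absorb
  simp only [run_seq_fst, run_seq_snd]
  set s1 := ((Prog.assign 23 (.add (.var 23) (.const 1))).run S K s).1 with hs1
  have hF1 : Frame (.assign 23 (.add (.var 23) (.const 1))) s s1 := frame_run S K _ s
  have hst : s1.var 23 = s.var 23 + 1 := by simp [hs1, NatExp.eval]
  obtain ⟨a1, a2, a3⟩ := computeKeys_spec S K s1 N i (by rw [hF1.var 3 rfl, hN])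
    (by rw [hF1.var 1 rfl, hd]) (by rw [hF1.var 25 rfl, hi])
    (by rw [hF1.arr 12 rfl, hF1.var 24 rfl]; exact hs.trie)
  have hF2 := frame_run S K computeKeys s1
  set s2 := (computeKeys.run S K s1).1
  have g4 : s2.arr 4 = s.arr 4 := by rw [hF2.arr 4 rfl, hF1.arr 4 rfl]
  have g10 : s2.arr 10 = s.arr 10 := by rw [hF2.arr 10 rfl, hF1.arr 10 rfl]
  have g13 : s2.arr 13 = s.arr 13 := by rw [hF2.arr 13 rfl, hF1.arr 13 rfl]
  have gs1 : s2.sk 1 = s.sk 1 := by rw [hF2.sk 1 rfl, hF1.sk 1 rfl]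
  have gs3 : s2.sk 3 = s.sk 3 := by rw [hF2.sk 3 rfl, hF1.sk 3 rfl]
  have g23 : s2.var 23 = s.var 23 + 1 := by rw [hF2.var 23 rfl, hst]
  have g3 : s2.var 3 = N := by rw [hF2.var 3 rfl, hF1.var 3 rfl, hN]
  have g25 : s2.var 25 = i := by rw [hF2.var 25 rfl, hF1.var 25 rfl, hi]
  obtain ⟨b1, b2, b3, b4⟩ := accumulate_spec S K s2 N i (s.var 23 + 1) g3 g25 g23
    (by rw [g13]; exact hs.flag _ (Nat.lt_succ_self _))
    (by rw [gs3]; exact hs.acc _ (Nat.lt_succ_self _)) (by rw [g10, gs1]; exact hpres)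
  have hF3 := frame_run S K accumulate s2
  set s3 := (accumulate.run S K s2).1
  obtain ⟨c1, c2, c3⟩ := multiply_spec S K s3 N j (s.var 23 + 1) b (by rw [hF3.var 3 rfl, g3])
    (by rw [hF3.var 26 rfl, hF2.var 26 rfl, hF1.var 26 rfl, hj])
    (by rw [hF3.var 27 rfl, hF2.var 27 rfl, hF1.var 27 rfl, hb]) (by rw [hF3.var 23 rfl, g23]) b2
    (by rw [hF3.arr 10 rfl, hF3.sk 1 rfl, g10, gs1]; exact hpres)
  have hF4 := frame_run S K multiply s3
  set s4 := (multiply.run S K s3).1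
  have k27 : s4.var 27 = if b then 1 else 0 := by
    rw [hF4.var 27 rfl, hF3.var 27 rfl, hF2.var 27 rfl, hF1.var 27 rfl, hb]
  have k25 : s4.var 25 = i := by rw [hF4.var 25 rfl, hF3.var 25 rfl, g25]
  have k26 : s4.var 26 = j := by
    rw [hF4.var 26 rfl, hF3.var 26 rfl, hF2.var 26 rfl, hF1.var 26 rfl, hj]
  have k2 : s4.sk 2 = s.sk 2 := by
    rw [hF4.sk 2 rfl, hF3.sk 2 rfl, hF2.sk 2 rfl, hF1.sk 2 rfl]
  -- the product of the zero values
  obtain ⟨s5, t5, hs5, hF5, hz5, ht5⟩ : ∃ s5 t5, (Prog.ite (.var 27)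
      (.sketchMul ⟨2, .var 26, .const 0⟩ ⟨2, .var 25, .const 0⟩ ⟨2, .var 26, .const 0⟩)
      (.sketchMul ⟨2, .var 26, .const 0⟩ ⟨2, .var 26, .const 0⟩ ⟨2, .var 25, .const 0⟩)).run S K s4 =
        (s5, t5) ∧ (s5.var = s4.var ∧ s5.arr = s4.arr ∧ s5.sk 1 = s4.sk 1 ∧ s5.sk 3 = s4.sk 3) ∧
      (∀ l, S.val (s5.sk 2 l 0) =
        if l = j then mulDir b (S.val (s.sk 2 i 0)) (S.val (s.sk 2 j 0)) else S.val (s.sk 2 l 0)) ∧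
      t5 ≤ 10 + K.mul := by
    cases b
    · refine ⟨_, _, run_ite_neg _ _ _ _ _ _ (by simpa [NatExp.eval] using k27),
        ⟨rfl, rfl, ?_, ?_⟩, ?_, ?_⟩
      · funext x y
        simp
      · funext x y
        simp
      · intro l
        by_cases hl : l = j
        · simp [NatExp.eval, SketchCell.value, k25, k26, k2, hl, mulDir, DBSketch.val_map_mul]
        · simp [NatExp.eval, SketchCell.value, k26, k2, hl]
      · simp [NatExp.cost, SketchCell.cost]
        omega
    · refine ⟨_, _, run_ite_pos _ _ _ _ _ _ (by simp [NatExp.eval, k27]),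
        ⟨rfl, rfl, ?_, ?_⟩, ?_, ?_⟩
      · funext x y
        simp
      · funext x y
        simp
      · intro l
        by_cases hl : l = j
        · simp [NatExp.eval, SketchCell.value, k25, k26, k2, hl, mulDir, DBSketch.val_map_mul]
        · simp [NatExp.eval, SketchCell.value, k26, k2, hl]
      · simp [NatExp.cost, SketchCell.cost]
        omega
  rw [hs5]
  obtain ⟨v5, r5, w5, x5⟩ := hF5
  simp only [run_assign, MachineState.setVar_sk, MachineState.setVar_arr, MachineState.setVar_var,
    NatExp.eval, NatExp.cost]
  refine ⟨⟨?_, ?_, ?_⟩, ⟨fun e => s2.arr 11 e 0, ?_, ?_⟩, ?_, hz5, ?_, ?_⟩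
  · simp only [MachineState.setVar_arr, MachineState.setVar_var]
    simp only [Nat.reduceEqDiff, if_false]
    rw [r5, v5, hF4.arr 12 rfl, hF4.var 24 rfl, hF3.arr 12 rfl, hF3.var 24 rfl]
    exact a1
  · intro st' hlt κ
    simp only [MachineState.setVar_var] at hlt
    simp only [Nat.reduceEqDiff, if_false] at hlt
    rw [v5, hF4.var 23 rfl, hF3.var 23 rfl, g23] at hlt
    simp only [MachineState.setVar_arr]
    rw [r5, hF4.arr 13 rfl, (b3 st' (by omega) κ).1, g13]
    exact hs.flag st' (by omega) κ
  · intro st' hlt κ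
    simp only [MachineState.setVar_var] at hlt
    simp only [Nat.reduceEqDiff, if_false] at hlt
    rw [v5, hF4.var 23 rfl, hF3.var 23 rfl, g23] at hlt
    simp only [MachineState.setVar_sk]
    rw [x5, hF4.sk 3 rfl, (b3 st' (by omega) κ).2, gs3]
    exact hs.acc st' (by omega) κ
  · rw [hF1.arr 9 rfl, hF1.arr 8 rfl] at a2
    exact a2
  · intro e he
    rw [w5, c1 e he, hF3.arr 4 rfl, hF3.arr 11 rfl, hF3.sk 1 rfl, b1, g4, gs1]
  · intro e he
    rw [r5, w5]
    exact c2 e he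
  · rw [v5, k26]
    simp
  · simp only [hs1, run_assign, NatExp.cost] at a3 ⊢
    have h1 : N * (41 + K.add) = N * 41 + N * K.add := by ring
    have h2 : N * (41 + K.mul) = N * 41 + N * K.mul := by ring
    have h3 : N * (K.add + K.mul) = N * K.add + N * K.mul := by ring
    omega

end Prog

/-! ### One run of Inside-Out for every column -/

namespace Prog

/-- Set up the factors for the column in register `18`. -/
def initCols : Prog :=
  .loop 19 (.var 0) (.loop 20 (.var 1) (.store 9 (.var 19) (.var 20) (.get 1 (.var 19) (.var 20))))

/-- The buffer holds a single entry, so each sketch is charged at most one unit of `T_f`. -/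
def initValues : Prog :=
  .loop 21 (.var 3) (.seq .clear (.seq
    (.ite (.eq (.get 4 (.var 21) (.const 0)) (.get 2 (.var 18) (.const 0)))
      (.seq (.read 0 (.get 4 (.var 21) (.const 0)) (.get 5 (.var 21) (.const 0)) (.var 18))
      (.seq (.push (.get 5 (.var 21) (.const 0)) (.var 18) 0)
        (.sketch ⟨1, .var 21, .const 0⟩ (.get 4 (.var 21) (.const 0)) (.var 1))))
      (.seq (.one 0)
      (.seq (.push (.get 5 (.var 21) (.const 0)) (.const 0) 0)
        (.sketch ⟨1, .var 21, .const 0⟩ (.get 4 (.var 21) (.const 0)) (.const 1)))))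
    (.store 10 (.var 21) (.const 0) (.const 1))))

/-- The buffer is empty: the sketches of zero matrices are not charged to `T_f` at all. -/
def initZeros : Prog :=
  .loop 19 (.var 0) (.seq .clear
    (.ite (.eq (.var 19) (.get 2 (.var 18) (.const 0)))
      (.sketch ⟨2, .var 19, .const 0⟩ (.var 19) (.var 1))
      (.sketch ⟨2, .var 19, .const 0⟩ (.var 19) (.const 1))))

def initColumn : Prog :=
  .seq initCols (.seq initValues (.seq initZeros (.assign 28 (.const 0))))

/-- Perform the elimination step in register `22`. -/
def stepProg : Prog :=
  .ite (.eq (.get 3 (.var 22) (.const 0)) (.const 0))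
    (.store 9 (.get 3 (.var 22) (.const 1)) (.get 3 (.var 22) (.const 2)) (.const 0))
    (.seq (.assign 25 (.get 3 (.var 22) (.const 1))) (.seq (.assign 26 (.get 3 (.var 22) (.const 2)))
      (.seq (.assign 27 (.get 3 (.var 22) (.const 3))) absorb)))

/-- Add the content of a cell to the output; register `29` says whether there is an output. -/
def addOut (u : SketchCell) : Prog :=
  .ite (.var 29) (.sketchAdd ⟨0, .const 0, .const 0⟩ ⟨0, .const 0, .const 0⟩ u)
    (.seq (.copy ⟨0, .const 0, .const 0⟩ u) (.assign 29 (.const 1)))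

/-- Add the values of the last factor to the output. -/
def finishColumn : Prog :=
  .seq (addOut ⟨2, .var 28, .const 0⟩)
    (.loop 21 (.var 3) (.ite (.eq (.get 4 (.var 21) (.const 0)) (.var 28))
      (.ite (.get 10 (.var 21) (.const 0)) (addOut ⟨1, .var 21, .const 0⟩) .skip) .skip))

def columnProg : Prog := .seq initColumn (.seq (.loop 22 (.var 2) stepProg) finishColumn)

/-- The two states agree on the input and on the results of the preparation. -/
structure Same {R : Type*} (s₀ s : MachineState R) : Prop where
  var : ∀ x < 4, s.var x = s₀.var x
  arr : ∀ a < 9, s.arr a = s₀.arr a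

theorem Same.of_frame {R : Type*} {s₀ s s' : MachineState R} {p : Prog} (h : Same s₀ s)
    (hF : Frame p s s') (hv : ∀ x < 4, p.writesVar x = false) (ha : ∀ a < 9, p.writesArr a = false) :
    Same s₀ s' :=
  ⟨fun x hx => (hF.var x (hv x hx)).trans (h.var x hx),
    fun a hx => (hF.arr a (ha a hx)).trans (h.arr a hx)⟩

/-- What holds after the preparation. -/
structure Base {m d : ℕ} {R : Type*} (Q : JoinQuery m d) (plan : List (PlanStep m d)) (N : ℕ)
    (s : MachineState R) : Prop where
  var_zero : s.var 0 = m
  var_one : s.var 1 = d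
  var_two : s.var 2 = plan.length
  cols : s.arr 1 = (Q.initState plan R).arr 1
  owner : s.arr 2 = (Q.initState plan R).arr 2
  steps : s.arr 3 = (Q.initState plan R).arr 3
  prepared : Prepared Q (fun i => (Q.initState plan R).arr 0 i 0) N s

/-! ### Correctness and cost of one column. -/

section

variable {m d : ℕ} {Q : JoinQuery m d} {ρ : MulTree m} {R : Type*} (S : DBSketch Q ρ R)
  (K : SketchCosts)

/-- The items of a table. -/
def itemsOf (s₀ : MachineState R) (N : ℕ) (i : Fin m) : Finset ℕ :=
  {e ∈ Finset.range N | s₀.arr 4 e 0 = i}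

/-- The entry of an item in a column. -/
noncomputable def itemEntry (Q : JoinQuery m d) (s₀ : MachineState R) (e : ℕ) (c : Fin d) : ℝ :=
  Q.entry (s₀.arr 4 e 0) (s₀.arr 5 e 0) c

/-- The sketch of the Kronecker factor for an item. -/
noncomputable def itemVal (k : Fin d) (s₀ : MachineState R) (e : ℕ) : S.Val :=
  if h : s₀.arr 4 e 0 < m then
    S.val (some (S.part ⟨_, h⟩ (Q.colCount k ⟨_, h⟩) (Q.factor k ⟨_, h⟩ (s₀.arr 5 e 0))))
  else 0

/-- The state during the run of Inside-Out for column `k`. -/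
structure FaqInv (k : Fin d) (s₀ : MachineState R) (N : ℕ) (live : Finset (Fin m))
    (cols' : Fin m → Finset (Fin d)) (tree : Fin m → MulTree m) (s : MachineState R) : Prop where
  val : ∀ j ∈ live, ∀ e < N, s₀.arr 4 e 0 = j → S.val (s.sk 1 e 0) =
    tupleSum Q.cols (itemsOf s₀ N) (itemEntry Q s₀) (itemVal S k s₀) (tree j) j e
  pres : ∀ e < N, s.arr 10 e 0 ≠ 0 ↔ s.sk 1 e 0 ≠ none
  zero : ∀ j ∈ live, s.sk 2 j 0 =
    some ((tree j).eval S.mul fun i => S.part i (Q.colCount k i) 0)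
  cols : ∀ (i : Fin m) (c : Fin d), s.arr 9 i c ≠ 0 ↔ c ∈ cols' i
  fin : ∃ j ∈ live, s.var 28 = j

theorem initCols_spec {plan : List (PlanStep m d)} (s : MachineState R) (h0 : s.var 0 = m)
    (h1 : s.var 1 = d) (hc : s.arr 1 = (Q.initState plan R).arr 1) :
    (∀ (i : Fin m) (c : Fin d), (initCols.run S K s).1.arr 9 i c ≠ 0 ↔ c ∈ Q.cols i) ∧
      (initCols.run S K s).2 ≤ 2 + m * (3 + d * 7) := by
  have key : ∀ (i : Fin m) (c : Fin d), s.arr 1 i c ≠ 0 ↔ c ∈ Q.cols i := by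
    intro i c
    rw [hc]
    simp [JoinQuery.initState]
  unfold initCols
  obtain ⟨a1, a2⟩ := loop_rule_const S K 19 (.var 0)
    (.loop 20 (.var 1) (.store 9 (.var 19) (.var 20) (.get 1 (.var 19) (.var 20)))) s m h0
    (fun k s' => ∀ i < k, ∀ c < d, s'.arr 9 i c = s.arr 1 i c) (2 + d * 7) (fun k s v h => h)
    (by simp) (by
      intro i hi s1 hF hi1 hI
      obtain ⟨b1, b2⟩ := loop_rule_const S K 20 (.var 1)
        (.store 9 (.var 19) (.var 20) (.get 1 (.var 19) (.var 20))) s1 d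
        (by simp only [NatExp.eval]; rw [hF.var 1 rfl, h1])
        (fun k s' => (∀ i' < i, ∀ c < d, s'.arr 9 i' c = s.arr 1 i' c) ∧
          ∀ c < k, s'.arr 9 i c = s.arr 1 i c) 6 (fun k s v h => h) ⟨hI, by simp⟩ (by
          intro c hc s2 hF2 hc2 hI2
          have h19 : s2.var 19 = i := by rw [hF2.var 19 rfl, hi1]
          have h1 : s2.arr 1 = s.arr 1 := by rw [hF2.arr 1 rfl, hF.arr 1 rfl]
          refine ⟨⟨fun i' hi' c' hc' => ?_, fun c' hc' => ?_⟩, by simp [NatExp.cost]⟩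
          · simp [NatExp.eval, h19, hi'.ne, hI2.1 i' hi' c' hc']
          · by_cases hcc : c' = c
            · simp [NatExp.eval, h19, hc2, h1, hcc]
            · simp [NatExp.eval, h19, hc2, hcc, hI2.2 c' (by omega)])
      refine ⟨fun i' hi' c hc => ?_, by simpa [NatExp.cost] using b2⟩
      by_cases hii : i' = i
      · rw [hii]
        exact b1.2 c hc
      · exact b1.1 i' (by omega) c hc)
  refine ⟨fun i c => ?_, ?_⟩
  · rw [a1 i i.2 c c.2]
    exact key i c
  · have : 2 + d * 7 + 1 = 3 + d * 7 := by omega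
    rw [this] at a2
    simp only [NatExp.cost] at a2
    omega

theorem initValues_spec {plan : List (PlanStep m d)} (N : ℕ) (k : Fin d) (s₀ s : MachineState R)
    (hB : Base Q plan N s₀) (hs : Same s₀ s) (hk : s.var 18 = k) :
    (∀ e < N, S.val ((initValues.run S K s).1.sk 1 e 0) = itemVal S k s₀ e ∧
        (initValues.run S K s).1.arr 10 e 0 = 1) ∧
      (initValues.run S K s).2 ≤ 2 + N * (41 + K.sketch) := by
  unfold initValues
  obtain ⟨a1, a2⟩ := loop_rule_const S K 21 (.var 3) (.seq .clear (.seq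
    (.ite (.eq (.get 4 (.var 21) (.const 0)) (.get 2 (.var 18) (.const 0)))
      (.seq (.read 0 (.get 4 (.var 21) (.const 0)) (.get 5 (.var 21) (.const 0)) (.var 18))
      (.seq (.push (.get 5 (.var 21) (.const 0)) (.var 18) 0)
        (.sketch ⟨1, .var 21, .const 0⟩ (.get 4 (.var 21) (.const 0)) (.var 1))))
      (.seq (.one 0)
      (.seq (.push (.get 5 (.var 21) (.const 0)) (.const 0) 0)
        (.sketch ⟨1, .var 21, .const 0⟩ (.get 4 (.var 21) (.const 0)) (.const 1)))))
    (.store 10 (.var 21) (.const 0) (.const 1)))) s N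
    ((hs.var 3 (by norm_num)).trans hB.prepared.var_three)
    (fun n s' => ∀ e < n, S.val (s'.sk 1 e 0) = itemVal S k s₀ e ∧ s'.arr 10 e 0 = 1)
    (40 + K.sketch) (fun k s v h => h) (by simp) (by
      intro e he s1 hF he1 hI
      have e4 : s1.arr 4 = s₀.arr 4 := (hF.arr 4 rfl).trans (hs.arr 4 (by norm_num))
      have e5 : s1.arr 5 = s₀.arr 5 := (hF.arr 5 rfl).trans (hs.arr 5 (by norm_num))
      have e2 : s1.arr 2 = s₀.arr 2 := (hF.arr 2 rfl).trans (hs.arr 2 (by norm_num))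
      have e18 : s1.var 18 = k := (hF.var 18 rfl).trans hk
      have e1 : s1.var 1 = d := ((hF.var 1 rfl).trans (hs.var 1 (by norm_num))).trans hB.var_one
      have hlt : s₀.arr 4 e 0 < m := by
        have := (hB.prepared.items.range e he).1
        omega
      obtain ⟨a, ha⟩ : ∃ a : Fin m, s₀.arr 4 e 0 = a := ⟨⟨_, hlt⟩, rfl⟩
      have hval : itemVal S k s₀ e =
          S.val (some (S.part a (Q.colCount k a) (Q.factor k a (s₀.arr 5 e 0)))) := by
        have : a = ⟨_, hlt⟩ := Fin.ext ha.symm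
        subst this
        unfold itemVal
        rw [dif_pos hlt]
      have hown : s₀.arr 2 k 0 = Q.owner k := by
        rw [hB.owner]
        simp [JoinQuery.initState]
      have hnnz := Q.nnz_bufferMatrix_single_le a
      simp only [run_seq_fst, run_seq_snd]
      by_cases hao : a = Q.owner k
      · rw [run_ite_pos _ _ _ _ _ _
          (by simp [NatExp.eval, he1, e4, e2, e18, ha, hown, hao])]
        simp only [run_seq_fst, run_seq_snd]
        rw [run_sketch S K _ _ _ _ a d (by simp [NatExp.eval, he1, e4, ha])
          (by simp [NatExp.eval, e1])]
        have hd : Q.colCount k a = d := by rw [hao, Q.colCount_owner]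
        have hbuf : Q.factorBuffer k a (s₀.arr 5 e 0) =
            [(s₀.arr 5 e 0, (k : ℕ), Q.entry a (s₀.arr 5 e 0) k)] := if_pos hao
        rw [JoinQuery.factor, hbuf, hd] at hval
        refine ⟨fun e' he' => ?_, ?_⟩
        · by_cases hee : e' = e
          · subst hee
            simp [NatExp.eval, he1, e4, e5, e18, ha, hval]
          · simpa [NatExp.eval, he1, hee] using hI e' (by omega)
        · have := Nat.mul_le_mul_left K.sketch
            (hnnz d (s₀.arr 5 e 0, (k : ℕ), Q.entry a (s₀.arr 5 e 0) k))
          simp [NatExp.cost, SketchCell.cost, NatExp.eval, he1, e4, e5, e18, ha]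
          omega
      · have hao' : (a : ℕ) ≠ Q.owner k := fun h => hao (Fin.ext h)
        rw [run_ite_neg _ _ _ _ _ _
          (by simp [NatExp.eval, he1, e4, e2, e18, ha, hown, hao'])]
        simp only [run_seq_fst, run_seq_snd]
        rw [run_sketch S K _ _ _ _ a 1 (by simp [NatExp.eval, he1, e4, ha])
          (by simp [NatExp.eval])]
        have hd : Q.colCount k a = 1 := Q.colCount_of_ne hao
        have hbuf : Q.factorBuffer k a (s₀.arr 5 e 0) = [(s₀.arr 5 e 0, 0, 1)] := if_neg hao
        rw [JoinQuery.factor, hbuf, hd] at hval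
        refine ⟨fun e' he' => ?_, ?_⟩
        · by_cases hee : e' = e
          · subst hee
            simp [NatExp.eval, he1, e5, hval]
          · simpa [NatExp.eval, he1, hee] using hI e' (by omega)
        · have := Nat.mul_le_mul_left K.sketch (hnnz 1 (s₀.arr 5 e 0, 0, 1))
          simp [NatExp.cost, SketchCell.cost, NatExp.eval, he1, e5]
          omega)
  refine ⟨a1, ?_⟩
  have : 40 + K.sketch + 1 = 41 + K.sketch := by omega
  rw [this] at a2
  simp only [NatExp.cost] at a2
  omega

theorem initZeros_spec {plan : List (PlanStep m d)} (N : ℕ) (k : Fin d) (s₀ s : MachineState R)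
    (hB : Base Q plan N s₀) (hs : Same s₀ s) (hk : s.var 18 = k) :
    (∀ j : Fin m, (initZeros.run S K s).1.sk 2 j 0 = some (S.part j (Q.colCount k j) 0)) ∧
      (initZeros.run S K s).2 ≤ 2 + m * 21 := by
  unfold initZeros
  obtain ⟨a1, a2⟩ := loop_rule_const S K 19 (.var 0) (.seq .clear
    (.ite (.eq (.var 19) (.get 2 (.var 18) (.const 0)))
      (.sketch ⟨2, .var 19, .const 0⟩ (.var 19) (.var 1))
      (.sketch ⟨2, .var 19, .const 0⟩ (.var 19) (.const 1)))) s m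
    ((hs.var 0 (by norm_num)).trans hB.var_zero)
    (fun n s' => ∀ j : Fin m, (j : ℕ) < n →
      s'.sk 2 j 0 = some (S.part j (Q.colCount k j) 0)) 20 (fun k s v h => h) (by simp) (by
      intro i hi s1 hF hi1 hI
      have e2 : s1.arr 2 = s₀.arr 2 := (hF.arr 2 rfl).trans (hs.arr 2 (by norm_num))
      have e18 : s1.var 18 = k := (hF.var 18 rfl).trans hk
      have e1 : s1.var 1 = d := ((hF.var 1 rfl).trans (hs.var 1 (by norm_num))).trans hB.var_one
      obtain ⟨a, rfl⟩ : ∃ a : Fin m, i = a := ⟨⟨i, hi⟩, rfl⟩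
      have hown : s₀.arr 2 k 0 = Q.owner k := by
        rw [hB.owner]
        simp [JoinQuery.initState]
      simp only [run_seq_fst, run_seq_snd]
      by_cases hao : a = Q.owner k
      · have hd : Q.colCount k a = d := by rw [hao, Q.colCount_owner]
        rw [run_ite_pos _ _ _ _ _ _ (by simp [NatExp.eval, hi1, e2, e18, hown, hao]),
          run_sketch S K _ _ _ _ a d (by simp [NatExp.eval, hi1]) (by simp [NatExp.eval, e1])]
        refine ⟨fun j hj => ?_, ?_⟩
        · by_cases hja : j = a
          · subst hja
            simp [NatExp.eval, hi1, Q.bufferMatrix_nil]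
            rw [hd]
          · have hja' : (j : ℕ) ≠ a := fun h => hja (Fin.ext h)
            simpa [NatExp.eval, hi1, hja'] using hI j (by omega)
        · simp [NatExp.cost, SketchCell.cost, Q.bufferMatrix_nil, JoinQuery.nnz_zero]
      · have hd : Q.colCount k a = 1 := Q.colCount_of_ne hao
        have hao' : (a : ℕ) ≠ Q.owner k := fun h => hao (Fin.ext h)
        rw [run_ite_neg _ _ _ _ _ _ (by simp [NatExp.eval, hi1, e2, e18, hown, hao']),
          run_sketch S K _ _ _ _ a 1 (by simp [NatExp.eval, hi1]) (by simp [NatExp.eval])]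
        refine ⟨fun j hj => ?_, ?_⟩
        · by_cases hja : j = a
          · subst hja
            simp [NatExp.eval, hi1, Q.bufferMatrix_nil]
            rw [hd]
          · have hja' : (j : ℕ) ≠ a := fun h => hja (Fin.ext h)
            simpa [NatExp.eval, hi1, hja'] using hI j (by omega)
        · simp [NatExp.cost, SketchCell.cost, Q.bufferMatrix_nil, JoinQuery.nnz_zero])
  refine ⟨fun j => a1 j j.2, ?_⟩
  simp only [NatExp.cost] at a2
  omega

theorem initColumn_spec {plan : List (PlanStep m d)} (N : ℕ) (k : Fin d) (s₀ s : MachineState R)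
    (hm : 0 < m) (hB : Base Q plan N s₀) (hs : Same s₀ s) (hk : s.var 18 = k) :
    FaqInv S k s₀ N Finset.univ Q.cols MulTree.leaf (initColumn.run S K s).1 ∧
      (initColumn.run S K s).2 ≤ 8 + m * (24 + d * 7) + N * (41 + K.sketch) := by
  unfold initColumn
  simp only [run_seq_fst, run_seq_snd]
  obtain ⟨a1, a2⟩ := initCols_spec (Q := Q) (plan := plan) S K s
    ((hs.var 0 (by norm_num)).trans hB.var_zero) ((hs.var 1 (by norm_num)).trans hB.var_one)
    ((hs.arr 1 (by norm_num)).trans hB.cols)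
  have hF1 := frame_run S K initCols s
  set s1 := (initCols.run S K s).1
  have hs1 := hs.of_frame hF1 (by decide) (by decide)
  obtain ⟨b1, b2⟩ := initValues_spec S K N k s₀ s1 hB hs1 ((hF1.var 18 rfl).trans hk)
  have hF2 := frame_run S K initValues s1
  set s2 := (initValues.run S K s1).1
  have hs2 := hs1.of_frame hF2 (by decide) (by decide)
  obtain ⟨c1, c2⟩ := initZeros_spec S K N k s₀ s2 hB hs2
    ((hF2.var 18 rfl).trans ((hF1.var 18 rfl).trans hk))
  have hF3 := frame_run S K initZeros s2
  set s3 := (initZeros.run S K s2).1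
  refine ⟨⟨?_, ?_, ?_, ?_, ?_⟩, ?_⟩
  · intro j _ e he hej
    simp only [run_assign, MachineState.setVar_sk]
    rw [hF3.sk 1 rfl, (b1 e he).1, tupleSum_leaf]
    rw [itemsOf, Finset.mem_filter, Finset.mem_range]
    exact ⟨he, hej⟩
  · intro e he
    simp only [run_assign, MachineState.setVar_sk, MachineState.setVar_arr]
    rw [hF3.sk 1 rfl, hF3.arr 10 rfl, (b1 e he).2]
    refine ⟨fun _ hnone => ?_, fun _ => one_ne_zero⟩
    have h1 := (b1 e he).1
    have hlt : s₀.arr 4 e 0 < m := by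
      have := (hB.prepared.items.range e he).1
      omega
    unfold itemVal at h1
    rw [hnone, dif_pos hlt] at h1
    exact Option.some_ne_none _ (S.val_injective h1).symm
  · intro j _
    exact c1 j
  · intro i c
    simp only [run_assign, MachineState.setVar_arr]
    rw [hF3.arr 9 rfl, hF2.arr 9 rfl]
    exact a1 i c
  -- Register `28` names some live table throughout. Its initial value `0` matters if there is only
  -- one table and hence no absorption.
  · exact ⟨⟨0, hm⟩, Finset.mem_univ _, by simp [NatExp.eval]⟩
  · simp only [run_assign, NatExp.cost]
    have : m * (24 + d * 7) = m * (3 + d * 7) + m * 21 := by ring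
    omega

/-- No sketch changes, since values are attached to rows of the original table. Clearing the
incidence bit makes later key computations ignore the column. -/
theorem stepProg_sumOut_spec {plan : List (PlanStep m d)} (N : ℕ) (k : Fin d)
    (s₀ s : MachineState R) (hB : Base Q plan N s₀) (hs : Same s₀ s) (live : Finset (Fin m))
    (cols' : Fin m → Finset (Fin d)) (tree : Fin m → MulTree m) (hI : FaqInv S k s₀ N live cols' tree s)
    (hst : StampInv s) (p : ℕ) (hp : s.var 22 = p) (hlen : p < plan.length) (i : Fin m) (c : Fin d)
    (hplan : plan[p] = .sumOut i c) :
    FaqInv S k s₀ N live (Function.update cols' i ((cols' i).erase c)) tree (stepProg.run S K s).1 ∧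
      StampInv (stepProg.run S K s).1 ∧ (stepProg.run S K s).2 ≤ 20 := by
  have e3 : s.arr 3 = (Q.initState plan R).arr 3 := (hs.arr 3 (by norm_num)).trans hB.steps
  unfold stepProg
  rw [run_ite_pos _ _ _ _ _ _
    (by simp [NatExp.eval, hp, e3, JoinQuery.initState, hlen, hplan, JoinQuery.planCode])]
  refine ⟨⟨hI.val, ?_, hI.zero, ?_, hI.fin⟩, ⟨?_, ?_, ?_⟩, by simp [NatExp.cost]⟩
  · intro e he
    simpa using hI.pres e he
  · intro a c'
    have h1 := hI.cols a c'
    by_cases ha : a = i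
    · subst ha
      rw [Function.update_self, Finset.mem_erase]
      by_cases hc : c' = c
      · simp [NatExp.eval, hp, e3, JoinQuery.initState, hlen, hplan, JoinQuery.planCode, hc]
      · have hc' : (c' : ℕ) ≠ c := fun h => hc (Fin.ext h)
        simpa [NatExp.eval, hp, e3, JoinQuery.initState, hlen, hplan, JoinQuery.planCode, hc, hc']
          using h1
    · have ha' : (a : ℕ) ≠ i := fun h => ha (Fin.ext h)
      rw [Function.update_of_ne ha]
      simpa [NatExp.eval, hp, e3, JoinQuery.initState, hlen, hplan, JoinQuery.planCode, ha'] using h1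
  · convert hst.trie using 1
    · funext n' s'
      simp
    · simp
  · intro st h κ
    simpa using hst.flag st h κ
  · exact hst.acc

/-- Sums over equal keys computed by the machine are matched with the sums over matching items in
`tupleSum_join`, whose condition on the schema is `SchemaInv.consistent_union`. -/
theorem stepProg_absorb_spec {plan : List (PlanStep m d)} (N : ℕ) (k : Fin d)
    (s₀ s : MachineState R) (hB : Base Q plan N s₀) (hs : Same s₀ s) (live : Finset (Fin m))
    (cols' : Fin m → Finset (Fin d)) (tree : Fin m → MulTree m) (hI : FaqInv S k s₀ N live cols' tree s)
    (hst : StampInv s) (p : ℕ) (hp : s.var 22 = p) (hlen : p < plan.length) (i j : Fin m) (b : Bool)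
    (hplan : plan[p] = .absorb i j b) (hinv : SchemaInv Q.cols live cols' tree) (hi : i ∈ live)
    (hj : j ∈ live) (hij : i ≠ j) (hsub : cols' i ⊆ cols' j) :
    FaqInv S k s₀ N (live.erase i) cols'
        (Function.update tree j (MulTree.join b (tree i) (tree j))) (stepProg.run S K s).1 ∧
      StampInv (stepProg.run S K s).1 ∧
      (stepProg.run S K s).2 ≤
        70 + N * 100 + d * (7 + N * 41) + N * (K.add + K.mul) + K.mul := by
  have e3 : s.arr 3 = (Q.initState plan R).arr 3 := (hs.arr 3 (by norm_num)).trans hB.steps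
  unfold stepProg
  rw [run_ite_neg _ _ _ _ _ _
    (by simp [NatExp.eval, hp, e3, JoinQuery.initState, hlen, hplan, JoinQuery.planCode])]
  simp only [run_seq_fst, run_seq_snd]
  set s1 := ((Prog.assign 27 (.get 3 (.var 22) (.const 3))).run S K
    ((Prog.assign 26 (.get 3 (.var 22) (.const 2))).run S K
      ((Prog.assign 25 (.get 3 (.var 22) (.const 1))).run S K s).1).1).1 with hs1
  have earr : s1.arr = s.arr := by simp [hs1]
  have esk : s1.sk = s.sk := by simp [hs1]
  have e25 : s1.var 25 = i := by
    simp [hs1, NatExp.eval, hp, e3, JoinQuery.initState, hlen, hplan, JoinQuery.planCode]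
  have e26 : s1.var 26 = j := by
    simp [hs1, NatExp.eval, hp, e3, JoinQuery.initState, hlen, hplan, JoinQuery.planCode]
  have e27 : s1.var 27 = if b then 1 else 0 := by
    simp [hs1, NatExp.eval, hp, e3, JoinQuery.initState, hlen, hplan, JoinQuery.planCode]
  have evar : ∀ x, x < 25 → s1.var x = s.var x := by
    intro x hx
    have h1 : x ≠ 25 := by omega
    have h2 : x ≠ 26 := by omega
    have h3 : x ≠ 27 := by omega
    simp [hs1, h1, h2, h3]
  obtain ⟨a1, ⟨key, a2, a3⟩, a4, a5, a6, a7⟩ := absorb_spec S K s1 N i j b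
    (by rw [evar 3 (by norm_num), hs.var 3 (by norm_num), hB.prepared.var_three])
    (by rw [evar 1 (by norm_num), hs.var 1 (by norm_num), hB.var_one]) e25 e26 e27
    ⟨by rw [earr, evar 24 (by norm_num)]; exact hst.trie,
      by rw [earr, evar 23 (by norm_num)]; exact hst.flag,
      by rw [esk, evar 23 (by norm_num)]; exact hst.acc⟩
    (by rw [earr, esk]; exact hI.pres)
  have hF := frame_run S K absorb s1
  rw [earr, esk] at a3
  rw [earr] at a2
  rw [esk] at a5
  have f4 : s.arr 4 = s₀.arr 4 := hs.arr 4 (by norm_num)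
  have f8 : s.arr 8 = s₀.arr 8 := hs.arr 8 (by norm_num)
  rw [f4] at a3
  -- Nonzero bits in row `i` of array `9` are the current columns of `i`, and equal value numbers
  -- there mean equal entries.
  have hkey : ∀ e < N, ∀ e' < N, key e' = key e ↔
      ∀ c ∈ cols' i, itemEntry Q s₀ e' c = itemEntry Q s₀ e c := by
    intro e he e' he'
    rw [a2 e' he' e he, f8]
    constructor
    · intro h c hc
      exact (hB.prepared.ids c c.2 e' he' e he).1 (h c c.2 ((hI.cols i c).2 hc))
    · intro h c hc hcur
      exact (hB.prepared.ids c hc e' he' e he).2 (h ⟨c, hc⟩ ((hI.cols i ⟨c, hc⟩).1 hcur))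
  refine ⟨⟨?_, a4, ?_, ?_, ⟨j, Finset.mem_erase.2 ⟨hij.symm, hj⟩, a6⟩⟩, a1, ?_⟩
  · intro l hl e he hel
    rw [Finset.mem_erase] at hl
    rw [a3 e he]
    by_cases hlj : l = j
    · subst hlj
      rw [if_pos hel, Function.update_self, tupleSum_join _ _ _ _ _ _ _ i l
        (hinv.disjoint i hi l hj hij) (hinv.self_mem i) (hinv.self_mem l) (cols' i)
        (hinv.consistent_union hi hj hij hsub _) e (fun e' => key e' = key e)
        (fun e' he' => hkey e he e' (by
          rw [itemsOf, Finset.mem_filter, Finset.mem_range] at he'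
          exact he'.1)), hI.val l hj e he hel]
      congr 1
      rw [itemsOf, Finset.filter_filter]
      refine Finset.sum_congr rfl fun e' he' => ?_
      rw [Finset.mem_filter, Finset.mem_range] at he'
      exact hI.val i hi e' he'.1 he'.2.1
    · have hlj' : s₀.arr 4 e 0 ≠ j := fun h => hlj (Fin.ext (hel.symm.trans h))
      rw [if_neg hlj', Function.update_of_ne hlj]
      exact hI.val l hl.2 e he hel
  · intro l hl
    rw [Finset.mem_erase] at hl
    apply S.val_injective
    rw [a5]
    by_cases hlj : l = j
    · subst hlj
      rw [if_pos rfl, Function.update_self, hI.zero i hi, hI.zero l hj, ← S.val_eval,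
        ← S.val_eval, ← S.val_eval, MulTree.eval_join]
    · rw [if_neg (fun h => hlj (Fin.ext h)), Function.update_of_ne hlj, hI.zero l hl.2]
  · intro a c
    rw [hF.arr 9 rfl, earr]
    exact hI.cols a c
  · simp only [run_assign, NatExp.cost]
    omega

/-- The induction is along the run, whose steps form a prefix of the stored plan. It speaks of
`iter` rather than of a loop invariant because the live tables, columns and trees are those of the
constructor at hand. -/
theorem planLoop_spec {plan : List (PlanStep m d)} (N : ℕ) (k : Fin d) (s₀ s : MachineState R)
    (hB : Base Q plan N s₀) (hs : Same s₀ s)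
    (hI : FaqInv S k s₀ N Finset.univ Q.cols MulTree.leaf s) (hst : StampInv s)
    {pl : List (PlanStep m d)} {live : Finset (Fin m)} {cols' : Fin m → Finset (Fin d)}
    {tree : Fin m → MulTree m} (h : PlanRun Q.cols pl live cols' tree) (hpre : pl <+: plan) :
    FaqInv S k s₀ N live cols' tree (iter S K 22 stepProg s pl.length).1 ∧
      StampInv (iter S K 22 stepProg s pl.length).1 ∧
      (iter S K 22 stepProg s pl.length).2 ≤ pl.length * 21 + absorbCount pl *
        (70 + N * 100 + d * (7 + N * 41) + N * (K.add + K.mul) + K.mul) := by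
  -- the state before the next step
  have hnext : ∀ (p : ℕ) (live : Finset (Fin m)) (cols' : Fin m → Finset (Fin d))
      (tree : Fin m → MulTree m), FaqInv S k s₀ N live cols' tree (iter S K 22 stepProg s p).1 →
      StampInv (iter S K 22 stepProg s p).1 →
      Same s₀ ((iter S K 22 stepProg s p).1.setVar 22 p) ∧
      FaqInv S k s₀ N live cols' tree ((iter S K 22 stepProg s p).1.setVar 22 p) ∧
      StampInv ((iter S K 22 stepProg s p).1.setVar 22 p) := by
    intro p live cols' tree h1 h2
    -- What a loop can write does not depend on its bound, so any expression will do here.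
    have h3 := hs.of_frame (frame_iter S K 22 stepProg (.const 0) s (frame_run S K stepProg) p)
      (by decide) (by decide)
    refine ⟨⟨fun x hx => ?_, h3.arr⟩, ⟨h1.val, h1.pres, h1.zero, h1.cols, ?_⟩, ⟨?_, ?_, ?_⟩⟩
    · rw [MachineState.setVar_var, if_neg (by omega)]
      exact h3.var x hx
    · simpa using h1.fin
    · simpa using h2.trie
    · simpa using h2.flag
    · simpa using h2.acc
  induction h with
  | start => exact ⟨hI, hst, by simp [iter]⟩
  | @sumOut pl live cols' tree h i c hi hc honly ih =>
    obtain ⟨b1, b2, b3⟩ := ih ((List.prefix_append _ _).trans hpre)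
    obtain ⟨g1, g2, g3⟩ := hnext _ _ _ _ b1 b2
    have hlen : pl.length < plan.length := by
      have := hpre.length_le
      simp at this
      omega
    have hget : plan[pl.length] = .sumOut i c := by
      rw [← hpre.getElem (by simp)]
      simp
    obtain ⟨c1, c2, c3⟩ := stepProg_sumOut_spec S K N k s₀ _ hB g1 live cols' tree g2 g3 pl.length
      (by simp) hlen i c hget
    rw [List.length_append, List.length_singleton]
    refine ⟨c1, c2, ?_⟩
    have hcount : absorbCount (pl ++ [PlanStep.sumOut i c]) = absorbCount pl := by
      simp [absorbCount]
    rw [hcount]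
    simp only [iter]
    omega
  | @absorb pl live cols' tree h i j b hi hj hij hsub ih =>
    obtain ⟨b1, b2, b3⟩ := ih ((List.prefix_append _ _).trans hpre)
    obtain ⟨g1, g2, g3⟩ := hnext _ _ _ _ b1 b2
    have hlen : pl.length < plan.length := by
      have := hpre.length_le
      simp at this
      omega
    have hget : plan[pl.length] = .absorb i j b := by
      rw [← hpre.getElem (by simp)]
      simp
    obtain ⟨c1, c2, c3⟩ := stepProg_absorb_spec S K N k s₀ _ hB g1 live cols' tree g2 g3 pl.length
      (by simp) hlen i j b hget h.schemaInv hi hj hij hsub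
    rw [List.length_append, List.length_singleton]
    refine ⟨c1, c2, ?_⟩
    have hcount : absorbCount (pl ++ [PlanStep.absorb i j b]) = absorbCount pl + 1 := by
      simp [absorbCount]
    rw [hcount, Nat.succ_mul (absorbCount pl)]
    simp only [iter]
    omega

theorem addOut_spec (u : SketchCell) (s : MachineState R) (hu : u.value s ≠ none)
    (h29 : s.var 29 ≠ 0 ↔ s.sk 0 0 0 ≠ none) :
    S.val (((addOut u).run S K s).1.sk 0 0 0) = S.val (s.sk 0 0 0) + S.val (u.value s) ∧
      (((addOut u).run S K s).1.var 29 ≠ 0 ↔ ((addOut u).run S K s).1.sk 0 0 0 ≠ none) ∧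
      ((addOut u).run S K s).2 ≤ 10 + u.cost + K.add := by
  unfold addOut
  by_cases h : s.var 29 = 0
  · have hn : s.sk 0 0 0 = none := by
      by_contra hne
      exact h29.2 hne h
    rw [run_ite_neg _ _ _ _ _ _ (by simpa [NatExp.eval] using h)]
    refine ⟨?_, ?_, ?_⟩
    · simp [NatExp.eval, hn, DBSketch.val_none]
    · simpa [NatExp.eval] using hu
    · simp [NatExp.cost, SketchCell.cost]
      omega
  · have hn := h29.1 h
    rw [run_ite_pos _ _ _ _ _ _ (by simpa [NatExp.eval] using h)]
    refine ⟨?_, ?_, ?_⟩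
    · simp only [run_sketchAdd, MachineState.setCell_sk, NatExp.eval, and_self, if_true]
      exact S.val_map_add hn hu
    · simp [NatExp.eval, h, SketchCell.value, hn, Option.map₂_eq_none_iff]
      simpa [SketchCell.value] using hu
    · simp [NatExp.cost, SketchCell.cost]
      omega

/-- Summing over the rows of the last table completes the query. The product of zero sketches is
added first; it is always present, so there is an output even if the join is empty. -/
theorem finishColumn_spec (N j : ℕ) (s : MachineState R) (hN : s.var 3 = N) (hj : s.var 28 = j)
    (hz : s.sk 2 j 0 ≠ none) (h29 : s.var 29 ≠ 0 ↔ s.sk 0 0 0 ≠ none)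
    (hpres : ∀ e < N, s.arr 10 e 0 ≠ 0 ↔ s.sk 1 e 0 ≠ none) :
    S.val ((finishColumn.run S K s).1.sk 0 0 0) = S.val (s.sk 0 0 0) + (S.val (s.sk 2 j 0) +
        ∑ e ∈ Finset.range N with s.arr 4 e 0 = j, S.val (s.sk 1 e 0)) ∧
      ((finishColumn.run S K s).1.var 29 ≠ 0 ↔ (finishColumn.run S K s).1.sk 0 0 0 ≠ none) ∧
      (finishColumn.run S K s).2 ≤ 14 + K.add + N * (31 + K.add) := by
  unfold finishColumn
  simp only [run_seq_fst, run_seq_snd]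
  have hv : (⟨2, .var 28, .const 0⟩ : SketchCell).value s = s.sk 2 j 0 := by
    simp [SketchCell.value, NatExp.eval, hj]
  obtain ⟨a1, a2, a3⟩ := addOut_spec S K ⟨2, .var 28, .const 0⟩ s (by rwa [hv]) h29
  have hF1 := frame_run S K (addOut ⟨2, .var 28, .const 0⟩) s
  set s1 := ((addOut ⟨2, .var 28, .const 0⟩).run S K s).1
  obtain ⟨⟨b1, b2⟩, b3⟩ := loop_rule_const S K 21 (.var 3)
    (.ite (.eq (.get 4 (.var 21) (.const 0)) (.var 28))
      (.ite (.get 10 (.var 21) (.const 0)) (addOut ⟨1, .var 21, .const 0⟩) .skip) .skip) s1 N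
    (by simp only [NatExp.eval]; rw [hF1.var 3 rfl, hN])
    (fun k s' => S.val (s'.sk 0 0 0) = S.val (s1.sk 0 0 0) +
        ∑ e ∈ Finset.range k with s.arr 4 e 0 = j, S.val (s.sk 1 e 0) ∧
      (s'.var 29 ≠ 0 ↔ s'.sk 0 0 0 ≠ none)) (30 + K.add) (fun k s v h => by simpa using h)
    ⟨by simp, a2⟩ (by
      intro e he s2 hF he2 hI
      obtain ⟨h1, h2⟩ := hI
      have f4 : s2.arr 4 = s.arr 4 := by rw [hF.arr 4 rfl, hF1.arr 4 rfl]
      have f10 : s2.arr 10 = s.arr 10 := by rw [hF.arr 10 rfl, hF1.arr 10 rfl]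
      have fs1 : s2.sk 1 = s.sk 1 := by rw [hF.sk 1 rfl, hF1.sk 1 rfl]
      have f28 : s2.var 28 = j := by rw [hF.var 28 rfl, hF1.var 28 rfl, hj]
      have hsum : S.val (s1.sk 0 0 0) +
          ∑ e ∈ Finset.range (e + 1) with s.arr 4 e 0 = j, S.val (s.sk 1 e 0) =
          S.val (s2.sk 0 0 0) + if s.arr 4 e 0 = j then S.val (s.sk 1 e 0) else 0 := by
        rw [h1, Finset.sum_filter, Finset.sum_filter, Finset.sum_range_succ, add_assoc]
      rw [hsum]
      by_cases hej : s.arr 4 e 0 = j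
      · rw [run_ite_pos _ _ _ _ _ _ (by simp [NatExp.eval, he2, f4, f28, hej])]
        by_cases hp : s.arr 10 e 0 = 0
        · rw [run_ite_neg _ _ _ _ _ _ (by simp [NatExp.eval, he2, f10, hp])]
          have hn : s.sk 1 e 0 = none := by
            by_contra hne
            exact (hpres e he).2 hne hp
          refine ⟨⟨?_, h2⟩, by simp [NatExp.cost]; omega⟩
          rw [hn, DBSketch.val_none, ite_self, add_zero, run_skip]
        · rw [run_ite_pos _ _ _ _ _ _ (by simp [NatExp.eval, he2, f10, hp])]
          have hve : (⟨1, .var 21, .const 0⟩ : SketchCell).value s2 = s.sk 1 e 0 := by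
            simp [SketchCell.value, NatExp.eval, he2, fs1]
          obtain ⟨c1, c2, c3⟩ := addOut_spec S K ⟨1, .var 21, .const 0⟩ s2
            (by rw [hve]; exact (hpres e he).1 hp) h2
          rw [hve] at c1
          rw [if_pos hej]
          refine ⟨⟨c1, c2⟩, ?_⟩
          simp only [NatExp.cost, SketchCell.cost] at c3 ⊢
          omega
      · rw [run_ite_neg _ _ _ _ _ _ (by simp [NatExp.eval, he2, f4, f28, hej])]
        refine ⟨⟨?_, h2⟩, by simp [NatExp.cost]; omega⟩
        rw [if_neg hej, add_zero, run_skip])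
  refine ⟨?_, b2, ?_⟩
  · rw [b1, a1, hv, add_assoc]
  · have : 30 + K.add + 1 = 31 + K.add := by omega
    rw [this] at b3
    simp only [NatExp.cost, SketchCell.cost] at a3 b3
    omega

-- Items correspond bijectively to pairs of a table and a row, so consistent tuples of items are
-- consistent choices of rows.
open Classical in
theorem sum_tuples_eq {plan : List (PlanStep m d)} (N : ℕ) (k : Fin d) (s₀ : MachineState R)
    (hB : Base Q plan N s₀) :
    ∑ f ∈ tuples Q.cols (itemsOf s₀ N) (itemEntry Q s₀) Finset.univ,
        ρ.eval (· * ·) (fun i => itemVal S k s₀ (f i)) =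
      ∑ f : ∀ i, Fin (Q.size i) with Q.Consistent f,
        S.val (some (ρ.eval S.mul fun i => S.part i (Q.colCount k i) (Q.factor k i (f i)))) := by
  have hsz : ∀ i : Fin m, (Q.initState plan R).arr 0 i 0 = Q.size i := by
    intro i
    simp [JoinQuery.initState]
  have hitem : ∀ (i : Fin m) (e : ℕ), e ∈ itemsOf s₀ N i →
      e < N ∧ s₀.arr 4 e 0 = i ∧ s₀.arr 5 e 0 < Q.size i := by
    intro i e he
    rw [itemsOf, Finset.mem_filter, Finset.mem_range] at he
    have h1 := (hB.prepared.items.range e he.1).2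
    simp only [he.2, hsz] at h1
    exact ⟨he.1, he.2, h1⟩
  have hmem : ∀ f ∈ tuples Q.cols (itemsOf s₀ N) (itemEntry Q s₀) Finset.univ,
      (∀ i, f i ∈ itemsOf s₀ N i) ∧ TupleConsistent Q.cols (itemEntry Q s₀) Finset.univ f := by
    intro f hf
    rw [mem_tuples] at hf
    exact ⟨fun i => hf.1 i (Finset.mem_univ i), hf.2.2⟩
  refine Finset.sum_bij (fun f hf i => ⟨s₀.arr 5 (f i) 0, (hitem i _ ((hmem f hf).1 i)).2.2⟩)
    ?_ ?_ ?_ ?_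
  · intro f hf
    rw [Finset.mem_filter]
    refine ⟨Finset.mem_univ _, fun a b c ha hb => ?_⟩
    have h1 := (hmem f hf).2 a (Finset.mem_univ a) b (Finset.mem_univ b) c ha hb
    unfold itemEntry at h1
    rwa [(hitem a _ ((hmem f hf).1 a)).2.1, (hitem b _ ((hmem f hf).1 b)).2.1] at h1
  · intro f hf f' hf' heq
    funext i
    obtain ⟨h1, h2, -⟩ := hitem i _ ((hmem f hf).1 i)
    obtain ⟨h3, h4, -⟩ := hitem i _ ((hmem f' hf').1 i)
    exact hB.prepared.items.inj _ h1 _ h3 (h2.trans h4.symm) (congrArg Fin.val (congrFun heq i))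
  · intro f hf
    rw [Finset.mem_filter] at hf
    have hex : ∀ i : Fin m, ∃ e < N, s₀.arr 4 e 0 = i ∧ s₀.arr 5 e 0 = f i := by
      intro i
      refine hB.prepared.items.surj i (f i) (Or.inl ⟨i.2, ?_⟩)
      simp only [hsz]
      exact (f i).2
    choose f' h1 h2 h3 using hex
    refine ⟨f', ?_, ?_⟩
    · rw [mem_tuples]
      refine ⟨fun i _ => ?_, fun i hi => absurd (Finset.mem_univ i) hi, fun a _ b _ c ha hb => ?_⟩
      · rw [itemsOf, Finset.mem_filter, Finset.mem_range]
        exact ⟨h1 i, h2 i⟩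
      · unfold itemEntry
        rw [h2, h3, h2, h3]
        exact hf.2 a b c ha hb
    · funext i
      exact Fin.ext (h3 i)
  · intro f hf
    rw [← S.val_eval]
    refine MulTree.eval_congr _ _ fun i _ => ?_
    obtain ⟨h1, h2, h3⟩ := hitem i _ ((hmem f hf).1 i)
    unfold itemVal
    have hlt : s₀.arr 4 (f i) 0 < m := h2 ▸ i.2
    have hi : (⟨s₀.arr 4 (f i) 0, hlt⟩ : Fin m) = i := Fin.ext h2
    rw [dif_pos hlt, hi]

open Classical in
theorem columnProg_spec {plan : List (PlanStep m d)} (hρ : Q.IsMulOrder plan ρ) (N : ℕ)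
    (k : Fin d) (s₀ s : MachineState R) (hm : 0 < m) (hB : Base Q plan N s₀) (hs : Same s₀ s)
    (hk : s.var 18 = k) (hst : StampInv s) (h29 : s.var 29 ≠ 0 ↔ s.sk 0 0 0 ≠ none) :
    S.val ((columnProg.run S K s).1.sk 0 0 0) = S.val (s.sk 0 0 0) +
        (S.val (some (ρ.eval S.mul fun i => S.part i (Q.colCount k i) 0)) +
          ∑ f : ∀ i, Fin (Q.size i) with Q.Consistent f,
            S.val (some (ρ.eval S.mul fun i => S.part i (Q.colCount k i) (Q.factor k i (f i))))) ∧
      ((columnProg.run S K s).1.var 29 ≠ 0 ↔ (columnProg.run S K s).1.sk 0 0 0 ≠ none) ∧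
      StampInv (columnProg.run S K s).1 ∧
      (columnProg.run S K s).2 ≤ 24 + K.add + m * (24 + d * 7) + N * (72 + K.sketch + K.add) +
        (m + m * d) * 21 + m * (70 + N * 100 + d * (7 + N * 41) + N * (K.add + K.mul) + K.mul) := by
  obtain ⟨j, cols', tree, hrun, hcols, rfl⟩ := hρ
  unfold columnProg
  simp only [run_seq_fst, run_seq_snd]
  obtain ⟨a1, a2⟩ := initColumn_spec S K N k s₀ s hm hB hs hk
  have hF1 := frame_run S K initColumn s
  set s1 := (initColumn.run S K s).1
  have hs1 := hs.of_frame hF1 (by decide) (by decide)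
  have hst1 : StampInv s1 := by
    refine ⟨?_, ?_, ?_⟩
    · rw [hF1.arr 12 rfl, hF1.var 24 rfl]
      exact hst.trie
    · rw [hF1.arr 13 rfl, hF1.var 23 rfl]
      exact hst.flag
    · rw [hF1.sk 3 rfl, hF1.var 23 rfl]
      exact hst.acc
  obtain ⟨b1, b2, b3⟩ := planLoop_spec S K N k s₀ s1 hB hs1 a1 hst1 hrun List.prefix_rfl
  have hF2 := frame_run S K (.loop 22 (.var 2) stepProg) s1
  have hlen : (NatExp.var 2).eval s1 = plan.length := (hs1.var 2 (by norm_num)).trans hB.var_two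
  have hloop := run_loop S K 22 (.var 2) stepProg s1
  rw [hlen] at hloop
  rw [hloop] at hF2 ⊢
  simp only at hF2 ⊢
  set s2 := (iter S K 22 stepProg s1 plan.length).1
  have hs2 := hs1.of_frame hF2 (by decide) (by decide)
  obtain ⟨j', hj', h28⟩ := b1.fin
  rw [Finset.mem_singleton] at hj'
  subst hj'
  have hjm := Finset.mem_singleton_self j'
  obtain ⟨c1, c2, c3⟩ := finishColumn_spec S K N j' s2
    ((hs2.var 3 (by norm_num)).trans hB.prepared.var_three) h28
    (by rw [b1.zero j' hjm]; exact Option.some_ne_none _)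
    (by rw [hF2.var 29 rfl, hF1.var 29 rfl, hF2.sk 0 rfl, hF1.sk 0 rfl]; exact h29) b1.pres
  have hF3 := frame_run S K finishColumn s2
  -- With one live table left, `cover` puts every table into its tree, so the last factor ranges
  -- over all consistent choices.
  have hleaves : (tree j').leaves = Finset.univ := by
    ext a
    obtain ⟨i, hi, ha⟩ := hrun.schemaInv.cover a
    rw [Finset.mem_singleton] at hi
    simpa [hi] using ha
  refine ⟨?_, c2, ⟨?_, ?_, ?_⟩, ?_⟩
  · rw [c1, b1.zero j' hjm, hF2.sk 0 rfl, hF1.sk 0 rfl, hs2.arr 4 (by norm_num),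
      ← sum_tuples_eq S N k s₀ hB, ← hleaves]
    have h1 := sum_tupleSum Q.cols (itemsOf s₀ N) (itemEntry Q s₀) (itemVal S k s₀) (tree j') j'
      (hrun.schemaInv.self_mem j') (fun _ => True)
    rw [Finset.filter_true, Finset.filter_true] at h1
    rw [← h1]
    congr 2
    refine Finset.sum_congr rfl fun e he => ?_
    rw [itemsOf, Finset.mem_filter, Finset.mem_range] at he
    exact b1.val j' hjm e he.1 he.2
  · rw [hF3.arr 12 rfl, hF3.var 24 rfl]
    exact b2.trie
  · rw [hF3.arr 13 rfl, hF3.var 23 rfl]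
    exact b2.flag
  · rw [hF3.sk 3 rfl, hF3.var 23 rfl]
    exact b2.acc
  · have h1 := hrun.card_live
    have h2 := hrun.length_le
    have h3 : plan.length * 21 ≤ (m + m * d) * 21 := Nat.mul_le_mul_right _ (by omega)
    have h4 := Nat.mul_le_mul_right
      (70 + N * 100 + d * (7 + N * 41) + N * (K.add + K.mul) + K.mul)
      (show absorbCount plan ≤ m by omega)
    have h5 : N * (72 + K.sketch + K.add) = N * (41 + K.sketch) + N * (31 + K.add) := by ring
    simp only [NatExp.cost]
    omega

end

end Prog

/-! ### The theorem -/

/-- From `m < 2 ^ m` one gets `log (m n) ≤ m + log n` up to a constant. Using `m` for `log m` is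
affordable, because sorting happens once and not once per absorption, which leaves a factor `m` to
spare. -/
theorem passes_le {m n N L : ℕ} (hm : 0 < m) (hn : 0 < n) (hN : N ≤ m * n)
    (hL : 2 ^ L ≤ 2 * N + 1) : L ≤ 3 * m * (1 + Nat.log 2 n) := by
  have h1 : n < 2 ^ (Nat.log 2 n + 1) := Nat.lt_pow_succ_log_self (by norm_num) n
  have h2 : m < 2 ^ m := Nat.lt_two_pow_self
  have h3 : m * n < 2 ^ m * 2 ^ (Nat.log 2 n + 1) := by nlinarith
  have h4 : 2 ^ L < 2 ^ (m + (Nat.log 2 n + 1) + 2) := by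
    rw [pow_add _ _ 2, pow_add]
    have : 0 < m * n := Nat.mul_pos hm hn
    omega
  have h5 := (Nat.pow_lt_pow_iff_right (by norm_num : 1 < 2)).1 h4
  have h6 : Nat.log 2 n ≤ m * Nat.log 2 n := Nat.le_mul_of_pos_left _ hm
  nlinarith

/-- Here `l` stands for `1 + log n`, and `a`, `b`, `c` for the costs of `⊕`, `⊙` and of sketching
one entry. Every term without `c` is a constant times a divisor-like monomial below `U`, possibly
with a factor `a` or `b`; the terms with `c` are `d * N * c`. The constant `2000` is generous. -/
theorem time_le {m d n N L l a b c : ℕ} (hm : 0 < m) (hd : 0 < d) (hn : 0 < n) (hl : 0 < l)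
    (ha : 0 < a) (hN : N ≤ m * n) (hL : L ≤ 3 * m * l) :
    12 + m * (5 + n * 14) + N * 14 + d * (9 + N * 65 + L * (100 * N + 21)) + (2 + d * (24 + a +
      m * (24 + d * 7) + N * (72 + c + a) + (m + m * d) * 21 +
      m * (70 + N * 100 + d * (7 + N * 41) + N * (a + b) + b) + 1)) ≤
      2000 * (m * (b + a) * (m * d ^ 2 * n * l) + c * m * n * d) := by
  set U := m * m * d * d * n * l with hU
  have key : ∀ {x₁ x₂ y₁ y₂ z w : ℕ}, x₁ ≤ m → x₂ ≤ m → y₁ ≤ d → y₂ ≤ d → z ≤ n → w ≤ l →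
      x₁ * x₂ * y₁ * y₂ * z * w ≤ U := by
    intro x₁ x₂ y₁ y₂ z w h1 h2 h3 h4 h5 h6
    rw [hU]
    gcongr
  have u0 : 1 ≤ U := by simpa using key hm hm hd hd hn hl
  have u1 : m ≤ U := by simpa using key le_rfl hm hd hd hn hl
  have u2 : m * n ≤ U := by simpa using key le_rfl hm hd hd le_rfl hl
  have u3 : d ≤ U := by simpa using key hm hm le_rfl hd hn hl
  have u4 : m * d ≤ U := by simpa using key le_rfl hm le_rfl hd hn hl
  have u5 : m * d * d ≤ U := by simpa using key le_rfl hm le_rfl le_rfl hn hl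
  have u6 : m * d * n ≤ U := by simpa using key le_rfl hm le_rfl hd le_rfl hl
  have u7 : m * m * d * n ≤ U := by simpa using key le_rfl le_rfl le_rfl hd le_rfl hl
  have u8 : m * m * d * d * n ≤ U := by simpa using key le_rfl le_rfl le_rfl le_rfl le_rfl hl
  have u9 : m * m * d * n * l ≤ U := by
    simpa using key le_rfl le_rfl le_rfl hd le_rfl le_rfl
  have u10 : m * d * l ≤ U := by simpa using key le_rfl hm le_rfl hd hn le_rfl
  -- Plain machine steps are paid by the sketch operations, as `1 ≤ a`.
  have hX : U ≤ (b + a) * U := Nat.le_mul_of_pos_left _ (by omega)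
  have e1 : d * N ≤ U := (Nat.mul_le_mul_left d hN).trans (le_trans (le_of_eq (by ring)) u6)
  have e2 : d * (m * N) ≤ U := (Nat.mul_le_mul_left d (Nat.mul_le_mul_left m hN)).trans
    (le_trans (le_of_eq (by ring)) u7)
  have e3 : d * (m * (d * N)) ≤ U :=
    (Nat.mul_le_mul_left d (Nat.mul_le_mul_left m (Nat.mul_le_mul_left d hN))).trans
      (le_trans (le_of_eq (by ring)) u8)
  have e4 : d * (L * N) ≤ 3 * U := (Nat.mul_le_mul_left d (Nat.mul_le_mul hL hN)).trans
    (le_trans (le_of_eq (by ring)) (Nat.mul_le_mul_left 3 u9))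
  have e5 : d * L ≤ 3 * U := (Nat.mul_le_mul_left d hL).trans
    (le_trans (le_of_eq (by ring)) (Nat.mul_le_mul_left 3 u10))
  have f1 : a * d ≤ a * U := Nat.mul_le_mul_left a u3
  have f2 : a * (d * N) ≤ a * U := Nat.mul_le_mul_left a e1
  have f3 : (a + b) * (d * (m * N)) ≤ (a + b) * U := Nat.mul_le_mul_left _ e2
  have f4 : b * (m * d) ≤ b * U := Nat.mul_le_mul_left b u4
  have f5 : c * (d * N) ≤ c * (d * (m * n)) :=
    Nat.mul_le_mul_left c (Nat.mul_le_mul_left d hN)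
  have hR : m * (b + a) * (m * d ^ 2 * n * l) = (b + a) * U := by
    rw [hU]
    ring
  rw [hR]
  have z1 : 0 ≤ a * U := Nat.zero_le _
  have z2 : 0 ≤ b * U := Nat.zero_le _
  have z3 : 0 ≤ c * (d * (m * n)) := Nat.zero_le _
  clear_value U
  linarith

theorem JoinQuery.initState_size_le {m d : ℕ} (Q : JoinQuery m d) (plan : List (PlanStep m d))
    (R : Type*) (i : ℕ) : (Q.initState plan R).arr 0 i 0 ≤ Q.maxSize := by
  simp only [JoinQuery.initState]
  split_ifs with h
  · exact Finset.le_sup (f := Q.size) (Finset.mem_univ _)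
  · exact Nat.zero_le _

/-- The algorithm. -/
def sketchProg : Prog := .seq Prog.prepare (.loop 18 (.var 1) Prog.columnProg)

/-- The output cell collects the contributions of all columns, whose sum is the sketch of the join
by `sum_sketch_eq`. All scratch data survive from one column to the next; `StampInv` is what keeps
them harmless. -/
theorem sketchProg_spec {m d : ℕ} {Q : JoinQuery m d} (hd : 0 < d) (hn : 0 < Q.maxSize)
    {plan : List (PlanStep m d)} {ρ : MulTree m} (hρ : Q.IsMulOrder plan ρ) {R : Type*}
    (S : DBSketch Q ρ R) (K : SketchCosts) (hK : 0 < K.add) :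
    (sketchProg.run S K (Q.initState plan R)).1.sk 0 0 0 = some (S.F Q.joinMatrix) ∧
      (sketchProg.run S K (Q.initState plan R)).2 ≤
        2000 * (m * (K.mul + K.add) * Q.faqTime + K.sketch * m * Q.maxSize * d) := by
  classical
  -- Without tables the supremum of the sizes would be `0`.
  have hm : 0 < m := by
    by_contra h
    have : m = 0 := by omega
    subst this
    simp [JoinQuery.maxSize] at hn
  unfold sketchProg
  simp only [Prog.run_seq_fst, Prog.run_seq_snd]
  obtain ⟨N, L, a1, a2, a3⟩ := Prog.prepare_spec S K (Q.initState plan R) Q.maxSize rfl rfl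
    (Q.initState_size_le plan R)
  have hF := Prog.frame_run S K Prog.prepare (Q.initState plan R)
  set s₀ := (Prog.prepare.run S K (Q.initState plan R)).1
  have hB : Prog.Base Q plan N s₀ :=
    ⟨hF.var 0 rfl, hF.var 1 rfl, hF.var 2 rfl, hF.arr 1 rfl, hF.arr 2 rfl, hF.arr 3 rfl, a1⟩
  have hst : Prog.StampInv s₀ := by
    refine ⟨⟨?_, ?_⟩, ?_, ?_⟩
    · rw [hF.arr 12 rfl]
      exact fun _ _ => Nat.zero_le _
    · rw [hF.arr 12 rfl]
      exact fun _ _ _ _ h => absurd rfl h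
    · rw [hF.arr 13 rfl]
      exact fun _ _ _ => rfl
    · rw [hF.sk 3 rfl]
      exact fun _ _ _ => rfl
  have hout : s₀.sk 0 0 0 = none := by
    rw [hF.sk 0 rfl]
    rfl
  have h29 : s₀.var 29 = 0 := by
    rw [hF.var 29 rfl]
    rfl
  set T : Fin d → S.Val := fun k =>
    S.val (some (ρ.eval S.mul fun i => S.part i (Q.colCount k i) 0)) +
      ∑ f : ∀ i, Fin (Q.size i) with Q.Consistent f,
        S.val (some (ρ.eval S.mul fun i => S.part i (Q.colCount k i) (Q.factor k i (f i)))) with hT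
  obtain ⟨⟨-, -, b1⟩, b2⟩ := Prog.loop_rule_const S K 18 (.var 1) Prog.columnProg s₀ d
    hB.var_one
    (fun k s => Prog.StampInv s ∧ (s.var 29 ≠ 0 ↔ s.sk 0 0 0 ≠ none) ∧
      S.val (s.sk 0 0 0) = ∑ k' ∈ Finset.range k, if h : k' < d then T ⟨k', h⟩ else 0) _
    (fun k s v h => by
      obtain ⟨h1, h2, h3⟩ := h
      refine ⟨⟨?_, ?_, ?_⟩, by simpa using h2, h3⟩
      · simpa using h1.trie
      · simpa using h1.flag
      · simpa using h1.acc)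
    ⟨hst, by simp [hout, h29], by rw [hout]; simp [DBSketch.val_none]⟩
    (fun k hk s₁ hF₁ hk₁ hI => by
      obtain ⟨h1, h2, h3⟩ := hI
      obtain ⟨c1, c2, c3, c4⟩ := Prog.columnProg_spec S K hρ N ⟨k, hk⟩ s₀ s₁ hm hB
        (Prog.Same.of_frame ⟨fun _ _ => rfl, fun _ _ => rfl⟩ hF₁ (by decide) (by decide)) hk₁ h1 h2
      refine ⟨⟨c3, c2, ?_⟩, c4⟩
      rw [c1, h3, Finset.sum_range_succ, dif_pos hk])
  refine ⟨?_, ?_⟩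
  · apply S.val_injective
    rw [b1, Finset.sum_range, ← Q.sum_sketch_eq S hd]
    exact Finset.sum_congr rfl fun k _ => dif_pos k.2
  · have hN : N ≤ m * Q.maxSize := by
      simpa using a1.items.bound Q.maxSize (Q.initState_size_le plan R)
    refine (Nat.add_le_add a3 b2).trans ?_
    exact time_le hm hd hn (by omega) hK hN
      (passes_le hm hn hN a2)

theorem mainTheorem3 :
    ∃ (P : Prog) (C : ℕ),
      ∀ (m d : ℕ) (Q : JoinQuery m d), Q.Acyclic → 0 < d → 0 < Q.maxSize →
      ∀ (plan : List (PlanStep m d)) (ρ : MulTree m), Q.IsMulOrder plan ρ →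
      ∀ (R : Type*) (S : DBSketch Q ρ R) (K : SketchCosts), 0 < K.add → 0 < K.mul →
        (P.run S K (Q.initState plan R)).1.sk 0 0 0 = some (S.F Q.joinMatrix) ∧
        (P.run S K (Q.initState plan R)).2 ≤
          C * (m * (K.mul + K.add) * Q.faqTime + K.sketch * m * Q.maxSize * d) :=
  ⟨sketchProg, 2000, fun _ _ _ _ hd hn _ _ hρ _ S K hK _ => sketchProg_spec hd hn hρ S K hK⟩
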